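/- Let $k$ be a field. Schemes, morphisms and products are over $k$, and all schemes are separated and locally noetherian. Let $G$ be a connected smooth group scheme of finite type over $k$, and let $X$ be a reduced scheme equipped with an action $\alpha : G \times X \to X$. Write $p_2 : G \times X \to X$ for the projection and use the following notation. - $\mathcal{O}(X)^*$ is the group of invertible global functions on $X$, and $\mathcal{O}(X)^{*G}$ is its subgroup of $G$-invariant functions, i.e. of those $f$ with $\alpha^* f = p_2^* f$. - $\widehat{G}(X)$ is the group of homomorphisms of $X$-group schemes $G \times X \to \mathbb{G}_m \times X$, i.e. of invertible functions $\lambda$ on $G \times X$ such that $\lambda(gh,x) = \lambda(g,x)\lambda(h,x)$ identically. - $\mathrm{Pic}(Y)$ is the group of isomorphism classes of line bundles on $Y$, and $\mathrm{Pic}^G(X)$ is the group of isomorphism classes of $G$-linearized line bundles on $X$, i.e. of line bundles $\pi : L \to X$ with an action of $G$ on the total space $L$ that lifts $\alpha$ and commutes with scalar multiplication on the fibres; both group laws are given by the tensor product. Then: 1. For every $f \in \mathcal{O}(X)^*$ there is a (unique) $\chi(f) \in \widehat{G}(X)$ such that $f(\alpha(g,x)) = \chi(f)(g,x)\, f(x)$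 on $G \times X$, and $\chi : \mathcal{O}(X)^* \to \widehat{G}(X)$ is a homomorphism. 2. For every $\lambda \in \widehat{G}(X)$, the formula $g \cdot (x,t) = (\alpha(g,x), \lambda(g,x)\,t)$ defines a $G$-linearization of the trivial line bundle $X \times \mathbb{A}^1$, and sending $\lambda$ to the class of this linearized bundle is a homomorphism $\gamma : \widehat{G}(X) \to \mathrm{Pic}^G(X)$. 3. The sequence $$0 \to \mathcal{O}(X)^{*G} \to \mathcal{O}(X)^* \xrightarrow{\chi} \widehat{G}(X) \xrightarrow{\gamma} \mathrm{Pic}^G(X) \xrightarrow{\varphi} \mathrm{Pic}(X) \xrightarrow{\psi} \mathrm{Pic}(G \times X)/p_2^*\mathrm{Pic}(X)$$ is exact, where the first map is the inclusion, $\varphi$ forgets the linearization, and $\psi$ sends the class of $L$ to the image of the class of $\alpha^*(L)$. -/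

import Mathlib

attribute [-instance] CategoryTheory.catToReflQuiver

open CategoryTheory Limits MonoidalCategory CartesianMonoidalCategory AlgebraicGeometry
open scoped MonObj

universe u

noncomputable section

namespace EquivariantPicard

/-- Pull-back of global functions along a morphism of schemes. -/
def pullFun {S T : Scheme.{u}} (f : S ⟶ T) : Γ(T, ⊤) →+* Γ(S, ⊤) := f.appTop.hom

@[simp]
lemma pullFun_id (T : Scheme.{u}) (a : Γ(T, ⊤)) : pullFun (𝟙 T) a = a := by
  simp [pullFun]

lemma pullFun_comp {R S T : Scheme.{u}} (f : R ⟶ S) (g : S ⟶ T) (a : Γ(T, ⊤)) :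
    pullFun (f ≫ g) a = pullFun f (pullFun g a) := by
  simp [pullFun, Scheme.Hom.comp_appTop, -Scheme.Hom.comp_app]

/-- A scheme over `X` with a multiplication of its points by scalars. Scalar multiplication
`𝔸¹ × total ⟶ total` is given on `T`-valued points, functorially in `T`. -/
structure ScalarScheme (X : Scheme.{u}) where
  total : Scheme.{u}
  proj : total ⟶ X
  smul : ∀ {T : Scheme.{u}}, Γ(T, ⊤) → (T ⟶ total) → (T ⟶ total)
  smul_proj : ∀ {T : Scheme.{u}} (a : Γ(T, ⊤)) (l : T ⟶ total), smul a l ≫ proj = l ≫ proj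
  comp_smul : ∀ {S T : Scheme.{u}} (f : S ⟶ T) (a : Γ(T, ⊤)) (l : T ⟶ total),
    f ≫ smul a l = smul (pullFun f a) (f ≫ l)
  one_smul : ∀ {T : Scheme.{u}} (l : T ⟶ total), smul 1 l = l
  mul_smul : ∀ {T : Scheme.{u}} (a b : Γ(T, ⊤)) (l : T ⟶ total),
    smul (a * b) l = smul a (smul b l)

/-- A `T`-valued point `s` is a frame (a nowhere vanishing section over `T`) if every point of the
total space lying over the same point of `X`, after any base change, is a unique multiple of `s`:
that is, `a ↦ a • s` identifies `𝔸¹ × T` with the base change of the total space to `T`. -/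
def ScalarScheme.IsFrame {X : Scheme.{u}} (L : ScalarScheme X) {T : Scheme.{u}}
    (s : T ⟶ L.total) : Prop :=
  ∀ {S : Scheme.{u}} (f : S ⟶ T) (l : S ⟶ L.total), l ≫ L.proj = f ≫ s ≫ L.proj →
    ∃! a : Γ(S, ⊤), L.smul a (f ≫ s) = l

/-- A (geometric) line bundle `π : L ⟶ X`: a scheme over `X` with scalar multiplication which is
locally over `X` isomorphic to `𝔸¹ × X` with the usual multiplication. -/
structure LineBundle (X : Scheme.{u}) extends ScalarScheme X where
  exists_frame : ∀ x : X, ∃ (U : X.Opens) (_ : x ∈ U) (s : U.toScheme ⟶ total),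
    s ≫ proj = U.ι ∧ toScalarScheme.IsFrame s

/-- An isomorphism of line bundles on `X`: an isomorphism of schemes over `X` which commutes with
scalar multiplication. -/
structure LineBundle.Isom {X : Scheme.{u}} (L M : LineBundle X) where
  iso : L.total ≅ M.total
  hom_proj : iso.hom ≫ M.proj = L.proj
  smul_hom : ∀ {T : Scheme.{u}} (a : Γ(T, ⊤)) (l : T ⟶ L.total),
    L.smul a l ≫ iso.hom = M.smul a (l ≫ iso.hom)

namespace LineBundle

variable {X : Scheme.{u}}

attribute [simp] ScalarScheme.smul_proj ScalarScheme.one_smul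

lemma isFrame_comp {L : ScalarScheme X} {S T : Scheme.{u}} {s : T ⟶ L.total} (hs : L.IsFrame s)
    (f : S ⟶ T) : L.IsFrame (f ≫ s) := by
  intro R g l hl
  have := hs (g ≫ f) l (by simpa using hl)
  simpa using this

lemma frame_ext {L : ScalarScheme X} {T : Scheme.{u}} {s : T ⟶ L.total} (hs : L.IsFrame s)
    {a b : Γ(T, ⊤)} (h : L.smul a s = L.smul b s) : a = b :=
  (hs (𝟙 T) (L.smul b s) (by simp)).unique (by simpa using h) (by simp)

lemma frame_exists {L : ScalarScheme X} {T : Scheme.{u}} {s : T ⟶ L.total} (hs : L.IsFrame s)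
    (l : T ⟶ L.total) (h : l ≫ L.proj = s ≫ L.proj) : ∃ a : Γ(T, ⊤), L.smul a s = l := by
  obtain ⟨a, ha, -⟩ := hs (𝟙 T) l (by simpa using h)
  exact ⟨a, by simpa using ha⟩

lemma isFrame_smul {L : ScalarScheme X} {T : Scheme.{u}} {s : T ⟶ L.total} (hs : L.IsFrame s)
    {a b : Γ(T, ⊤)} (hab : b * a = 1) : L.IsFrame (L.smul a s) := by
  intro S f l hl
  obtain ⟨c, hc, hu⟩ := hs f l (by simpa using hl)
  have hab' : pullFun f b * pullFun f a = 1 := by rw [← map_mul, hab, map_one]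
  refine ⟨c * pullFun f b, ?_, fun d hd ↦ ?_⟩
  · change L.smul _ _ = l
    rw [L.comp_smul, ← L.mul_smul, mul_assoc, hab', mul_one, hc]
  · change L.smul _ _ = l at hd
    rw [L.comp_smul, ← L.mul_smul] at hd
    rw [← hu _ hd, mul_assoc, mul_comm (pullFun f a), hab', mul_one]

/-- Two frames over the same point differ by an invertible scalar. -/
lemma frame_ratio {L : ScalarScheme X} {T : Scheme.{u}} {s t : T ⟶ L.total} (hs : L.IsFrame s)
    (ht : L.IsFrame t) (h : t ≫ L.proj = s ≫ L.proj) :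
    ∃ a b : Γ(T, ⊤), b * a = 1 ∧ L.smul a s = t ∧ L.smul b t = s := by
  obtain ⟨a, ha⟩ := frame_exists hs t h
  obtain ⟨b, hb⟩ := frame_exists ht s h.symm
  refine ⟨a, b, frame_ext hs ?_, ha, hb⟩
  rw [L.mul_smul, ha, hb, L.one_smul]

/-- Every point of `X` with values in `T` lifts, locally on `T`, to a frame. -/
lemma exists_local_frame (L : LineBundle X) {T : Scheme.{u}} (x : T ⟶ X) (t : T) :
    ∃ (V : T.Opens) (_ : t ∈ V) (s : V.toScheme ⟶ L.total),
      s ≫ L.proj = V.ι ≫ x ∧ L.IsFrame s := by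
  obtain ⟨U, hU, s, hs, hf⟩ := L.exists_frame (x t)
  refine ⟨x ⁻¹ᵁ U, hU, (x ∣_ U) ≫ s, ?_, isFrame_comp hf _⟩
  rw [Category.assoc, hs, morphismRestrict_ι]

lemma exists_local_frame₂ (L M : LineBundle X) {T : Scheme.{u}} (x : T ⟶ X) (t : T) :
    ∃ (V : T.Opens) (_ : t ∈ V) (s : V.toScheme ⟶ L.total) (r : V.toScheme ⟶ M.total),
      (s ≫ L.proj = V.ι ≫ x ∧ L.IsFrame s) ∧ (r ≫ M.proj = V.ι ≫ x ∧ M.IsFrame r) := by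
  obtain ⟨V, hV, s, hs, hf⟩ := L.exists_local_frame x t
  obtain ⟨W, hW, r, hr, hg⟩ := M.exists_local_frame x t
  refine ⟨V ⊓ W, ⟨hV, hW⟩, T.homOfLE inf_le_left ≫ s, T.homOfLE inf_le_right ≫ r,
    ⟨?_, isFrame_comp hf _⟩, ⟨?_, isFrame_comp hg _⟩⟩
  · simp [hs]
  · simp [hr]

namespace Isom

attribute [simp] Isom.hom_proj

@[simp]
lemma hom_proj_assoc {L M : LineBundle X} (e : Isom L M) {Z : Scheme.{u}} (h : X ⟶ Z) :
    e.iso.hom ≫ M.proj ≫ h = L.proj ≫ h := by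
  rw [← Category.assoc, e.hom_proj]

/-- The identity isomorphism. -/
@[simps]
def refl (L : LineBundle X) : Isom L L where
  iso := Iso.refl _
  hom_proj := by simp
  smul_hom := by simp

/-- The inverse isomorphism. -/
@[simps]
def symm {L M : LineBundle X} (e : Isom L M) : Isom M L where
  iso := e.iso.symm
  hom_proj := by rw [Iso.symm_hom, Iso.inv_comp_eq, e.hom_proj]
  smul_hom a l := by
    rw [← cancel_mono e.iso.hom]
    simp [e.smul_hom]

/-- Composition of isomorphisms. -/
@[simps]
def trans {L M N : LineBundle X} (e : Isom L M) (f : Isom M N) : Isom L N where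
  iso := e.iso ≪≫ f.iso
  hom_proj := by simp
  smul_hom a l := by
    simp [e.smul_hom, f.smul_hom, ← Category.assoc]

lemma isFrame {L M : LineBundle X} (e : Isom L M) {T : Scheme.{u}} {s : T ⟶ L.total}
    (hs : L.IsFrame s) : M.IsFrame (s ≫ e.iso.hom) := by
  intro S f l hl
  obtain ⟨a, ha, hu⟩ := hs f (l ≫ e.symm.iso.hom)
    (by rw [Category.assoc, e.symm.hom_proj, hl, Category.assoc, e.hom_proj])
  have key (c : Γ(S, ⊤)) :
      M.smul c (f ≫ s ≫ e.iso.hom) = l ↔ L.smul c (f ≫ s) = l ≫ e.symm.iso.hom := by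
    rw [← Category.assoc, ← e.smul_hom, symm_iso, Iso.symm_hom, Iso.eq_comp_inv]
  exact ⟨a, (key a).2 ha, fun c hc ↦ hu c ((key c).1 hc)⟩

end Isom

end LineBundle

/-- A morphism prescribed locally by a pull-back stable and single-valued relation exists. -/
lemma exists_glue {T Y : Scheme.{u}} (P : ∀ {S : Scheme.{u}}, (S ⟶ T) → (S ⟶ Y) → Prop)
    (hpull : ∀ {R S : Scheme.{u}} (h : R ⟶ S) (f : S ⟶ T) (p : S ⟶ Y), P f p → P (h ≫ f) (h ≫ p))
    (huniq : ∀ {S : Scheme.{u}} (f : S ⟶ T) (p q : S ⟶ Y), P f p → P f q → p = q)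
    (hloc : ∀ t : T, ∃ (V : T.Opens) (_ : t ∈ V) (p : V.toScheme ⟶ Y), P V.ι p) :
    ∃ p : T ⟶ Y, ∀ {S : Scheme.{u}} (f : S ⟶ T) (q : S ⟶ Y), P f q → f ≫ p = q := by
  choose V hV p hp using hloc
  let 𝒰 : T.OpenCover :=
    { I₀ := T
      X i := V i
      f i := (V i).ι
      mem₀ := by
        rw [Scheme.presieve₀_mem_precoverage_iff]
        exact ⟨fun x ↦ ⟨x, by simpa using hV x⟩, inferInstance⟩ }
  let e : T ⟶ Y := 𝒰.glueMorphisms p (fun i j ↦ by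
    refine huniq (pullback.fst (𝒰.f i) (𝒰.f j) ≫ (V i).ι) _ _ (hpull _ _ _ (hp i)) ?_
    have hc : pullback.fst (𝒰.f i) (𝒰.f j) ≫ (V i).ι =
      pullback.snd (𝒰.f i) (𝒰.f j) ≫ (V j).ι := pullback.condition
    rw [hc]
    exact hpull _ _ _ (hp j))
  have he (i : T) : (V i).ι ≫ e = p i := 𝒰.ι_glueMorphisms p _ i
  refine ⟨e, fun {S} f q hq ↦ Scheme.hom_ext_of_forall _ _ fun s ↦
    ⟨f ⁻¹ᵁ (V (f s)), hV (f s), ?_⟩⟩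
  rw [← Category.assoc, ← morphismRestrict_ι, Category.assoc, he]
  refine huniq _ _ _ (hpull (f ∣_ V (f s)) _ _ (hp (f s))) ?_
  rw [morphismRestrict_ι]
  exact hpull _ _ _ hq

namespace LineBundle

variable {X : Scheme.{u}}

/-- A correspondence between local frames of two line bundles that is compatible with restriction
and with scalars. -/
structure FrameRel (N N' : LineBundle X)
    (R : ∀ {T : Scheme.{u}}, (T ⟶ N.total) → (T ⟶ N'.total) → Prop) : Prop where
  pull : ∀ {S T : Scheme.{u}} (f : S ⟶ T) (p : T ⟶ N.total) (p' : T ⟶ N'.total),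
    R p p' → R (f ≫ p) (f ≫ p')
  base : ∀ {T : Scheme.{u}} (p : T ⟶ N.total) (p' : T ⟶ N'.total),
    R p p' → p ≫ N.proj = p' ≫ N'.proj
  fst : ∀ {T : Scheme.{u}} (p : T ⟶ N.total) (p' : T ⟶ N'.total), R p p' → N.IsFrame p
  snd : ∀ {T : Scheme.{u}} (p : T ⟶ N.total) (p' : T ⟶ N'.total), R p p' → N'.IsFrame p'
  coh : ∀ {T : Scheme.{u}} (p q : T ⟶ N.total) (p' q' : T ⟶ N'.total) (a : Γ(T, ⊤)),
    R p p' → R q q' → q = N.smul a p → q' = N'.smul a p'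
  loc : ∀ x : X, ∃ (U : X.Opens) (_ : x ∈ U) (p : U.toScheme ⟶ N.total)
    (p' : U.toScheme ⟶ N'.total), p ≫ N.proj = U.ι ∧ R p p'

namespace FrameRel

variable {N N' : LineBundle X} {R : ∀ {T : Scheme.{u}}, (T ⟶ N.total) → (T ⟶ N'.total) → Prop}

lemma symm (h : FrameRel N N' R) : FrameRel N' N (fun p' p ↦ R p p') where
  pull f p p' := h.pull f p' p
  base p p' hp := (h.base p' p hp).symm
  fst p p' := h.snd p' p
  snd p p' := h.fst p' p
  coh p q p' q' a hp hq e := by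
    obtain ⟨c, hc⟩ := frame_exists (h.fst _ _ hp) q' (by
      rw [h.base _ _ hq, h.base _ _ hp, e, N'.smul_proj])
    have := h.coh _ _ _ _ c hp hq hc.symm
    rw [← hc, frame_ext (h.snd _ _ hp) (this.symm.trans e)]
  loc x := by
    obtain ⟨U, hU, p, p', hp, hr⟩ := h.loc x
    exact ⟨U, hU, p', p, by rw [← h.base _ _ hr, hp], hr⟩

lemma local_rep (h : FrameRel N N' R) {T : Scheme.{u}} (n : T ⟶ N.total) (t : T) :
    ∃ (V : T.Opens) (_ : t ∈ V) (p : V.toScheme ⟶ N.total) (p' : V.toScheme ⟶ N'.total)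
      (a : Γ(V.toScheme, ⊤)), R p p' ∧ V.ι ≫ n = N.smul a p := by
  obtain ⟨U, hU, p, p', hp, hr⟩ := h.loc ((n ≫ N.proj) t)
  obtain ⟨a, ha⟩ := frame_exists (h.fst _ _ (h.pull ((n ≫ N.proj) ∣_ U) p p' hr))
    (((n ≫ N.proj) ⁻¹ᵁ U).ι ≫ n) (by rw [Category.assoc, Category.assoc, hp, morphismRestrict_ι])
  exact ⟨(n ≫ N.proj) ⁻¹ᵁ U, hU, _, _, a, h.pull _ _ _ hr, ha.symm⟩

lemma exists_hom (h : FrameRel N N' R) :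
    ∃ θ : N.total ⟶ N'.total, ∀ {T : Scheme.{u}} (p : T ⟶ N.total) (p' : T ⟶ N'.total)
      (a : Γ(T, ⊤)), R p p' → N.smul a p ≫ θ = N'.smul a p' := by
  let P : ∀ {S : Scheme.{u}}, (S ⟶ N.total) → (S ⟶ N'.total) → Prop := fun {S} f q ↦
    ∃ (p : S ⟶ N.total) (p' : S ⟶ N'.total) (a : Γ(S, ⊤)), R p p' ∧
      f = N.smul a p ∧ q = N'.smul a p'
  have h₁ : ∀ {R S : Scheme.{u}} (h : R ⟶ S) (f : S ⟶ N.total) (p : S ⟶ N'.total),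
      P f p → P (h ≫ f) (h ≫ p) := by
    rintro R' S k f q ⟨p, p', a, hr, rfl, rfl⟩
    exact ⟨k ≫ p, k ≫ p', pullFun k a, h.pull _ _ _ hr, N.comp_smul _ _ _, N'.comp_smul _ _ _⟩
  have h₂ : ∀ {S : Scheme.{u}} (f : S ⟶ N.total) (p q : S ⟶ N'.total),
      P f p → P f q → p = q := by
    rintro S f q₁ q₂ ⟨p, p', a, hr, hf, rfl⟩ ⟨q, q', c, hq, hf', rfl⟩
    have hb : q ≫ N.proj = p ≫ N.proj := by
      rw [← N.smul_proj c q, ← N.smul_proj a p, ← hf, ← hf']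
    obtain ⟨d, hd⟩ := frame_exists (h.fst _ _ hr) q hb
    rw [h.coh _ _ _ _ d hr hq hd.symm, ← N'.mul_smul]
    congr 1
    apply frame_ext (h.fst _ _ hr)
    rw [N.mul_smul, hd, ← hf, hf']
  obtain ⟨θ, hθ⟩ := exists_glue P h₁ h₂ (fun t ↦ by
    obtain ⟨V, hV, p, p', a, hr, ha⟩ := h.local_rep (𝟙 _) t
    exact ⟨V, hV, N'.smul a p', p, p', a, hr, by simpa using ha, rfl⟩)
  exact ⟨θ, fun p p' a hr ↦ hθ _ _ ⟨p, p', a, hr, rfl, rfl⟩⟩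

/-- The isomorphism of line bundles determined by a correspondence of local frames. -/
lemma exists_iso (h : FrameRel N N' R) :
    ∃ e : Isom N N',
      ∀ {T : Scheme.{u}} (p : T ⟶ N.total) (p' : T ⟶ N'.total), R p p' → p ≫ e.iso.hom = p' := by
  obtain ⟨θ, hθ⟩ := h.exists_hom
  obtain ⟨θ', hθ'⟩ := h.symm.exists_hom
  refine ⟨⟨⟨θ, θ', ?_, ?_⟩, ?_, ?_⟩, ?_⟩
  · refine Scheme.hom_ext_of_forall _ _ fun t ↦ ?_
    obtain ⟨V, hV, p, p', a, hr, ha⟩ := h.local_rep (𝟙 _) t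
    refine ⟨V, hV, ?_⟩
    rw [Category.comp_id] at ha
    rw [Category.comp_id, ha, ← Category.assoc, hθ _ _ _ hr, hθ' _ _ _ hr]
  · refine Scheme.hom_ext_of_forall _ _ fun t ↦ ?_
    obtain ⟨V, hV, p, p', a, hr, ha⟩ := h.symm.local_rep (𝟙 _) t
    refine ⟨V, hV, ?_⟩
    rw [Category.comp_id] at ha
    rw [Category.comp_id, ha, ← Category.assoc, hθ' _ _ _ hr, hθ _ _ _ hr]
  · refine Scheme.hom_ext_of_forall _ _ fun t ↦ ?_
    obtain ⟨V, hV, p, p', a, hr, ha⟩ := h.local_rep (𝟙 _) t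
    refine ⟨V, hV, ?_⟩
    rw [Category.comp_id] at ha
    rw [← Category.assoc, ha, hθ _ _ _ hr, N.smul_proj, N'.smul_proj, h.base _ _ hr]
  · intro T a l
    refine Scheme.hom_ext_of_forall _ _ fun t ↦ ?_
    obtain ⟨V, hV, p, p', c, hr, hc⟩ := h.local_rep l t
    refine ⟨V, hV, ?_⟩
    simp only [← Category.assoc, N.comp_smul, N'.comp_smul, hc]
    rw [← N.mul_smul, hθ _ _ _ hr, hθ _ _ _ hr, N'.mul_smul]
  · intro T p p' hr
    simpa using hθ p p' 1 hr

end FrameRel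

/-- A bilinear pairing `L × M ⟶ N` of line bundles (given on points) which exhibits `N` as the
tensor product of `L` and `M`: the product of two frames is a frame. -/
structure TensorPairing (L M N : LineBundle X) where
  pair : ∀ {T : Scheme.{u}} (l : T ⟶ L.total) (m : T ⟶ M.total),
    l ≫ L.proj = m ≫ M.proj → (T ⟶ N.total)
  pair_proj : ∀ {T : Scheme.{u}} (l : T ⟶ L.total) (m : T ⟶ M.total)
    (h : l ≫ L.proj = m ≫ M.proj), pair l m h ≫ N.proj = l ≫ L.proj
  comp_pair : ∀ {S T : Scheme.{u}} (f : S ⟶ T) (l : T ⟶ L.total) (m : T ⟶ M.total)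
    (h : l ≫ L.proj = m ≫ M.proj), f ≫ pair l m h = pair (f ≫ l) (f ≫ m) (by simp [h])
  smul_pair : ∀ {T : Scheme.{u}} (a : Γ(T, ⊤)) (l : T ⟶ L.total) (m : T ⟶ M.total)
    (h : l ≫ L.proj = m ≫ M.proj),
    pair (L.smul a l) m (by simp [h]) = N.smul a (pair l m h)
  pair_smul : ∀ {T : Scheme.{u}} (a : Γ(T, ⊤)) (l : T ⟶ L.total) (m : T ⟶ M.total)
    (h : l ≫ L.proj = m ≫ M.proj),
    pair l (M.smul a m) (by simp [h]) = N.smul a (pair l m h)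
  isFrame_pair : ∀ {T : Scheme.{u}} (l : T ⟶ L.total) (m : T ⟶ M.total)
    (h : l ≫ L.proj = m ≫ M.proj), L.IsFrame l → M.IsFrame m → N.IsFrame (pair l m h)

namespace TensorPairing

variable {L M N : LineBundle X} (b : TensorPairing L M N)

lemma pair_congr {T : Scheme.{u}} {l l' : T ⟶ L.total} {m m' : T ⟶ M.total} (hl : l = l')
    (hm : m = m') (h : l ≫ L.proj = m ≫ M.proj) :
    b.pair l m h = b.pair l' m' (by rw [← hl, ← hm, h]) := by
  subst hl hm; rfl

/-- The symmetry of the tensor product. -/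
def symm : TensorPairing M L N where
  pair l m h := b.pair m l h.symm
  pair_proj l m h := by rw [b.pair_proj, h]
  comp_pair f l m h := b.comp_pair _ _ _ _
  smul_pair a l m h := b.pair_smul _ _ _ _
  pair_smul a l m h := b.smul_pair _ _ _ _
  isFrame_pair l m h hl hm := b.isFrame_pair _ _ _ hm hl

/-- Transport of a pairing along isomorphisms. -/
def congr {L' M' N' : LineBundle X} (e : Isom L' L) (f : Isom M' M) (g : Isom N N') :
    TensorPairing L' M' N' where
  pair l m h := b.pair (l ≫ e.iso.hom) (m ≫ f.iso.hom) (by simp [h]) ≫ g.iso.hom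
  pair_proj l m h := by simp [b.pair_proj]
  comp_pair k l m h := by
    rw [← Category.assoc, b.comp_pair]
    congr 1
  smul_pair a l m h := by
    rw [← g.smul_hom, ← b.smul_pair]
    congr 1
    apply pair_congr
    · rw [e.smul_hom]
    · rfl
  pair_smul a l m h := by
    rw [← g.smul_hom, ← b.pair_smul]
    congr 1
    apply pair_congr
    · rfl
    · rw [f.smul_hom]
  isFrame_pair l m h hl hm := g.isFrame (b.isFrame_pair _ _ _ (e.isFrame hl) (f.isFrame hm))

end TensorPairing

/-- Triples of frames over the same point of `X`. -/
structure Frames (L M N : LineBundle X) (T : Scheme.{u}) where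
  x : T ⟶ X
  l : T ⟶ L.total
  m : T ⟶ M.total
  n : T ⟶ N.total
  hl : l ≫ L.proj = x
  hm : m ≫ M.proj = x
  hn : n ≫ N.proj = x
  fl : L.IsFrame l
  fm : M.IsFrame m
  fn : N.IsFrame n

/-- Restriction of a triple of frames. -/
@[simps]
def Frames.res {L M N : LineBundle X} {S T : Scheme.{u}} (f : S ⟶ T) (e : Frames L M N T) :
    Frames L M N S where
  x := f ≫ e.x
  l := f ≫ e.l
  m := f ≫ e.m
  n := f ≫ e.n
  hl := by simp [e.hl]
  hm := by simp [e.hm]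
  hn := by simp [e.hn]
  fl := isFrame_comp e.fl f
  fm := isFrame_comp e.fm f
  fn := isFrame_comp e.fn f

lemma Frames.exists_local (L M N : LineBundle X) {T : Scheme.{u}} (x : T ⟶ X) (t : T) :
    ∃ (V : T.Opens) (_ : t ∈ V) (e : Frames L M N V), e.x = V.ι ≫ x := by
  obtain ⟨U₁, h₁, s₁, hs₁, f₁⟩ := L.exists_local_frame x t
  obtain ⟨U₂, h₂, s₂, hs₂, f₂⟩ := M.exists_local_frame x t
  obtain ⟨U₃, h₃, s₃, hs₃, f₃⟩ := N.exists_local_frame x t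
  refine ⟨U₁ ⊓ (U₂ ⊓ U₃), ⟨h₁, h₂, h₃⟩,
    { x := (U₁ ⊓ (U₂ ⊓ U₃)).ι ≫ x
      l := T.homOfLE inf_le_left ≫ s₁
      m := T.homOfLE (inf_le_right.trans inf_le_left) ≫ s₂
      n := T.homOfLE (inf_le_right.trans inf_le_right) ≫ s₃
      hl := by simp [hs₁]
      hm := by simp [hs₂]
      hn := by simp [hs₃]
      fl := isFrame_comp f₁ _
      fm := isFrame_comp f₂ _
      fn := isFrame_comp f₃ _ }, rfl⟩

/-- A correspondence of frames parametrized by triples of frames. -/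
lemma FrameRel.ofFrames {L M N P Q : LineBundle X}
    (v : ∀ {T : Scheme.{u}}, Frames L M N T → (T ⟶ P.total))
    (w : ∀ {T : Scheme.{u}}, Frames L M N T → (T ⟶ Q.total))
    (hv : ∀ {S T : Scheme.{u}} (f : S ⟶ T) (e : Frames L M N T), f ≫ v e = v (e.res f))
    (hw : ∀ {S T : Scheme.{u}} (f : S ⟶ T) (e : Frames L M N T), f ≫ w e = w (e.res f))
    (xv : ∀ {T : Scheme.{u}} (e : Frames L M N T), v e ≫ P.proj = e.x)
    (xw : ∀ {T : Scheme.{u}} (e : Frames L M N T), w e ≫ Q.proj = e.x)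
    (fv : ∀ {T : Scheme.{u}} (e : Frames L M N T), P.IsFrame (v e))
    (fw : ∀ {T : Scheme.{u}} (e : Frames L M N T), Q.IsFrame (w e))
    (ratio : ∀ {T : Scheme.{u}} (e e' : Frames L M N T) (a b c : Γ(T, ⊤)),
      e'.l = L.smul a e.l → e'.m = M.smul b e.m → e'.n = N.smul c e.n →
      ∃ d, v e' = P.smul d (v e) ∧ w e' = Q.smul d (w e)) :
    FrameRel P Q (fun {T} p q ↦ ∃ e : Frames L M N T, p = v e ∧ q = w e) where
  pull := by
    rintro S T f _ _ ⟨e, rfl, rfl⟩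
    exact ⟨e.res f, hv f e, hw f e⟩
  base := by
    rintro T _ _ ⟨e, rfl, rfl⟩
    rw [xv, xw]
  fst := by
    rintro T _ _ ⟨e, rfl, rfl⟩
    exact fv e
  snd := by
    rintro T _ _ ⟨e, rfl, rfl⟩
    exact fw e
  coh := by
    rintro T _ _ _ _ a ⟨e, rfl, rfl⟩ ⟨e', rfl, rfl⟩ h
    have hx : e'.x = e.x := by rw [← xv e', h, P.smul_proj, xv]
    obtain ⟨a₁, h₁⟩ := frame_exists e.fl e'.l (by rw [e.hl, e'.hl, hx])
    obtain ⟨a₂, h₂⟩ := frame_exists e.fm e'.m (by rw [e.hm, e'.hm, hx])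
    obtain ⟨a₃, h₃⟩ := frame_exists e.fn e'.n (by rw [e.hn, e'.hn, hx])
    obtain ⟨d, hd, hd'⟩ := ratio e e' a₁ a₂ a₃ h₁.symm h₂.symm h₃.symm
    rw [frame_ext (fv e) (h.symm.trans hd), hd']
  loc x := by
    obtain ⟨V, hV, e, he⟩ := Frames.exists_local L M N (𝟙 X) x
    exact ⟨V, hV, v e, w e, by rw [xv, he, Category.comp_id], e, rfl, rfl⟩

namespace TensorPairing

lemma frameRel_unique {L M N N' : LineBundle X} (b : TensorPairing L M N)
    (b' : TensorPairing L M N') :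
    FrameRel N N' (fun {T} p q ↦ ∃ e : Frames L M M T, p = b.pair e.l e.m (by rw [e.hl, e.hm]) ∧
      q = b'.pair e.l e.m (by rw [e.hl, e.hm])) := by
  refine FrameRel.ofFrames (fun e ↦ b.pair e.l e.m (by rw [e.hl, e.hm]))
    (fun e ↦ b'.pair e.l e.m (by rw [e.hl, e.hm])) (fun f e ↦ b.comp_pair _ _ _ _)
    (fun f e ↦ b'.comp_pair _ _ _ _) (fun e ↦ by rw [b.pair_proj, e.hl])
    (fun e ↦ by rw [b'.pair_proj, e.hl]) (fun e ↦ b.isFrame_pair _ _ _ e.fl e.fm)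
    (fun e ↦ b'.isFrame_pair _ _ _ e.fl e.fm) ?_
  intro T e e' a c d h₁ h₂ h₃
  have hx : e.l ≫ L.proj = e.m ≫ M.proj := by rw [e.hl, e.hm]
  refine ⟨a * c, ?_, ?_⟩
  · rw [b.pair_congr h₁ h₂, b.smul_pair a e.l _ (by simpa using hx), b.pair_smul _ _ _ hx,
      N.mul_smul]
  · rw [b'.pair_congr h₁ h₂, b'.smul_pair a e.l _ (by simpa using hx), b'.pair_smul _ _ _ hx,
      N'.mul_smul]

lemma frameRel_assoc {L M N P Q R Q' : LineBundle X} (b₁ : TensorPairing L M P)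
    (b₂ : TensorPairing P N Q) (b₃ : TensorPairing M N R) (b₄ : TensorPairing L R Q') :
    FrameRel Q Q' (fun {T} p q ↦ ∃ e : Frames L M N T,
      p = b₂.pair (b₁.pair e.l e.m (by rw [e.hl, e.hm])) e.n
        (by rw [b₁.pair_proj, e.hl, e.hn]) ∧
      q = b₄.pair e.l (b₃.pair e.m e.n (by rw [e.hm, e.hn]))
        (by rw [b₃.pair_proj, e.hl, e.hm])) := by
  refine FrameRel.ofFrames
    (fun e ↦ b₂.pair (b₁.pair e.l e.m (by rw [e.hl, e.hm])) e.n
        (by rw [b₁.pair_proj, e.hl, e.hn]))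
    (fun e ↦ b₄.pair e.l (b₃.pair e.m e.n (by rw [e.hm, e.hn]))
        (by rw [b₃.pair_proj, e.hl, e.hm])) ?_ ?_ ?_ ?_ ?_ ?_ ?_
  · intro S T f e
    rw [b₂.comp_pair]
    exact b₂.pair_congr (b₁.comp_pair _ _ _ _) rfl _
  · intro S T f e
    rw [b₄.comp_pair]
    exact b₄.pair_congr rfl (b₃.comp_pair _ _ _ _) _
  · intro T e
    rw [b₂.pair_proj, b₁.pair_proj, e.hl]
  · intro T e
    rw [b₄.pair_proj, e.hl]
  · intro T e
    exact b₂.isFrame_pair _ _ _ (b₁.isFrame_pair _ _ _ e.fl e.fm) e.fn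
  · intro T e
    exact b₄.isFrame_pair _ _ _ e.fl (b₃.isFrame_pair _ _ _ e.fm e.fn)
  · intro T e e' a c d h₁ h₂ h₃
    have hx : e.l ≫ L.proj = e.m ≫ M.proj := by rw [e.hl, e.hm]
    have hy : e.m ≫ M.proj = e.n ≫ N.proj := by rw [e.hm, e.hn]
    have k₁ : b₁.pair e'.l e'.m (by rw [e'.hl, e'.hm]) =
        P.smul (a * c) (b₁.pair e.l e.m hx) := by
      rw [b₁.pair_congr h₁ h₂, b₁.smul_pair a e.l _ (by simpa using hx), b₁.pair_smul _ _ _ hx,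
        P.mul_smul]
    have k₃ : b₃.pair e'.m e'.n (by rw [e'.hm, e'.hn]) =
        R.smul (c * d) (b₃.pair e.m e.n hy) := by
      rw [b₃.pair_congr h₂ h₃, b₃.smul_pair c e.m _ (by simpa using hy), b₃.pair_smul _ _ _ hy,
        R.mul_smul]
    have h₂' : b₁.pair e.l e.m hx ≫ P.proj = e.n ≫ N.proj := by rw [b₁.pair_proj, hx, hy]
    have h₄' : e.l ≫ L.proj = b₃.pair e.m e.n hy ≫ R.proj := by rw [b₃.pair_proj, hx]
    refine ⟨a * c * d, ?_, ?_⟩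
    · rw [b₂.pair_congr k₁ h₃, b₂.smul_pair (a * c) _ _ (by simpa using h₂'),
        b₂.pair_smul _ _ _ h₂', Q.mul_smul (a * c)]
    · rw [b₄.pair_congr h₁ k₃, b₄.smul_pair a _ _ (by simpa using h₄'),
        b₄.pair_smul _ _ _ h₄', mul_assoc, Q'.mul_smul a]

end TensorPairing

end LineBundle

/-- A line bundle on `X` described by its functor of points: a sheaf for the Zariski topology
over `X`, with scalar multiplication, which locally over `X` has a frame. -/
structure PointSheaf (X : Scheme.{u}) where
  pts : Scheme.{u} → Type u
  res : ∀ {S T : Scheme.{u}}, (S ⟶ T) → pts T → pts S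
  res_id : ∀ {T : Scheme.{u}} (e : pts T), res (𝟙 T) e = e
  res_comp : ∀ {R S T : Scheme.{u}} (f : R ⟶ S) (g : S ⟶ T) (e : pts T),
    res (f ≫ g) e = res f (res g e)
  base : ∀ {T : Scheme.{u}}, pts T → (T ⟶ X)
  base_res : ∀ {S T : Scheme.{u}} (f : S ⟶ T) (e : pts T), base (res f e) = f ≫ base e
  smul : ∀ {T : Scheme.{u}}, Γ(T, ⊤) → pts T → pts T
  base_smul : ∀ {T : Scheme.{u}} (a : Γ(T, ⊤)) (e : pts T), base (smul a e) = base e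
  res_smul : ∀ {S T : Scheme.{u}} (f : S ⟶ T) (a : Γ(T, ⊤)) (e : pts T),
    res f (smul a e) = smul (pullFun f a) (res f e)
  one_smul : ∀ {T : Scheme.{u}} (e : pts T), smul 1 e = e
  mul_smul : ∀ {T : Scheme.{u}} (a b : Γ(T, ⊤)) (e : pts T),
    smul (a * b) e = smul a (smul b e)
  ext : ∀ {T : Scheme.{u}} (𝒰 : Scheme.OpenCover.{u} T) (e e' : pts T),
    (∀ i, res (𝒰.f i) e = res (𝒰.f i) e') → e = e'
  glue : ∀ {T : Scheme.{u}} (𝒰 : Scheme.OpenCover.{u} T) (e : ∀ i, pts (𝒰.X i)),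
    (∀ i j, res (pullback.fst (𝒰.f i) (𝒰.f j)) (e i) =
      res (pullback.snd (𝒰.f i) (𝒰.f j)) (e j)) → ∃ e' : pts T, ∀ i, res (𝒰.f i) e' = e i
  exists_frame : ∀ x : X, ∃ (U : X.Opens) (_ : x ∈ U) (s : pts U), base s = U.ι ∧
    ∀ {S : Scheme.{u}} (f : S ⟶ U) (l : pts S), base l = f ≫ U.ι →
      ∃! a : Γ(S, ⊤), smul a (res f s) = l

namespace PointSheaf

variable {X : Scheme.{u}} (F : PointSheaf X)

/-- The associated presheaf. -/
def functor : Scheme.{u}ᵒᵖ ⥤ Type u where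
  obj T := F.pts T.unop
  map f := ↾fun e ↦ F.res f.unop e
  map_id T := by ext e; exact F.res_id e
  map_comp f g := by ext e; exact F.res_comp g.unop f.unop e

lemma isSheaf : Presieve.IsSheaf Scheme.zariskiTopology F.functor := by
  rw [Scheme.zariskiTopology, Scheme.grothendieckTopology,
    Precoverage.isSheaf_toGrothendieck_iff_of_isStableUnderBaseChange_of_small.{u}]
  intro Y (𝒰 : Scheme.OpenCover.{u} Y) x hx
  obtain ⟨e, he⟩ := F.glue 𝒰 (fun j ↦ x (𝒰.f j) (.mk j))
    (fun i j ↦ hx _ _ _ _ pullback.condition)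
  refine ⟨e, ?_, ?_⟩
  · rintro Z _ ⟨j⟩
    exact he j
  · intro e' h
    exact F.ext 𝒰 _ _ fun i ↦ (h (𝒰.f i) (.mk i)).trans (he i).symm

/-- The projection to `X`. -/
def toBase : F.functor ⟶ yoneda.obj X where
  app T := ↾fun (e : F.pts T.unop) ↦ (F.base e : T.unop ⟶ X)
  naturality S T f := by ext e; exact F.base_res f.unop e

lemma exists_rep : ∃ (N : Scheme.{u}) (v : F.pts N), ∀ {T : Scheme.{u}} (e : F.pts T),
    ∃! f : T ⟶ N, F.res f v = e := by
  choose U hU s hs hf using F.exists_frame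
  let A (x : X) : Scheme.{u} := 𝔸(PUnit.{u + 1}; U x)
  let α (x : X) : F.pts (A x) := F.smul (AffineSpace.coord _ PUnit.unit) (F.res (A x ↘ U x) (s x))
  let φ (x : X) : yoneda.obj (A x) ⟶ F.functor := yonedaEquiv.symm (α x)
  have hφ (x : X) {T : Scheme.{u}} (f : T ⟶ A x) : (φ x).app (.op T) f =
      F.smul (pullFun f (AffineSpace.coord _ PUnit.unit)) (F.res (f ≫ (A x ↘ U x)) (s x)) := by
    change F.res f (α x) = _
    rw [F.res_smul, F.res_comp]
  have hb (x : X) {T : Scheme.{u}} (f : T ⟶ A x) :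
      F.base ((φ x).app (.op T) f) = (f ≫ (A x ↘ U x)) ≫ (U x).ι := by
    rw [hφ, F.base_smul, F.base_res, hs]
  have hpb (x : X) : IsPullback (φ x) (yoneda.map (A x ↘ U x)) F.toBase (yoneda.map (U x).ι) := by
    refine IsPullback.of_forall_isPullback_app fun T ↦ ?_
    rw [Types.isPullback_iff]
    refine ⟨?_, ?_, ?_⟩
    · ext f
      exact hb x f
    · rintro (f : T.unop ⟶ A x) (g : T.unop ⟶ A x) ⟨h₁, h₂⟩
      have h₂' : f ≫ (A x ↘ U x) = g ≫ (A x ↘ U x) := h₂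
      refine AffineSpace.hom_ext h₂' fun i ↦ ?_
      have h₁' : (φ x).app (.op T.unop) f = (φ x).app (.op T.unop) g := h₁
      rw [hφ, hφ, h₂'] at h₁'
      exact (hf x (g ≫ (A x ↘ U x)) _ (by rw [F.base_smul, F.base_res, hs])).unique h₁' rfl
    · rintro (e : F.pts T.unop) (y : T.unop ⟶ U x) h
      have h' : F.base e = y ≫ (U x).ι := h
      obtain ⟨a, ha, -⟩ := hf x y e h'
      refine ⟨AffineSpace.homOfVector y (fun _ ↦ a), ?_, ?_⟩
      · refine (hφ x _).trans ?_
        rw [AffineSpace.homOfVector_over]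
        refine Eq.trans ?_ ha
        congr 1
        exact AffineSpace.homOfVector_appTop_coord y (fun _ ↦ a) PUnit.unit
      · exact AffineSpace.homOfVector_over y _
  have hop (x : X) : IsOpenImmersion.presheaf (φ x) :=
    (MorphismProperty.relative_isStableUnderBaseChange _).of_isPullback (hpb x).flip
      (MorphismProperty.relative_map inferInstance)
  let F' : Sheaf Scheme.zariskiTopology.{u} (Type u) :=
    ⟨F.functor, (isSheaf_iff_isSheaf_of_type _ _).2 F.isSheaf⟩
  have hsurj : Presheaf.IsLocallySurjective Scheme.zariskiTopology (Sigma.desc φ) := by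
    refine ⟨fun {T} (e : F.pts T) ↦ ?_⟩
    rw [Scheme.mem_grothendieckTopology_iff]
    let 𝒰 : Scheme.OpenCover.{u} T :=
      { I₀ := T
        X t := (F.base e) ⁻¹ᵁ (U (F.base e t))
        f t := ((F.base e) ⁻¹ᵁ (U (F.base e t))).ι
        mem₀ := by
          rw [Scheme.presieve₀_mem_precoverage_iff]
          exact ⟨fun t ↦ ⟨t, by simpa using hU (F.base e t)⟩, inferInstance⟩ }
    refine ⟨𝒰, ?_⟩
    rintro _ _ ⟨t⟩
    obtain ⟨a, ha, -⟩ := hf (F.base e t) (F.base e ∣_ U (F.base e t)) (F.res (𝒰.f t) e) (by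
      rw [F.base_res, morphismRestrict_ι])
    let y : 𝒰.X t ⟶ A (F.base e t) :=
      AffineSpace.homOfVector (F.base e ∣_ U (F.base e t)) (fun _ ↦ a)
    refine ⟨(Sigma.ι (fun x ↦ yoneda.obj (A x)) (F.base e t)).app (.op (𝒰.X t)) y, ?_⟩
    have h₁ : (φ (F.base e t)).app (.op (𝒰.X t)) y = F.res (𝒰.f t) e := by
      rw [hφ, AffineSpace.homOfVector_over]
      refine Eq.trans ?_ ha
      congr 1
      exact AffineSpace.homOfVector_appTop_coord _ (fun _ ↦ a) PUnit.unit
    refine Eq.trans ?_ h₁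
    have h₂ := congr_arg (fun ψ ↦ ψ.app (.op (𝒰.X t)) y) (Sigma.ι_desc φ (F.base e t))
    exact h₂
  obtain ⟨N, ⟨r⟩⟩ := Scheme.LocalRepresentability.isRepresentable (F := F') hop
  refine ⟨N, r.homEquiv (𝟙 N), fun {T} e ↦ ?_⟩
  have key (f : T ⟶ N) : F.res f (r.homEquiv (𝟙 N)) = r.homEquiv f := by
    have := r.homEquiv_comp f (𝟙 N)
    rw [Category.comp_id] at this
    exact this.symm
  refine ⟨r.homEquiv.symm e, ?_, fun f hf ↦ ?_⟩
  · exact (key _).trans (r.homEquiv.apply_symm_apply e)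
  · exact (r.homEquiv.symm_apply_eq.2 (hf.symm.trans (key f))).symm

/-- The scheme representing the functor of points. -/
def rep : Scheme.{u} := F.exists_rep.choose

/-- The universal point. -/
def univ : F.pts F.rep := F.exists_rep.choose_spec.choose

/-- The morphism to the representing scheme given by a point. -/
def hom {T : Scheme.{u}} (e : F.pts T) : T ⟶ F.rep :=
  (F.exists_rep.choose_spec.choose_spec e).choose

/-- The point given by a morphism to the representing scheme. -/
def pt {T : Scheme.{u}} (l : T ⟶ F.rep) : F.pts T := F.res l F.univ

@[simp]
lemma pt_hom {T : Scheme.{u}} (e : F.pts T) : F.pt (F.hom e) = e :=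
  (F.exists_rep.choose_spec.choose_spec e).choose_spec.1

@[simp]
lemma hom_pt {T : Scheme.{u}} (l : T ⟶ F.rep) : F.hom (F.pt l) = l :=
  ((F.exists_rep.choose_spec.choose_spec (F.pt l)).choose_spec.2 l rfl).symm

lemma pt_comp {S T : Scheme.{u}} (f : S ⟶ T) (l : T ⟶ F.rep) :
    F.pt (f ≫ l) = F.res f (F.pt l) :=
  F.res_comp _ _ _

lemma pt_injective {T : Scheme.{u}} {l l' : T ⟶ F.rep} (h : F.pt l = F.pt l') : l = l' := by
  rw [← F.hom_pt l, h, F.hom_pt]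

lemma comp_hom {S T : Scheme.{u}} (f : S ⟶ T) (e : F.pts T) :
    f ≫ F.hom e = F.hom (F.res f e) := by
  apply F.pt_injective
  rw [F.pt_comp, F.pt_hom, F.pt_hom]

lemma base_pt {T : Scheme.{u}} (l : T ⟶ F.rep) : F.base (F.pt l) = l ≫ F.base F.univ :=
  F.base_res _ _

/-- The scalar multiplication on the representing scheme. -/
def toScalarScheme : ScalarScheme X where
  total := F.rep
  proj := F.base F.univ
  smul a l := F.hom (F.smul a (F.pt l))
  smul_proj a l := by rw [← F.base_pt, ← F.base_pt, F.pt_hom, F.base_smul]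
  comp_smul f a l := by rw [F.comp_hom, F.res_smul, F.pt_comp]
  one_smul l := by rw [F.one_smul, F.hom_pt]
  mul_smul a b l := by rw [F.mul_smul, F.pt_hom]

lemma isFrame_hom {T : Scheme.{u}} {s : F.pts T} (hs : ∀ {S : Scheme.{u}} (f : S ⟶ T)
    (l : F.pts S), F.base l = f ≫ F.base s → ∃! a : Γ(S, ⊤), F.smul a (F.res f s) = l) :
    F.toScalarScheme.IsFrame (F.hom s) := by
  intro S f (l : S ⟶ F.rep) hl
  have key (a : Γ(S, ⊤)) :
      F.toScalarScheme.smul a (f ≫ F.hom s) = l ↔ F.smul a (F.res f s) = F.pt l := by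
    change F.hom (F.smul a (F.pt (f ≫ F.hom s))) = l ↔ _
    rw [F.pt_comp, F.pt_hom]
    exact ⟨fun h ↦ by rw [← h, F.pt_hom], fun h ↦ by rw [h, F.hom_pt]⟩
  obtain ⟨a, ha, hu⟩ := hs f (F.pt l) (by
    rw [F.base_pt]
    refine hl.trans ?_
    change f ≫ F.hom s ≫ F.base F.univ = _
    rw [← F.base_pt, F.pt_hom])
  exact ⟨a, (key a).2 ha, fun c hc ↦ hu c ((key c).1 hc)⟩

/-- The line bundle with the given functor of points. -/
def toLineBundle : LineBundle X where
  toScalarScheme := F.toScalarScheme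
  exists_frame x := by
    obtain ⟨U, hU, s, hs, hf⟩ := F.exists_frame x
    refine ⟨U, hU, F.hom s, ?_, F.isFrame_hom fun f l hl ↦ hf f l (by rw [hl, hs])⟩
    change F.hom s ≫ F.base F.univ = _
    rw [← F.base_pt, F.pt_hom, hs]

end PointSheaf

namespace LineBundle

variable {X : Scheme.{u}}

/-- A `T`-valued point `x` of `X` together with a linear morphism from `L` to `M` over `x`. -/
structure HomPt (L M : LineBundle X) (T : Scheme.{u}) where
  x : T ⟶ X
  φ : pullback x L.proj ⟶ M.total
  φ_proj : φ ≫ M.proj = pullback.fst _ _ ≫ x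
  φ_smul : ∀ {S : Scheme.{u}} (f : S ⟶ T) (l : S ⟶ L.total) (h : f ≫ x = l ≫ L.proj)
    (a : Γ(S, ⊤)), pullback.lift f (L.smul a l) (by simp [h]) ≫ φ =
      M.smul a (pullback.lift f l h ≫ φ)

namespace HomPt

variable {L M : LineBundle X} {T : Scheme.{u}}

/-- Evaluation of a linear morphism. -/
def ev (e : HomPt L M T) {S : Scheme.{u}} (f : S ⟶ T) (l : S ⟶ L.total)
    (h : f ≫ e.x = l ≫ L.proj) : S ⟶ M.total :=
  pullback.lift f l h ≫ e.φ

lemma ev_proj (e : HomPt L M T) {S : Scheme.{u}} (f : S ⟶ T) (l : S ⟶ L.total)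
    (h : f ≫ e.x = l ≫ L.proj) : e.ev f l h ≫ M.proj = f ≫ e.x := by
  rw [ev, Category.assoc, e.φ_proj, pullback.lift_fst_assoc]

lemma comp_ev (e : HomPt L M T) {R S : Scheme.{u}} (k : R ⟶ S) (f : S ⟶ T) (l : S ⟶ L.total)
    (h : f ≫ e.x = l ≫ L.proj) :
    k ≫ e.ev f l h = e.ev (k ≫ f) (k ≫ l) (by simp [h]) := by
  rw [ev, ev, ← Category.assoc]
  congr 1
  apply pullback.hom_ext
  · rw [Category.assoc, pullback.lift_fst, pullback.lift_fst]
  · rw [Category.assoc, pullback.lift_snd, pullback.lift_snd]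

lemma ev_smul (e : HomPt L M T) {S : Scheme.{u}} (f : S ⟶ T) (l : S ⟶ L.total)
    (h : f ≫ e.x = l ≫ L.proj) (a : Γ(S, ⊤)) :
    e.ev f (L.smul a l) (by simp [h]) = M.smul a (e.ev f l h) :=
  e.φ_smul f l h a

lemma ev_congr (e : HomPt L M T) {S : Scheme.{u}} {f f' : S ⟶ T} {l l' : S ⟶ L.total}
    (hf : f = f') (hl : l = l') (h : f ≫ e.x = l ≫ L.proj) :
    e.ev f l h = e.ev f' l' (by rw [← hf, ← hl, h]) := by
  subst hf hl; rfl

lemma ext' {e e' : HomPt L M T} (hx : e.x = e'.x)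
    (h : ∀ {S : Scheme.{u}} (f : S ⟶ T) (l : S ⟶ L.total) (h : f ≫ e.x = l ≫ L.proj),
      e.ev f l h = e'.ev f l (by rw [← hx, h])) : e = e' := by
  obtain ⟨x, φ, h₁, h₂⟩ := e
  obtain ⟨x', φ', h₁', h₂'⟩ := e'
  obtain rfl : x = x' := hx
  have := h (pullback.fst x L.proj) (pullback.snd x L.proj) pullback.condition
  have hid : pullback.lift (pullback.fst x L.proj) (pullback.snd x L.proj) pullback.condition =
    𝟙 _ := by apply pullback.hom_ext <;> simp
  simp only [ev, hid, Category.id_comp] at this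
  subst this
  rfl

/-- A linear morphism given by its values on all points. -/
def mk' (x : T ⟶ X) (v : ∀ {S : Scheme.{u}} (f : S ⟶ T) (l : S ⟶ L.total),
      f ≫ x = l ≫ L.proj → (S ⟶ M.total))
    (v_proj : ∀ {S : Scheme.{u}} (f : S ⟶ T) (l : S ⟶ L.total) (h : f ≫ x = l ≫ L.proj),
      v f l h ≫ M.proj = f ≫ x)
    (comp_v : ∀ {R S : Scheme.{u}} (k : R ⟶ S) (f : S ⟶ T) (l : S ⟶ L.total)
      (h : f ≫ x = l ≫ L.proj), k ≫ v f l h = v (k ≫ f) (k ≫ l) (by simp [h]))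
    (v_smul : ∀ {S : Scheme.{u}} (f : S ⟶ T) (l : S ⟶ L.total) (h : f ≫ x = l ≫ L.proj)
      (a : Γ(S, ⊤)), v f (L.smul a l) (by simp [h]) = M.smul a (v f l h)) : HomPt L M T where
  x := x
  φ := v (pullback.fst _ _) (pullback.snd _ _) pullback.condition
  φ_proj := v_proj _ _ _
  φ_smul f l h a := by
    rw [comp_v, comp_v]
    simp_rw [pullback.lift_fst, pullback.lift_snd]
    exact v_smul f l h a

lemma mk'_ev (x : T ⟶ X) (v : ∀ {S : Scheme.{u}} (f : S ⟶ T) (l : S ⟶ L.total),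
      f ≫ x = l ≫ L.proj → (S ⟶ M.total)) (h₁ h₂ h₃) {S : Scheme.{u}} (f : S ⟶ T)
    (l : S ⟶ L.total) (h : f ≫ x = l ≫ L.proj) :
    (mk' x v h₁ h₂ h₃ : HomPt L M T).ev f l h = v f l h := by
  refine (h₂ _ _ _ _).trans ?_
  congr 1
  · exact pullback.lift_fst f l h
  · exact pullback.lift_snd f l h

/-- Restriction of a linear morphism. -/
def res {S : Scheme.{u}} (k : S ⟶ T) (e : HomPt L M T) : HomPt L M S :=
  mk' (k ≫ e.x) (fun f l h ↦ e.ev (f ≫ k) l (by simpa using h))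
    (fun f l h ↦ by rw [ev_proj, Category.assoc])
    (fun j f l h ↦ by rw [comp_ev]; exact e.ev_congr (Category.assoc _ _ _).symm rfl _)
    (fun f l h a ↦ e.ev_smul _ _ _ _)

lemma res_ev {S : Scheme.{u}} (k : S ⟶ T) (e : HomPt L M T) {R : Scheme.{u}} (f : R ⟶ S)
    (l : R ⟶ L.total) (h : f ≫ k ≫ e.x = l ≫ L.proj) :
    (e.res k).ev f l h = e.ev (f ≫ k) l (by simpa using h) :=
  mk'_ev _ _ _ _ _ _ _ _

/-- Multiples of a linear morphism. -/
def smul (a : Γ(T, ⊤)) (e : HomPt L M T) : HomPt L M T :=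
  mk' e.x (fun f l h ↦ M.smul (pullFun f a) (e.ev f l h))
    (fun f l h ↦ by rw [M.smul_proj, ev_proj])
    (fun j f l h ↦ by rw [M.comp_smul, comp_ev, pullFun_comp])
    (fun f l h c ↦ by rw [ev_smul, ← M.mul_smul, ← M.mul_smul, mul_comm])

lemma smul_ev (a : Γ(T, ⊤)) (e : HomPt L M T) {R : Scheme.{u}} (f : R ⟶ T)
    (l : R ⟶ L.total) (h : f ≫ e.x = l ≫ L.proj) :
    (e.smul a).ev f l h = M.smul (pullFun f a) (e.ev f l h) :=
  mk'_ev _ _ _ _ _ _ _ _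

/-- A linear morphism carrying a frame to a frame. -/
lemma exists_of_frame {s : T ⟶ L.total} {r : T ⟶ M.total} (hs : L.IsFrame s)
    (h : s ≫ L.proj = r ≫ M.proj) :
    ∃ e : HomPt L M T, e.x = s ≫ L.proj ∧
      ∀ {S : Scheme.{u}} (f : S ⟶ T) (hx : f ≫ e.x = (f ≫ s) ≫ L.proj),
        e.ev f (f ≫ s) hx = f ≫ r := by
  have hex {S : Scheme.{u}} (f : S ⟶ T) (l : S ⟶ L.total) (hl : f ≫ s ≫ L.proj = l ≫ L.proj) :=
    hs f l hl.symm
  let c {S : Scheme.{u}} (f : S ⟶ T) (l : S ⟶ L.total) (hl : f ≫ s ≫ L.proj = l ≫ L.proj) :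
    Γ(S, ⊤) := (hex f l hl).choose
  have hc {S : Scheme.{u}} (f : S ⟶ T) (l : S ⟶ L.total) (hl : f ≫ s ≫ L.proj = l ≫ L.proj) :
    L.smul (c f l hl) (f ≫ s) = l := (hex f l hl).choose_spec.1
  have hu {S : Scheme.{u}} (f : S ⟶ T) (l : S ⟶ L.total) (hl : f ≫ s ≫ L.proj = l ≫ L.proj)
    (a : Γ(S, ⊤)) (ha : L.smul a (f ≫ s) = l) : c f l hl = a :=
    ((hex f l hl).choose_spec.2 a ha).symm
  refine ⟨mk' (s ≫ L.proj) (fun f l hl ↦ M.smul (c f l hl) (f ≫ r)) ?_ ?_ ?_, rfl, ?_⟩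
  · intro S f l hl
    rw [M.smul_proj, Category.assoc, h]
  · intro R S k f l hl
    rw [M.comp_smul, ← Category.assoc]
    congr 1
    refine (hu _ _ (by rw [Category.assoc, hl, Category.assoc]) _ ?_).symm
    rw [Category.assoc, ← L.comp_smul, hc]
    exact hl
  · intro S f l hl a
    rw [← M.mul_smul]
    congr 1
    refine hu _ _ (by rw [L.smul_proj, hl]) _ ?_
    rw [L.mul_smul, hc]
    exact hl
  · intro S f hx
    refine (mk'_ev _ _ _ _ _ _ _ _).trans ?_
    rw [hu f (f ≫ s) _ 1 (L.one_smul _), M.one_smul]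
    exact (Category.assoc _ _ _).symm

end HomPt

end LineBundle

namespace LineBundle

variable {X : Scheme.{u}}

lemma exists_local_lift {S T : Scheme.{u}} (𝒰 : Scheme.OpenCover.{u} T) (f : S ⟶ T) (s : S) :
    ∃ (V : S.Opens) (_ : s ∈ V) (i : 𝒰.I₀) (y : V.toScheme ⟶ 𝒰.X i), y ≫ 𝒰.f i = V.ι ≫ f := by
  obtain ⟨i, z, hz⟩ := 𝒰.exists_eq (f s)
  refine ⟨f ⁻¹ᵁ (𝒰.f i).opensRange, ⟨z, hz⟩, i, IsOpenImmersion.lift (𝒰.f i)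
    ((f ⁻¹ᵁ (𝒰.f i).opensRange).ι ≫ f) ?_, IsOpenImmersion.lift_fac _ _ _⟩
  rintro _ ⟨w, rfl⟩
  exact w.2

namespace HomPt

variable {L M : LineBundle X} {T : Scheme.{u}}

lemma ext_frame {e e' : HomPt L M T} (hx : e.x = e'.x) {s : T ⟶ L.total} (hs : L.IsFrame s)
    (hsx : 𝟙 T ≫ e.x = s ≫ L.proj)
    (h : e.ev (𝟙 T) s hsx = e'.ev (𝟙 T) s (by rw [← hx, hsx])) : e = e' := by
  refine ext' hx fun {S} f l hl ↦ ?_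
  obtain ⟨a, ha⟩ := frame_exists (isFrame_comp hs f) l (by
    rw [← hl, Category.assoc, ← hsx, Category.id_comp])
  have h₁ : f ≫ e.x = (f ≫ s) ≫ L.proj := by rw [Category.assoc, ← hsx, Category.id_comp]
  have h₂ : f ≫ e'.x = (f ≫ s) ≫ L.proj := by rw [← hx, h₁]
  rw [e.ev_congr rfl ha.symm, e'.ev_congr rfl ha.symm, e.ev_smul f _ h₁, e'.ev_smul f _ h₂,
    e.ev_congr (Category.comp_id f).symm rfl h₁, e'.ev_congr (Category.comp_id f).symm rfl h₂,
    ← comp_ev (h := hsx), ← comp_ev (h := by rw [← hx, hsx]), h]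

lemma ext_cover (𝒰 : Scheme.OpenCover.{u} T) (e e' : HomPt L M T)
    (h : ∀ i, e.res (𝒰.f i) = e'.res (𝒰.f i)) : e = e' := by
  have hx : e.x = e'.x := 𝒰.hom_ext _ _ fun i ↦ congr_arg HomPt.x (h i)
  refine ext' hx fun {S} f l hl ↦ Scheme.hom_ext_of_forall _ _ fun s ↦ ?_
  obtain ⟨V, hV, i, y, hy⟩ := exists_local_lift 𝒰 f s
  refine ⟨V, hV, ?_⟩
  have key (e : HomPt L M T) (hl : f ≫ e.x = l ≫ L.proj) :
      V.ι ≫ e.ev f l hl = (e.res (𝒰.f i)).ev y (V.ι ≫ l) (by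
        change y ≫ 𝒰.f i ≫ e.x = _
        rw [← Category.assoc, hy, Category.assoc, hl, Category.assoc]) := by
    refine (comp_ev _ _ _ _ _).trans (Eq.trans ?_ (res_ev _ _ _ _ _).symm)
    exact e.ev_congr hy.symm rfl _
  rw [key e, key e']
  congr 1
  rw [h]

lemma glue (𝒰 : Scheme.OpenCover.{u} T) (e : ∀ i, HomPt L M (𝒰.X i))
    (h : ∀ i j, (e i).res (pullback.fst (𝒰.f i) (𝒰.f j)) =
      (e j).res (pullback.snd (𝒰.f i) (𝒰.f j))) :
    ∃ e' : HomPt L M T, ∀ i, e'.res (𝒰.f i) = e i := by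
  let x : T ⟶ X := 𝒰.glueMorphisms (fun i ↦ (e i).x) fun i j ↦ congr_arg HomPt.x (h i j)
  have hx (i) : 𝒰.f i ≫ x = (e i).x := 𝒰.ι_glueMorphisms _ _ i
  have agree {R : Scheme.{u}} (i j) (y : R ⟶ 𝒰.X i) (z : R ⟶ 𝒰.X j)
      (hyz : y ≫ 𝒰.f i = z ≫ 𝒰.f j) (l : R ⟶ L.total) (hl : y ≫ (e i).x = l ≫ L.proj)
      (hl' : z ≫ (e j).x = l ≫ L.proj) : (e i).ev y l hl = (e j).ev z l hl' := by
    have hy : pullback.lift y z hyz ≫ pullback.fst _ _ = y := pullback.lift_fst _ _ _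
    have hz : pullback.lift y z hyz ≫ pullback.snd _ _ = z := pullback.lift_snd _ _ _
    have h₁ := res_ev (pullback.fst (𝒰.f i) (𝒰.f j)) (e i) (pullback.lift y z hyz) l
      (by rw [← Category.assoc, hy, hl])
    have h₂ := res_ev (pullback.snd (𝒰.f i) (𝒰.f j)) (e j) (pullback.lift y z hyz) l
      (by rw [← Category.assoc, hz, hl'])
    rw [(e i).ev_congr hy.symm rfl, (e j).ev_congr hz.symm rfl, ← h₁, ← h₂]
    congr 1
    exact h i j
  have ex {S : Scheme.{u}} (f : S ⟶ T) (l : S ⟶ L.total) (hl : f ≫ x = l ≫ L.proj) :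
      ∃ w : S ⟶ M.total, ∀ {R : Scheme.{u}} (k : R ⟶ S) (i : 𝒰.I₀) (y : R ⟶ 𝒰.X i)
        (_ : y ≫ 𝒰.f i = k ≫ f) (hx : y ≫ (e i).x = (k ≫ l) ≫ L.proj),
        k ≫ w = (e i).ev y (k ≫ l) hx := by
    let P : ∀ {R : Scheme.{u}}, (R ⟶ S) → (R ⟶ M.total) → Prop := fun {R} k q ↦
      ∃ (i : 𝒰.I₀) (y : R ⟶ 𝒰.X i) (_ : y ≫ 𝒰.f i = k ≫ f)
        (hx : y ≫ (e i).x = (k ≫ l) ≫ L.proj), q = (e i).ev y (k ≫ l) hx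
    obtain ⟨w, hw⟩ := exists_glue P (by
        rintro R' R j k q ⟨i, y, h₁, h₂, rfl⟩
        refine ⟨i, j ≫ y, by rw [Category.assoc, h₁, Category.assoc],
          by rw [Category.assoc, h₂]; simp only [Category.assoc], ?_⟩
        rw [comp_ev]
        exact ev_congr _ rfl (Category.assoc _ _ _).symm _) (by
        rintro R k q q' ⟨i, y, h₁, h₂, rfl⟩ ⟨j, z, h₃, h₄, rfl⟩
        exact agree _ _ _ _ (h₁.trans h₃.symm) _ _ _) (by
        intro s
        obtain ⟨V, hV, i, y, hy⟩ := exists_local_lift 𝒰 f s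
        exact ⟨V, hV, _, i, y, hy, by
          rw [← hx, ← Category.assoc, hy, Category.assoc, hl, Category.assoc], rfl⟩)
    exact ⟨w, fun k i y h₁ h₂ ↦ hw _ _ ⟨i, y, h₁, h₂, rfl⟩⟩
  let v {S : Scheme.{u}} (f : S ⟶ T) (l : S ⟶ L.total) (hl : f ≫ x = l ≫ L.proj) : S ⟶ M.total :=
    (ex f l hl).choose
  have hv {S : Scheme.{u}} (f : S ⟶ T) (l : S ⟶ L.total) (hl : f ≫ x = l ≫ L.proj)
      {R : Scheme.{u}} (k : R ⟶ S) (i : 𝒰.I₀) (y : R ⟶ 𝒰.X i) (hy : y ≫ 𝒰.f i = k ≫ f) :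
      k ≫ v f l hl = (e i).ev y (k ≫ l) (by
        rw [← hx, ← Category.assoc, hy, Category.assoc, hl, Category.assoc]) :=
    (ex f l hl).choose_spec k i y hy _
  refine ⟨mk' x v ?_ ?_ ?_, fun i ↦ ext' (hx i) ?_⟩
  · intro S f l hl
    refine Scheme.hom_ext_of_forall _ _ fun s ↦ ?_
    obtain ⟨V, hV, i, y, hy⟩ := exists_local_lift 𝒰 f s
    refine ⟨V, hV, ?_⟩
    rw [← Category.assoc, hv f l hl _ i y hy, ev_proj, ← hx, ← Category.assoc, hy, Category.assoc]
  · intro R S k f l hl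
    refine Scheme.hom_ext_of_forall _ _ fun s ↦ ?_
    obtain ⟨V, hV, i, y, hy⟩ := exists_local_lift 𝒰 (k ≫ f) s
    refine ⟨V, hV, ?_⟩
    rw [← Category.assoc, hv f l hl (V.ι ≫ k) i y (by rw [hy, Category.assoc]), hv _ _ _ _ i y hy]
    · exact ev_congr _ rfl (Category.assoc _ _ _) _
    · rw [Category.assoc, hl, Category.assoc]
  · intro S f l hl a
    refine Scheme.hom_ext_of_forall _ _ fun s ↦ ?_
    obtain ⟨V, hV, i, y, hy⟩ := exists_local_lift 𝒰 f s
    refine ⟨V, hV, ?_⟩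
    rw [M.comp_smul, hv f l hl _ i y hy, hv f _ _ _ i y hy, ← ev_smul]
    · exact ev_congr _ rfl (L.comp_smul _ _ _) _
    · rw [L.smul_proj, hl]
  · intro S f l hl
    have hl' : (f ≫ 𝒰.f i) ≫ x = l ≫ L.proj := by rw [Category.assoc]; exact hl
    have := hv (f ≫ 𝒰.f i) l hl' (𝟙 S) i f (Category.id_comp _).symm
    rw [Category.id_comp] at this
    refine (res_ev _ _ _ _ _).trans ((mk'_ev _ _ _ _ _ _ _ _).trans (this.trans ?_))
    exact ev_congr _ rfl (Category.id_comp _) _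

end HomPt

/-- The functor of points of the line bundle of linear morphisms from `L` to `M`. -/
def homSheaf (L M : LineBundle X) : PointSheaf X where
  pts := HomPt L M
  res f e := e.res f
  res_id e := HomPt.ext' (Category.id_comp _) fun f l h ↦
    (HomPt.res_ev _ _ _ _ _).trans (HomPt.ev_congr _ (Category.comp_id _) rfl _)
  res_comp f g e := HomPt.ext' (Category.assoc _ _ _) fun k l h ↦ by
    refine (HomPt.res_ev _ _ _ _ _).trans ?_
    refine Eq.trans ?_ (HomPt.res_ev _ _ _ _ _).symm
    refine Eq.trans ?_ (HomPt.res_ev _ _ _ _ _).symm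
    exact HomPt.ev_congr _ (Category.assoc _ _ _).symm rfl _
  base e := e.x
  base_res f e := rfl
  smul a e := e.smul a
  base_smul a e := rfl
  res_smul k a e := HomPt.ext' rfl fun f l h ↦ by
    refine (HomPt.res_ev _ _ _ _ _).trans ?_
    refine (HomPt.smul_ev _ _ _ _ _).trans ?_
    refine Eq.trans ?_ (HomPt.smul_ev _ _ _ _ _).symm
    rw [pullFun_comp]
    exact congr_arg _ (HomPt.res_ev _ _ _ _ _).symm
  one_smul e := HomPt.ext' rfl fun f l h ↦ by
    refine (HomPt.smul_ev _ _ _ _ _).trans ?_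
    rw [map_one, M.one_smul]
  mul_smul a b e := HomPt.ext' rfl fun f l h ↦ by
    refine (HomPt.smul_ev _ _ _ _ _).trans ?_
    refine Eq.trans ?_ (HomPt.smul_ev _ _ _ _ _).symm
    rw [map_mul, M.mul_smul]
    exact congr_arg _ (HomPt.smul_ev _ _ _ _ _).symm
  ext := HomPt.ext_cover
  glue := HomPt.glue
  exists_frame x := by
    obtain ⟨U, hU, s, r, ⟨hs, fs⟩, hr, fr⟩ := exists_local_frame₂ L M (𝟙 X) x
    obtain ⟨e, hx, he⟩ := HomPt.exists_of_frame (r := r) fs (by rw [hs, hr])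
    rw [hs, Category.comp_id] at hx
    refine ⟨U, hU, e, hx, fun {S} f l hl ↦ ?_⟩
    have hx' : f ≫ e.x = (f ≫ s) ≫ L.proj := by rw [hx, Category.assoc, hs, Category.comp_id]
    have hl' : 𝟙 S ≫ l.x = (f ≫ s) ≫ L.proj := by rw [hl, Category.id_comp, ← hx', hx]
    have key (a : Γ(S, ⊤)) : ((e.res f).smul a).ev (𝟙 S) (f ≫ s)
        (by change 𝟙 S ≫ f ≫ e.x = _; rw [Category.id_comp, hx']) = M.smul a (f ≫ r) := by
      refine (HomPt.smul_ev _ _ _ _ _).trans ?_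
      rw [pullFun_id, ← he f hx']
      congr 1
      exact (HomPt.res_ev _ _ _ _ _).trans (HomPt.ev_congr _ (Category.id_comp _) rfl _)
    obtain ⟨a, ha, hu⟩ := fr f (l.ev (𝟙 S) (f ≫ s) hl') (by
      rw [HomPt.ev_proj, hr, hl, Category.comp_id, Category.id_comp])
    refine ⟨a, HomPt.ext_frame (by change f ≫ e.x = _; rw [hl, hx]) (isFrame_comp fs f)
      (by change 𝟙 S ≫ f ≫ e.x = _; rw [Category.id_comp, hx']) ((key a).trans ha),
      fun c hc ↦ hu c ?_⟩
    change M.smul c (f ≫ r) = _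
    rw [← key]
    congr 1

end LineBundle

namespace LineBundle

variable {X : Scheme.{u}}

/-- The line bundle of linear morphisms from `L` to `M`. -/
def hom (L M : LineBundle X) : LineBundle X := (homSheaf L M).toLineBundle

variable {L M : LineBundle X}

/-- The linear morphism given by a point of `hom L M`. -/
def toHomPt {T : Scheme.{u}} (p : T ⟶ (hom L M).total) : HomPt L M T := (homSheaf L M).pt p

/-- The point of `hom L M` given by a linear morphism. -/
def ofHomPt {T : Scheme.{u}} (e : HomPt L M T) : T ⟶ (hom L M).total := (homSheaf L M).hom e

@[simp]
lemma toHomPt_ofHomPt {T : Scheme.{u}} (e : HomPt L M T) : toHomPt (ofHomPt e) = e :=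
  (homSheaf L M).pt_hom e

@[simp]
lemma ofHomPt_toHomPt {T : Scheme.{u}} (p : T ⟶ (hom L M).total) : ofHomPt (toHomPt p) = p :=
  (homSheaf L M).hom_pt p

lemma toHomPt_comp {S T : Scheme.{u}} (f : S ⟶ T) (p : T ⟶ (hom L M).total) :
    toHomPt (f ≫ p) = (toHomPt p).res f := (homSheaf L M).pt_comp f p

lemma toHomPt_x {T : Scheme.{u}} (p : T ⟶ (hom L M).total) :
    (toHomPt p).x = p ≫ (hom L M).proj := (homSheaf L M).base_pt p

lemma toHomPt_smul {T : Scheme.{u}} (a : Γ(T, ⊤)) (p : T ⟶ (hom L M).total) :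
    toHomPt ((hom L M).smul a p) = (toHomPt p).smul a := (homSheaf L M).pt_hom _

lemma toHomPt_injective {T : Scheme.{u}} {p q : T ⟶ (hom L M).total}
    (h : toHomPt p = toHomPt q) : p = q := (homSheaf L M).pt_injective h

lemma ofHomPt_proj {T : Scheme.{u}} (e : HomPt L M T) :
    ofHomPt e ≫ (hom L M).proj = e.x := by rw [← toHomPt_x, toHomPt_ofHomPt]

lemma HomPt.ev_eq {T : Scheme.{u}} {e e' : HomPt L M T} (he : e = e') {S : Scheme.{u}} (f : S ⟶ T)
    (l : S ⟶ L.total) (h : f ≫ e.x = l ≫ L.proj) :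
    e.ev f l h = e'.ev f l (by rw [← he, h]) := by
  subst he; rfl

/-- The evaluation pairing. -/
def evPairing (L M : LineBundle X) : TensorPairing (hom L M) L M where
  pair p l h := (toHomPt p).ev (𝟙 _) l (by rw [toHomPt_x, Category.id_comp, h])
  pair_proj p l h := by rw [HomPt.ev_proj, toHomPt_x, Category.id_comp]
  comp_pair {S T} f p l h := by
    have hl : 𝟙 S ≫ f ≫ (toHomPt p).x = (f ≫ l) ≫ L.proj := by
      rw [toHomPt_x, Category.id_comp, h, Category.assoc]
    refine (HomPt.comp_ev _ _ _ _ _).trans ?_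
    refine (HomPt.ev_congr _ ((Category.comp_id f).trans (Category.id_comp f).symm) rfl _).trans ?_
    refine (HomPt.res_ev f (toHomPt p) (𝟙 _) (f ≫ l) hl).symm.trans ?_
    exact HomPt.ev_eq (toHomPt_comp f p).symm _ _ _
  smul_pair {T} a p l h := by
    have hl : 𝟙 T ≫ (toHomPt p).x = l ≫ L.proj := by rw [toHomPt_x, Category.id_comp, h]
    refine (HomPt.ev_eq (toHomPt_smul a p) _ _ _).trans ?_
    refine (HomPt.smul_ev a (toHomPt p) (𝟙 _) l hl).trans ?_
    rw [pullFun_id]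
  pair_smul a p l h := HomPt.ev_smul _ _ _ _ _
  isFrame_pair {T} p l h hp hl := by
    intro S f m hm
    have hx : 𝟙 T ≫ (toHomPt p).x = l ≫ L.proj := by rw [toHomPt_x, Category.id_comp, h]
    have hm' : (f ≫ l) ≫ L.proj = m ≫ M.proj := by
      rw [hm, HomPt.ev_proj, hx, Category.assoc]
    obtain ⟨e, hex, he⟩ := HomPt.exists_of_frame (isFrame_comp hl f) hm'
    have hex' : 𝟙 S ≫ e.x = (f ≫ l) ≫ L.proj := by rw [hex, Category.id_comp]
    have he' : e.ev (𝟙 S) (f ≫ l) hex' = m := by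
      refine (HomPt.ev_congr _ rfl (Category.id_comp _).symm _).trans ?_
      refine (he (𝟙 S) _).trans (Category.id_comp _)
    obtain ⟨a, ha, hu⟩ := hp f (ofHomPt e) (by
      rw [ofHomPt_proj, hex, h, Category.assoc])
    have key (c : Γ(S, ⊤)) (h₁ : 𝟙 S ≫ (toHomPt ((hom L M).smul c (f ≫ p))).x =
        (f ≫ l) ≫ L.proj) :
        (toHomPt ((hom L M).smul c (f ≫ p))).ev (𝟙 S) (f ≫ l) h₁ =
          M.smul c (f ≫ (toHomPt p).ev (𝟙 T) l hx) := by
      have h₂ : 𝟙 S ≫ ((toHomPt p).res f).x = (f ≫ l) ≫ L.proj := by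
        change 𝟙 S ≫ f ≫ (toHomPt p).x = _
        rw [Category.id_comp, toHomPt_x, h, Category.assoc]
      refine (HomPt.ev_eq (e' := ((toHomPt p).res f).smul c)
        (by rw [toHomPt_smul, toHomPt_comp]) _ _ _).trans ?_
      refine (HomPt.smul_ev _ _ _ _ h₂).trans ?_
      rw [pullFun_id]
      congr 1
      refine (HomPt.res_ev _ _ _ _ _).trans ?_
      refine Eq.trans ?_ (HomPt.comp_ev _ _ _ _ _).symm
      exact HomPt.ev_congr _ ((Category.id_comp f).trans (Category.comp_id f).symm) rfl _
    have h₁ (c : Γ(S, ⊤)) : 𝟙 S ≫ (toHomPt ((hom L M).smul c (f ≫ p))).x =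
        (f ≫ l) ≫ L.proj := by
      rw [Category.id_comp, toHomPt_x, ScalarScheme.smul_proj, Category.assoc, h, Category.assoc]
    refine ⟨a, ?_, fun c hc ↦ hu c ?_⟩
    · change M.smul a _ = m
      rw [← key a (h₁ a), ← he']
      exact HomPt.ev_eq (by rw [ha, toHomPt_ofHomPt]) _ _ _
    · apply toHomPt_injective
      rw [toHomPt_ofHomPt]
      refine HomPt.ext_frame ?_ (isFrame_comp hl f) (h₁ c) ?_
      · rw [← Category.id_comp (toHomPt _).x, h₁, hex]
      · rw [key, he']
        exact hc

lemma ofHomPt_pair {T : Scheme.{u}} (e : HomPt L M T) (l : T ⟶ L.total)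
    (h : ofHomPt e ≫ (hom L M).proj = l ≫ L.proj) :
    (evPairing L M).pair (ofHomPt e) l h =
      e.ev (𝟙 T) l (by rw [Category.id_comp, ← ofHomPt_proj, h]) :=
  HomPt.ev_eq (toHomPt_ofHomPt e) _ _ _

/-- Points of `hom L M` are determined by their values. -/
lemma hom_ext {T : Scheme.{u}} {p q : T ⟶ (hom L M).total}
    (h : p ≫ (hom L M).proj = q ≫ (hom L M).proj)
    (hv : ∀ {S : Scheme.{u}} (f : S ⟶ T) (l : S ⟶ L.total)
      (hl : (f ≫ p) ≫ (hom L M).proj = l ≫ L.proj),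
      (evPairing L M).pair (f ≫ p) l hl = (evPairing L M).pair (f ≫ q) l
        (by rw [← hl, Category.assoc, Category.assoc, h])) : p = q := by
  apply toHomPt_injective
  refine HomPt.ext' (by rw [toHomPt_x, toHomPt_x, h]) fun {S} f l hl ↦ ?_
  have key (p : T ⟶ (hom L M).total) (hl : (f ≫ p) ≫ (hom L M).proj = l ≫ L.proj) :
      (evPairing L M).pair (f ≫ p) l hl = (toHomPt p).ev f l
        (by rw [toHomPt_x, ← hl, Category.assoc]) := by
    refine (HomPt.ev_eq (toHomPt_comp f p) _ _ _).trans ?_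
    refine (HomPt.res_ev _ _ _ _ _).trans ?_
    exact HomPt.ev_congr _ (Category.id_comp f) rfl _
  rw [toHomPt_x, ← Category.assoc] at hl
  rw [← key p hl, ← key q (by rw [← hl, Category.assoc, Category.assoc, h]), hv f l hl]

/-- Points of `hom L M` given by values. -/
lemma exists_hom_pt {T : Scheme.{u}} (x : T ⟶ X) (v : ∀ {S : Scheme.{u}} (f : S ⟶ T)
      (l : S ⟶ L.total), f ≫ x = l ≫ L.proj → (S ⟶ M.total))
    (v_proj : ∀ {S : Scheme.{u}} (f : S ⟶ T) (l : S ⟶ L.total) (h : f ≫ x = l ≫ L.proj),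
      v f l h ≫ M.proj = f ≫ x)
    (comp_v : ∀ {R S : Scheme.{u}} (k : R ⟶ S) (f : S ⟶ T) (l : S ⟶ L.total)
      (h : f ≫ x = l ≫ L.proj), k ≫ v f l h = v (k ≫ f) (k ≫ l) (by simp [h]))
    (v_smul : ∀ {S : Scheme.{u}} (f : S ⟶ T) (l : S ⟶ L.total) (h : f ≫ x = l ≫ L.proj)
      (a : Γ(S, ⊤)), v f (L.smul a l) (by simp [h]) = M.smul a (v f l h)) :
    ∃ (p : T ⟶ (hom L M).total) (_ : p ≫ (hom L M).proj = x), ∀ {S : Scheme.{u}} (f : S ⟶ T)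
      (l : S ⟶ L.total) (h : (f ≫ p) ≫ (hom L M).proj = l ≫ L.proj) (h' : f ≫ x = l ≫ L.proj),
      (evPairing L M).pair (f ≫ p) l h = v f l h' := by
  refine ⟨ofHomPt (HomPt.mk' x v v_proj comp_v v_smul), ofHomPt_proj _, fun f l h h' ↦ ?_⟩
  refine (HomPt.ev_eq (toHomPt_comp _ _) _ _ _).trans ?_
  refine (HomPt.res_ev _ _ _ _ _).trans ?_
  refine (HomPt.ev_eq (toHomPt_ofHomPt _) _ _ _).trans ?_
  refine (HomPt.mk'_ev _ _ _ _ _ _ _ _).trans ?_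
  congr 1

lemma hom_ext_frame {T : Scheme.{u}} {p q : T ⟶ (hom L M).total}
    (h : p ≫ (hom L M).proj = q ≫ (hom L M).proj) {l : T ⟶ L.total} (hl : L.IsFrame l)
    (hp : p ≫ (hom L M).proj = l ≫ L.proj)
    (hv : (evPairing L M).pair p l hp = (evPairing L M).pair q l (by rw [← h, hp])) : p = q :=
  toHomPt_injective (HomPt.ext_frame (by rw [toHomPt_x, toHomPt_x, h]) hl
    (by rw [toHomPt_x, Category.id_comp, hp]) hv)

lemma isFrame_of_pair {T : Scheme.{u}} {p : T ⟶ (hom L M).total} {l : T ⟶ L.total}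
    (hl : L.IsFrame l) (h : p ≫ (hom L M).proj = l ≫ L.proj)
    (hv : M.IsFrame ((evPairing L M).pair p l h)) : (hom L M).IsFrame p := by
  intro S f q hq
  have h₁ : q ≫ (hom L M).proj = (f ≫ l) ≫ L.proj := by rw [hq, h, Category.assoc]
  have h₂ : (f ≫ p) ≫ (hom L M).proj = (f ≫ l) ≫ L.proj := by
    rw [Category.assoc, h, Category.assoc]
  have h₃ (a : Γ(S, ⊤)) : (hom L M).smul a (f ≫ p) ≫ (hom L M).proj = (f ≫ l) ≫ L.proj := by
    rw [ScalarScheme.smul_proj, h₂]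
  have key (a : Γ(S, ⊤)) : (evPairing L M).pair ((hom L M).smul a (f ≫ p)) (f ≫ l) (h₃ a) =
      M.smul a (f ≫ (evPairing L M).pair p l h) := by
    rw [(evPairing L M).smul_pair a _ _ h₂, (evPairing L M).comp_pair]
  obtain ⟨a, ha, hu⟩ := hv f ((evPairing L M).pair q (f ≫ l) h₁) (by
    rw [TensorPairing.pair_proj, TensorPairing.pair_proj, hq])
  refine ⟨a, hom_ext_frame ((h₃ a).trans h₁.symm) (isFrame_comp hl f) (h₃ a)
    ((key a).trans ha), fun c hc ↦ hu c ?_⟩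
  change M.smul c _ = _
  rw [← key]
  exact TensorPairing.pair_congr _ hc rfl _

lemma exists_hom_frame {T : Scheme.{u}} {l : T ⟶ L.total} {m : T ⟶ M.total} (hl : L.IsFrame l)
    (h : l ≫ L.proj = m ≫ M.proj) :
    ∃ (p : T ⟶ (hom L M).total) (hp : p ≫ (hom L M).proj = l ≫ L.proj),
      (evPairing L M).pair p l hp = m := by
  obtain ⟨e, hx, he⟩ := HomPt.exists_of_frame hl h
  refine ⟨ofHomPt e, by rw [ofHomPt_proj, hx], ?_⟩
  rw [ofHomPt_pair]
  refine (HomPt.ev_congr _ rfl (Category.id_comp _).symm _).trans ?_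
  exact (he (𝟙 T) (by rw [hx, Category.id_comp, Category.id_comp])).trans (Category.id_comp _)

/-- The point `(x, a)` of `X × 𝔸¹`. -/
def linePt {T : Scheme.{u}} (x : T ⟶ X) (a : Γ(T, ⊤)) : T ⟶ 𝔸(PUnit.{u + 1}; X) :=
  AffineSpace.homOfVector x (fun _ ↦ a)

/-- The coordinate in `𝔸¹` of a point of `X × 𝔸¹`. -/
def lineCoord {T : Scheme.{u}} (l : T ⟶ 𝔸(PUnit.{u + 1}; X)) : Γ(T, ⊤) :=
  pullFun l (AffineSpace.coord X PUnit.unit)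

lemma linePt_over {T : Scheme.{u}} (x : T ⟶ X) (a : Γ(T, ⊤)) :
    linePt x a ≫ 𝔸(PUnit.{u + 1}; X) ↘ X = x := AffineSpace.homOfVector_over _ _

@[simp]
lemma lineCoord_linePt {T : Scheme.{u}} (x : T ⟶ X) (a : Γ(T, ⊤)) :
    lineCoord (linePt x a) = a :=
  AffineSpace.homOfVector_appTop_coord x (fun _ ↦ a) PUnit.unit

lemma line_ext {T : Scheme.{u}} {l l' : T ⟶ 𝔸(PUnit.{u + 1}; X)}
    (h : l ≫ 𝔸(PUnit.{u + 1}; X) ↘ X = l' ≫ 𝔸(PUnit.{u + 1}; X) ↘ X)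
    (h' : lineCoord l = lineCoord l') : l = l' :=
  AffineSpace.hom_ext h fun _ ↦ h'

lemma lineCoord_comp {S T : Scheme.{u}} (f : S ⟶ T) (l : T ⟶ 𝔸(PUnit.{u + 1}; X)) :
    lineCoord (f ≫ l) = pullFun f (lineCoord l) := pullFun_comp _ _ _

lemma comp_linePt {S T : Scheme.{u}} (f : S ⟶ T) (x : T ⟶ X) (a : Γ(T, ⊤)) :
    f ≫ linePt x a = linePt (f ≫ x) (pullFun f a) := by
  apply line_ext
  · rw [Category.assoc, linePt_over, linePt_over]
  · rw [lineCoord_comp, lineCoord_linePt, lineCoord_linePt]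

/-- The scheme `X × 𝔸¹` with the scalar multiplication `a • (x, b) = (x, a b)`. -/
abbrev trivialScalar (X : Scheme.{u}) : ScalarScheme X where
  total := 𝔸(PUnit.{u + 1}; X)
  proj := 𝔸(PUnit.{u + 1}; X) ↘ X
  smul a l := linePt (l ≫ 𝔸(PUnit.{u + 1}; X) ↘ X) (a * lineCoord l)
  smul_proj a l := linePt_over _ _
  comp_smul f a l := by
    rw [comp_linePt, Category.assoc, map_mul, lineCoord_comp]
  one_smul l := line_ext (linePt_over _ _) (by rw [lineCoord_linePt, one_mul])
  mul_smul a b l := line_ext (by simp only [linePt_over])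
    (by simp only [lineCoord_linePt, mul_assoc])

lemma isFrame_linePt {T : Scheme.{u}} (x : T ⟶ X) : (trivialScalar X).IsFrame (linePt x 1) := by
  intro S f l hl
  have key (a : Γ(S, ⊤)) : (trivialScalar X).smul a (f ≫ linePt x 1) = l ↔ a = lineCoord l := by
    constructor
    · rintro rfl
      refine Eq.trans ?_ (lineCoord_linePt _ _).symm
      rw [lineCoord_comp, lineCoord_linePt, map_one, mul_one]
    · rintro rfl
      refine line_ext ((linePt_over _ _).trans ((Category.assoc _ _ _).trans hl.symm)) ?_
      refine (lineCoord_linePt _ _).trans ?_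
      rw [lineCoord_comp, lineCoord_linePt, map_one, mul_one]
  exact ⟨lineCoord l, (key _).2 rfl, fun c hc ↦ (key c).1 hc⟩

/-- The trivial line bundle `X × 𝔸¹`. -/
abbrev trivial (X : Scheme.{u}) : LineBundle X where
  toScalarScheme := trivialScalar X
  exists_frame _ := ⟨⊤, _root_.trivial, linePt (⊤ : X.Opens).ι 1, linePt_over _ _,
    isFrame_linePt _⟩

/-- The pairing `(x, a), m ↦ a • m`. -/
def unitPairing (M : LineBundle X) : TensorPairing (trivial X) M M where
  pair l m h := M.smul (lineCoord l) m
  pair_proj l m h := by rw [M.smul_proj, h]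
  comp_pair f l m h := by rw [M.comp_smul, lineCoord_comp]
  smul_pair a l m h := by
    rw [← M.mul_smul]
    congr 1
    exact lineCoord_linePt _ _
  pair_smul a l m h := by rw [← M.mul_smul, ← M.mul_smul, mul_comm]
  isFrame_pair l m h hl hm := by
    obtain ⟨a, b, hab, h₁, h₂⟩ := frame_ratio (isFrame_linePt (l ≫ (trivial X).proj)) hl
      (linePt_over _ _).symm
    refine isFrame_smul (b := b) hm ?_
    rw [← hab, ← h₁]
    congr 1
    refine (lineCoord_linePt _ _).trans ?_
    rw [lineCoord_linePt, mul_one]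

/-- The dual line bundle. -/
abbrev dual (L : LineBundle X) : LineBundle X := hom L (trivial X)

/-- The tensor product of two line bundles, as the line bundle of linear morphisms from the dual
of the first one to the second one. -/
abbrev tensor (L M : LineBundle X) : LineBundle X := hom (dual L) M

lemma exists_tensor_pt {T : Scheme.{u}} (l : T ⟶ L.total) (m : T ⟶ M.total)
    (h : l ≫ L.proj = m ≫ M.proj) :
    ∃ (p : T ⟶ (tensor L M).total) (_ : p ≫ (tensor L M).proj = l ≫ L.proj),
      ∀ {S : Scheme.{u}} (f : S ⟶ T) (ξ : S ⟶ (dual L).total)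
        (h₁ : (f ≫ p) ≫ (tensor L M).proj = ξ ≫ (dual L).proj)
        (h₂ : ξ ≫ (dual L).proj = (f ≫ l) ≫ L.proj),
        (evPairing (dual L) M).pair (f ≫ p) ξ h₁ =
          M.smul (lineCoord ((evPairing L (trivial X)).pair ξ (f ≫ l) h₂)) (f ≫ m) := by
  obtain ⟨p, hp, hv⟩ := exists_hom_pt (L := dual L) (M := M) (l ≫ L.proj) (fun {S} f ξ hξ ↦
    M.smul (lineCoord ((evPairing L (trivial X)).pair ξ (f ≫ l)
      (by rw [Category.assoc]; exact hξ.symm))) (f ≫ m)) (fun f ξ hξ ↦ by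
      rw [M.smul_proj, Category.assoc, h]) (fun k f ξ hξ ↦ by
      rw [M.comp_smul, ← lineCoord_comp]
      congr 1
      · congr 1
        refine (TensorPairing.comp_pair _ _ _ _ _).trans ?_
        exact TensorPairing.pair_congr _ rfl (Category.assoc _ _ _).symm _) (fun f ξ hξ a ↦ by
      rw [← M.mul_smul]
      congr 1
      refine (congr_arg lineCoord (TensorPairing.smul_pair _ a ξ (f ≫ l)
        (by rw [Category.assoc]; exact hξ.symm))).trans ?_
      exact lineCoord_linePt _ _)
  exact ⟨p, hp, fun f ξ h₁ h₂ ↦ hv f ξ h₁ (by rw [h₂, Category.assoc])⟩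

/-- The point `l ⊗ m`, which sends `ξ` to `ξ(l) • m`. -/
def tensorPt {T : Scheme.{u}} (l : T ⟶ L.total) (m : T ⟶ M.total)
    (h : l ≫ L.proj = m ≫ M.proj) : T ⟶ (tensor L M).total := (exists_tensor_pt l m h).choose

lemma tensorPt_proj {T : Scheme.{u}} (l : T ⟶ L.total) (m : T ⟶ M.total)
    (h : l ≫ L.proj = m ≫ M.proj) : tensorPt l m h ≫ (tensor L M).proj = l ≫ L.proj :=
  (exists_tensor_pt l m h).choose_spec.choose

lemma tensorPt_ev {T : Scheme.{u}} (l : T ⟶ L.total) (m : T ⟶ M.total)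
    (h : l ≫ L.proj = m ≫ M.proj) {S : Scheme.{u}} (f : S ⟶ T) (ξ : S ⟶ (dual L).total)
    (h₁ : (f ≫ tensorPt l m h) ≫ (tensor L M).proj = ξ ≫ (dual L).proj)
    (h₂ : ξ ≫ (dual L).proj = (f ≫ l) ≫ L.proj) :
    (evPairing (dual L) M).pair (f ≫ tensorPt l m h) ξ h₁ =
      M.smul (lineCoord ((evPairing L (trivial X)).pair ξ (f ≫ l) h₂)) (f ≫ m) :=
  (exists_tensor_pt l m h).choose_spec.choose_spec f ξ h₁ h₂

/-- A point of `tensor L M` is determined by its values. -/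
lemma eq_tensorPt {T : Scheme.{u}} (l : T ⟶ L.total) (m : T ⟶ M.total)
    (h : l ≫ L.proj = m ≫ M.proj) (p : T ⟶ (tensor L M).total)
    (hp : p ≫ (tensor L M).proj = l ≫ L.proj)
    (hv : ∀ {S : Scheme.{u}} (f : S ⟶ T) (ξ : S ⟶ (dual L).total)
      (h₁ : (f ≫ p) ≫ (tensor L M).proj = ξ ≫ (dual L).proj)
      (h₂ : ξ ≫ (dual L).proj = (f ≫ l) ≫ L.proj),
      (evPairing (dual L) M).pair (f ≫ p) ξ h₁ =
        M.smul (lineCoord ((evPairing L (trivial X)).pair ξ (f ≫ l) h₂)) (f ≫ m)) :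
    p = tensorPt l m h := by
  refine hom_ext (hp.trans (tensorPt_proj l m h).symm) fun f ξ hξ ↦ ?_
  have h₂ : ξ ≫ (dual L).proj = (f ≫ l) ≫ L.proj := by
    rw [← hξ, Category.assoc, Category.assoc]
    exact congr_arg _ hp
  exact (hv f ξ hξ h₂).trans (tensorPt_ev l m h f ξ _ h₂).symm

/-- The pairing `l, m ↦ l ⊗ m`. -/
def tensorPairing (L M : LineBundle X) : TensorPairing L M (tensor L M) where
  pair := tensorPt
  pair_proj := tensorPt_proj
  comp_pair f l m h := by
    refine eq_tensorPt _ _ _ _ (by rw [Category.assoc, tensorPt_proj, Category.assoc]) ?_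
    intro S k ξ h₁ h₂
    refine (TensorPairing.pair_congr _ (Category.assoc _ _ _).symm rfl _).trans ?_
    refine (tensorPt_ev l m h (k ≫ f) ξ _ (by rw [h₂, Category.assoc k f l])).trans ?_
    congr 1
  smul_pair {T} a l m h := by
    refine (eq_tensorPt _ _ _ _ (by rw [ScalarScheme.smul_proj, tensorPt_proj, L.smul_proj]) ?_).symm
    intro S k ξ h₁ h₂
    have h₂' : ξ ≫ (dual L).proj = (k ≫ l) ≫ L.proj := by
      rw [h₂, Category.assoc, L.smul_proj, Category.assoc]
    have h₁' : (k ≫ tensorPt l m h) ≫ (tensor L M).proj = ξ ≫ (dual L).proj := by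
      rw [Category.assoc, tensorPt_proj, h₂', Category.assoc]
    refine (TensorPairing.pair_congr _ (ScalarScheme.comp_smul _ _ _ _) rfl _).trans ?_
    refine (TensorPairing.smul_pair _ _ _ _ h₁').trans ?_
    refine (congr_arg _ (tensorPt_ev l m h k ξ h₁' h₂')).trans ?_
    rw [← M.mul_smul]
    congr 1
    refine Eq.trans ?_ (congr_arg lineCoord
      (((evPairing L (LineBundle.trivial X)).pair_congr rfl (L.comp_smul k a l) h₂).trans
      ((evPairing L (LineBundle.trivial X)).pair_smul (pullFun k a) _ _ h₂'))).symm
    exact (lineCoord_linePt _ _).symm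
  pair_smul {T} a l m h := by
    refine (eq_tensorPt _ _ _ _ (by rw [ScalarScheme.smul_proj, tensorPt_proj]) ?_).symm
    intro S k ξ h₁ h₂
    have h₁' : (k ≫ tensorPt l m h) ≫ (tensor L M).proj = ξ ≫ (dual L).proj := by
      rw [Category.assoc, tensorPt_proj, h₂, Category.assoc]
    refine (TensorPairing.pair_congr _ (ScalarScheme.comp_smul _ _ _ _) rfl _).trans ?_
    refine (TensorPairing.smul_pair _ _ _ _ h₁').trans ?_
    refine (congr_arg _ (tensorPt_ev l m h k ξ h₁' h₂)).trans ?_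
    rw [← M.mul_smul, mul_comm, M.mul_smul, M.comp_smul]
  isFrame_pair {T} l m h hl hm := by
    obtain ⟨ξ, hξ, hξl⟩ := exists_hom_frame (M := LineBundle.trivial X) hl
      (m := linePt (l ≫ L.proj) 1) (linePt_over _ _).symm
    have hf : (dual L).IsFrame ξ := isFrame_of_pair hl hξ (by rw [hξl]; exact isFrame_linePt _)
    have hx := (tensorPt_proj l m h).trans hξ.symm
    suffices H : M.IsFrame ((evPairing (dual L) M).pair (tensorPt l m h) ξ hx) from
      fun {S} ↦ isFrame_of_pair (L := dual L) (M := M) hf hx H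
    have := tensorPt_ev l m h (𝟙 T) ξ (by rw [Category.id_comp, tensorPt_proj, hξ])
      (by rw [Category.id_comp, hξ])
    rw [TensorPairing.pair_congr _ (Category.id_comp _) rfl] at this
    rw [this, TensorPairing.pair_congr _ rfl (Category.id_comp _), hξl, lineCoord_linePt,
      M.one_smul, Category.id_comp]
    exact @hm

/-- Isomorphism of line bundles, as an equivalence relation. -/
instance isomSetoid (X : Scheme.{u}) : Setoid (LineBundle X) where
  r L M := Nonempty (Isom L M)
  iseqv := ⟨fun L ↦ ⟨Isom.refl L⟩, fun ⟨e⟩ ↦ ⟨e.symm⟩, fun ⟨e⟩ ⟨f⟩ ↦ ⟨e.trans f⟩⟩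

lemma TensorPairing.unique {L M N N' : LineBundle X} (b : TensorPairing L M N)
    (b' : TensorPairing L M N') : Nonempty (Isom N N') :=
  ⟨(b.frameRel_unique b').exists_iso.choose⟩

end LineBundle

/-- The Picard group: isomorphism classes of line bundles. -/
def Pic (X : Scheme.{u}) : Type (u + 1) := Quotient (LineBundle.isomSetoid X)

namespace Pic

open LineBundle

variable {X : Scheme.{u}}

/-- The class of a line bundle. -/
def mk (L : LineBundle X) : Pic X := Quotient.mk _ L

lemma mk_surjective : Function.Surjective (mk : LineBundle X → Pic X) := Quotient.mk_surjective

lemma mk_eq_iff {L M : LineBundle X} : mk L = mk M ↔ Nonempty (Isom L M) := Quotient.eq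

instance : One (Pic X) := ⟨mk (trivial X)⟩

instance : Mul (Pic X) := ⟨Quotient.map₂ tensor fun L L' ⟨e⟩ M M' ⟨f⟩ ↦
  ((tensorPairing L M).congr e.symm f.symm (Isom.refl _)).unique (tensorPairing L' M')⟩

lemma mk_mul {L M N : LineBundle X} (b : TensorPairing L M N) : mk L * mk M = mk N :=
  mk_eq_iff.2 ((tensorPairing L M).unique b)

/-- The monoid structure on the Picard group, given by tensor product of line bundles. -/
instance : CommMonoid (Pic X) where
  mul_assoc := by
    intro a b c
    obtain ⟨L, rfl⟩ := mk_surjective a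
    obtain ⟨M, rfl⟩ := mk_surjective b
    obtain ⟨N, rfl⟩ := mk_surjective c
    rw [mk_mul (tensorPairing L M), mk_mul (tensorPairing _ N), mk_mul (tensorPairing M N),
      mk_mul (tensorPairing L _), mk_eq_iff]
    exact ⟨((tensorPairing L M).frameRel_assoc (tensorPairing _ N) (tensorPairing M N)
      (tensorPairing L _)).exists_iso.choose⟩
  mul_comm := by
    intro a b
    obtain ⟨L, rfl⟩ := mk_surjective a
    obtain ⟨M, rfl⟩ := mk_surjective b
    rw [mk_mul (tensorPairing L M), mk_mul (tensorPairing L M).symm]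
  one_mul := by
    intro a
    obtain ⟨L, rfl⟩ := mk_surjective a
    exact mk_mul (unitPairing L)
  mul_one := by
    intro a
    obtain ⟨L, rfl⟩ := mk_surjective a
    exact mk_mul (unitPairing L).symm

lemma mk_dual_mul (L : LineBundle X) : mk (dual L) * mk L = 1 := mk_mul (evPairing L (trivial X))

instance : Inv (Pic X) := ⟨Quotient.map dual fun L L' h ↦ by
  have h' : mk L = mk L' := Quotient.sound h
  refine mk_eq_iff.1 (left_inv_eq_right_inv (mk_dual_mul L) ?_)
  rw [h', mul_comm, mk_dual_mul]⟩

/-- The group structure on the Picard group; inverses are given by duals. -/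
instance : CommGroup (Pic X) where
  inv_mul_cancel := by
    intro a
    obtain ⟨L, rfl⟩ := mk_surjective a
    exact mk_dual_mul L

end Pic

namespace LineBundle

variable {X Y : Scheme.{u}}

/-- The total space `Y ×_X L` of the pull-back of a line bundle, with its scalar multiplication. -/
abbrev pullScalar (f : Y ⟶ X) (L : ScalarScheme X) : ScalarScheme Y where
  total := pullback f L.proj
  proj := pullback.fst f L.proj
  smul a l := pullback.lift (l ≫ pullback.fst f L.proj) (L.smul a (l ≫ pullback.snd f L.proj))
    (by rw [L.smul_proj, Category.assoc, Category.assoc, pullback.condition])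
  smul_proj a l := pullback.lift_fst _ _ _
  comp_smul k a l := by
    apply pullback.hom_ext
    · rw [Category.assoc, pullback.lift_fst, pullback.lift_fst, Category.assoc]
    · rw [Category.assoc, pullback.lift_snd, pullback.lift_snd, L.comp_smul, Category.assoc]
  one_smul l := by
    apply pullback.hom_ext
    · rw [pullback.lift_fst]
    · rw [pullback.lift_snd, L.one_smul]
  mul_smul a b l := by
    apply pullback.hom_ext
    · rw [pullback.lift_fst, pullback.lift_fst, pullback.lift_fst]
    · rw [pullback.lift_snd, pullback.lift_snd, pullback.lift_snd, L.mul_smul]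

lemma pullScalar_smul_snd (f : Y ⟶ X) (L : ScalarScheme X) {T : Scheme.{u}} (a : Γ(T, ⊤))
    (l : T ⟶ (pullScalar f L).total) :
    (pullScalar f L).smul a l ≫ pullback.snd f L.proj = L.smul a (l ≫ pullback.snd f L.proj) :=
  pullback.lift_snd _ _ _

lemma isFrame_pullScalar (f : Y ⟶ X) (L : ScalarScheme X) {T : Scheme.{u}}
    (s : T ⟶ (pullScalar f L).total) (hs : L.IsFrame (s ≫ pullback.snd f L.proj)) :
    (pullScalar f L).IsFrame s := by
  intro S k l hl
  have hl' : l ≫ pullback.fst f L.proj = k ≫ s ≫ pullback.fst f L.proj := hl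
  have key (a : Γ(S, ⊤)) : (pullScalar f L).smul a (k ≫ s) = l ↔
      L.smul a (k ≫ s ≫ pullback.snd f L.proj) = l ≫ pullback.snd f L.proj := by
    constructor
    · rintro rfl
      rw [pullScalar_smul_snd, Category.assoc]
    · intro h
      apply pullback.hom_ext
      · rw [hl', ← Category.assoc]
        exact (pullScalar f L).smul_proj _ _
      · rw [pullScalar_smul_snd, Category.assoc, h]
  obtain ⟨a, ha, hu⟩ := hs k (l ≫ pullback.snd f L.proj) (by
    simp only [Category.assoc, ← pullback.condition]
    simp only [← Category.assoc]
    simp only [Category.assoc, hl'])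
  exact ⟨a, (key a).2 ha, fun c hc ↦ hu c ((key c).1 hc)⟩

/-- The pull-back of a line bundle. -/
abbrev pull (f : Y ⟶ X) (L : LineBundle X) : LineBundle Y where
  toScalarScheme := pullScalar f L.toScalarScheme
  exists_frame y := by
    obtain ⟨V, hV, s, hs, hf⟩ := L.exists_local_frame f y
    refine ⟨V, hV, pullback.lift V.ι s hs.symm, pullback.lift_fst _ _ _,
      isFrame_pullScalar _ _ _ ?_⟩
    rw [pullback.lift_snd]
    exact @hf

lemma isFrame_of_pullScalar (f : Y ⟶ X) (L : ScalarScheme X) {T : Scheme.{u}}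
    (s : T ⟶ (pullScalar f L).total) (hs : (pullScalar f L).IsFrame s) :
    L.IsFrame (s ≫ pullback.snd f L.proj) := by
  intro S k l hl
  have hl' : (k ≫ s ≫ pullback.fst f L.proj) ≫ f = l ≫ L.proj := by
    rw [hl, Category.assoc, Category.assoc, pullback.condition, Category.assoc]
  have key (a : Γ(S, ⊤)) : (pullScalar f L).smul a (k ≫ s) = pullback.lift _ l hl' ↔
      L.smul a (k ≫ s ≫ pullback.snd f L.proj) = l := by
    constructor
    · intro h
      have := congr_arg (fun p ↦ p ≫ pullback.snd f L.proj) h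
      rw [← Category.assoc k, ← pullScalar_smul_snd]
      exact this.trans (pullback.lift_snd _ _ _)
    · intro h
      apply pullback.hom_ext
      · refine ((pullScalar f L).smul_proj _ _).trans ?_
        exact (Category.assoc _ _ _).trans (pullback.lift_fst _ _ _).symm
      · rw [pullScalar_smul_snd, pullback.lift_snd, Category.assoc, h]
  obtain ⟨a, ha, hu⟩ := hs k (pullback.lift _ l hl') (pullback.lift_fst _ _ _)
  exact ⟨a, (key a).1 ha, fun c hc ↦ hu c ((key c).2 hc)⟩

/-- The pull-back of a morphism of schemes over `X`. -/
def pullHom (f : Y ⟶ X) {L M : ScalarScheme X} (e : L.total ⟶ M.total)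
    (h : e ≫ M.proj = L.proj) : (pullScalar f L).total ⟶ (pullScalar f M).total :=
  pullback.lift (pullback.fst _ _) (pullback.snd _ _ ≫ e)
    (by rw [Category.assoc, h, pullback.condition])

lemma pullHom_fst (f : Y ⟶ X) {L M : ScalarScheme X} (e : L.total ⟶ M.total)
    (h : e ≫ M.proj = L.proj) :
    pullHom f e h ≫ pullback.fst f M.proj = pullback.fst f L.proj := pullback.lift_fst _ _ _

lemma pullHom_snd (f : Y ⟶ X) {L M : ScalarScheme X} (e : L.total ⟶ M.total)
    (h : e ≫ M.proj = L.proj) :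
    pullHom f e h ≫ pullback.snd f M.proj = pullback.snd f L.proj ≫ e := pullback.lift_snd _ _ _

lemma pullHom_comp (f : Y ⟶ X) {L M : ScalarScheme X} (e : L.total ⟶ M.total)
    (e' : M.total ⟶ L.total) (h : e ≫ M.proj = L.proj) (h' : e' ≫ L.proj = M.proj)
    (hh : e ≫ e' = 𝟙 _) : pullHom f e h ≫ pullHom f e' h' = 𝟙 _ := by
  apply pullback.hom_ext
  · rw [Category.assoc, pullHom_fst, pullHom_fst, Category.id_comp]
  · rw [Category.assoc, pullHom_snd, ← Category.assoc, pullHom_snd, Category.assoc, hh,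
      Category.comp_id, Category.id_comp]

/-- The pull-back of an isomorphism. -/
def Isom.pull (f : Y ⟶ X) {L M : LineBundle X} (e : Isom L M) :
    Isom (L.pull f) (M.pull f) where
  iso :=
    { hom := pullHom f e.iso.hom e.hom_proj
      inv := pullHom f e.iso.inv e.symm.hom_proj
      hom_inv_id := pullHom_comp f _ _ _ _ e.iso.hom_inv_id
      inv_hom_id := pullHom_comp f _ _ _ _ e.iso.inv_hom_id }
  hom_proj := pullHom_fst f e.iso.hom e.hom_proj
  smul_hom a l := by
    apply pullback.hom_ext
    · refine (Category.assoc _ _ _).trans ?_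
      refine (congr_arg _ (pullHom_fst f e.iso.hom e.hom_proj)).trans ?_
      refine ((L.pull f).smul_proj _ _).trans ?_
      refine Eq.trans ?_ ((M.pull f).smul_proj _ _).symm
      refine Eq.trans ?_ (Category.assoc _ _ _).symm
      exact (congr_arg _ (pullHom_fst f e.iso.hom e.hom_proj)).symm
    · refine (Category.assoc _ _ _).trans ?_
      refine (congr_arg _ (pullHom_snd f e.iso.hom e.hom_proj)).trans ?_
      refine (Category.assoc _ _ _).symm.trans ?_
      refine (congr_arg (· ≫ e.iso.hom) (pullScalar_smul_snd _ _ _ _)).trans ?_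
      refine (e.smul_hom _ _).trans ?_
      refine Eq.trans ?_ (pullScalar_smul_snd _ _ _ _).symm
      refine congr_arg (M.smul a) ?_
      refine Eq.trans ?_ (Category.assoc _ _ _).symm
      refine Eq.trans (Category.assoc _ _ _) ?_
      exact (congr_arg (l ≫ ·) (pullHom_snd f e.iso.hom e.hom_proj)).symm

/-- The pull-back of a tensor product. -/
def TensorPairing.pull (f : Y ⟶ X) {L M N : LineBundle X} (b : TensorPairing L M N) :
    TensorPairing (L.pull f) (M.pull f) (N.pull f) := by
  have hx {T : Scheme.{u}} (l : T ⟶ (L.pull f).total) (m : T ⟶ (M.pull f).total)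
      (h : l ≫ (L.pull f).proj = m ≫ (M.pull f).proj) :
      (l ≫ pullback.snd f L.proj) ≫ L.proj = (m ≫ pullback.snd f M.proj) ≫ M.proj := by
    have h' : l ≫ pullback.fst _ _ = m ≫ pullback.fst _ _ := h
    rw [Category.assoc, Category.assoc, ← pullback.condition, ← pullback.condition,
      ← Category.assoc, h', Category.assoc]
  exact
  { pair l m h := pullback.lift (l ≫ pullback.fst f L.proj)
      (b.pair (l ≫ pullback.snd f L.proj) (m ≫ pullback.snd f M.proj) (hx l m h))
      (by rw [b.pair_proj, Category.assoc, Category.assoc, pullback.condition])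
    pair_proj l m h := pullback.lift_fst _ _ _
    comp_pair k l m h := by
      apply pullback.hom_ext
      · rw [Category.assoc, pullback.lift_fst, pullback.lift_fst, Category.assoc]
      · rw [Category.assoc, pullback.lift_snd, pullback.lift_snd, b.comp_pair]
        exact b.pair_congr (Category.assoc _ _ _).symm (Category.assoc _ _ _).symm _
    smul_pair a l m h := by
      apply pullback.hom_ext
      · rw [pullback.lift_fst, pullback.lift_fst, pullback.lift_fst, pullback.lift_fst]
      · refine (pullback.lift_snd _ _ _).trans ?_
        refine (b.pair_congr (pullScalar_smul_snd _ _ _ _) rfl _).trans ?_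
        refine (b.smul_pair _ _ _ (hx l m h)).trans ?_
        refine Eq.trans ?_ (pullScalar_smul_snd _ _ _ _).symm
        exact congr_arg _ (pullback.lift_snd _ _ _).symm
    pair_smul a l m h := by
      apply pullback.hom_ext
      · rw [pullback.lift_fst, pullback.lift_fst, pullback.lift_fst]
      · refine (pullback.lift_snd _ _ _).trans ?_
        refine (b.pair_congr rfl (pullScalar_smul_snd _ _ _ _) _).trans ?_
        refine (b.pair_smul _ _ _ (hx l m h)).trans ?_
        refine Eq.trans ?_ (pullScalar_smul_snd _ _ _ _).symm
        exact congr_arg _ (pullback.lift_snd _ _ _).symm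
    isFrame_pair l m h hl hm := by
      refine isFrame_pullScalar _ _ _ ?_
      rw [pullback.lift_snd]
      exact fun {S} ↦ b.isFrame_pair _ _ _ (isFrame_of_pullScalar f L.toScalarScheme l hl)
        (isFrame_of_pullScalar f M.toScalarScheme m hm) }

end LineBundle

/-- The pull-back homomorphism of Picard groups. -/
def Pic.map {X Y : Scheme.{u}} (f : Y ⟶ X) : Pic X →* Pic Y :=
  MonoidHom.mk' (Quotient.map (LineBundle.pull f) fun _ _ ⟨e⟩ ↦ ⟨e.pull f⟩) fun a b ↦ by
    obtain ⟨L, rfl⟩ := mk_surjective a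
    obtain ⟨M, rfl⟩ := mk_surjective b
    rw [mk_mul (LineBundle.tensorPairing L M)]
    exact (mk_mul ((LineBundle.tensorPairing L M).pull f)).symm

/-- An action of a monoid object given on points. -/
abbrev actionOfPoints {C : Type*} [Category* C] [CartesianMonoidalCategory C] {G Y : C} [MonObj G]
    (act : ∀ {T : C}, (T ⟶ G) → (T ⟶ Y) → (T ⟶ Y))
    (comp_act : ∀ {S T : C} (f : S ⟶ T) (g : T ⟶ G) (y : T ⟶ Y),
      f ≫ act g y = act (f ≫ g) (f ≫ y))
    (one_act : ∀ {T : C} (y : T ⟶ Y), act 1 y = y)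
    (mul_act : ∀ {T : C} (g h : T ⟶ G) (y : T ⟶ Y), act (g * h) y = act g (act h y)) :
    ModObj G Y where
  smul := act (fst G Y) (snd G Y)
  one_smul := by
    have := one_act (snd (𝟙_ C) Y)
    rw [Hom.one_def] at this
    refine (comp_act _ _ _).trans ?_
    refine Eq.trans ?_ (this.trans (leftUnitor_hom Y).symm)
    congr 1
    · refine (whiskerRight_fst _ _).trans ?_
      congr 1
      exact toUnit_unique _ _
    · exact whiskerRight_snd _ _
  mul_smul := by
    have := mul_act (fst (G ⊗ G) Y ≫ fst G G) (fst (G ⊗ G) Y ≫ snd G G) (snd (G ⊗ G) Y)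
    rw [Hom.mul_def] at this
    refine (comp_act _ _ _).trans ?_
    refine Eq.trans ?_ (this.trans ?_)
    · congr 1
      · refine (whiskerRight_fst _ _).trans ?_
        rw [← comp_lift, lift_fst_snd, Category.comp_id]
      · exact whiskerRight_snd _ _
    · refine Eq.trans ?_ (congr_arg _ (comp_act _ _ _).symm)
      refine Eq.trans ?_ (comp_act _ _ _).symm
      congr 1
      · simp
      · refine Eq.trans ?_ (congr_arg _ (whiskerLeft_snd _ _).symm)
        refine Eq.trans ?_ (congr_arg _ (comp_act _ _ _).symm)
        refine Eq.trans ?_ (comp_act _ _ _).symm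
        congr 1 <;> simp

lemma actionOfPoints_smul {C : Type*} [Category* C] [CartesianMonoidalCategory C] {G Y : C}
    [MonObj G] (act : ∀ {T : C}, (T ⟶ G) → (T ⟶ Y) → (T ⟶ Y)) (h₁ h₂ h₃) {T : C} (g : T ⟶ G)
    (y : T ⟶ Y) :
    letI := actionOfPoints (G := G) (Y := Y) act h₁ h₂ h₃
    g • y = act g y := by
  refine (h₁ _ _ _).trans ?_
  congr 1 <;> simp


namespace LineBundle

variable {B : Scheme.{u}} {X : Over B} {L M N : LineBundle X.left}

/-- The total space of a line bundle on a `B`-scheme, as a `B`-scheme. -/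
abbrev toOver (L : LineBundle X.left) : Over B := Over.mk (L.proj ≫ X.hom)

/-- The projection of a line bundle, as a morphism of `B`-schemes. -/
def π (L : LineBundle X.left) : L.toOver ⟶ X := Over.homMk L.proj rfl

/-- Scalar multiplication on `T`-points of a line bundle over a `B`-scheme. -/
def smulOver (L : LineBundle X.left) {T : Over B} (a : Γ(T.left, ⊤)) (l : T ⟶ L.toOver) :
    T ⟶ L.toOver :=
  Over.homMk (L.smul a l.left) (by
    refine (Category.assoc _ _ _).symm.trans ?_
    rw [L.smul_proj, Category.assoc]
    exact Over.w l)

@[simp]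
lemma π_left (L : LineBundle X.left) : L.π.left = L.proj := rfl

@[simp]
lemma smulOver_left {T : Over B} (a : Γ(T.left, ⊤)) (l : T ⟶ L.toOver) :
    (L.smulOver a l).left = L.smul a l.left := rfl

lemma smulOver_π {T : Over B} (a : Γ(T.left, ⊤)) (l : T ⟶ L.toOver) :
    L.smulOver a l ≫ L.π = l ≫ L.π := by
  ext1
  exact L.smul_proj _ _

lemma comp_smulOver {S T : Over B} (f : S ⟶ T) (a : Γ(T.left, ⊤)) (l : T ⟶ L.toOver) :
    f ≫ L.smulOver a l = L.smulOver (pullFun f.left a) (f ≫ l) := by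
  ext1
  exact L.comp_smul _ _ _

lemma proj_of_π {T : Over B} {l : T ⟶ L.toOver} {m : T ⟶ M.toOver} (h : l ≫ L.π = m ≫ M.π) :
    l.left ≫ L.proj = m.left ≫ M.proj := congr_arg CommaMorphism.left h

/-- An isomorphism of line bundles over a `B`-scheme, as a morphism of `B`-schemes. -/
def Isom.homOver (e : Isom L M) : L.toOver ⟶ M.toOver :=
  Over.homMk e.iso.hom (e.hom_proj_assoc X.hom)

lemma Isom.homOver_π (e : Isom L M) : e.homOver ≫ M.π = L.π := by
  ext1
  exact e.hom_proj

lemma Isom.smulOver_homOver (e : Isom L M) {T : Over B} (a : Γ(T.left, ⊤)) (l : T ⟶ L.toOver) :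
    L.smulOver a l ≫ e.homOver = M.smulOver a (l ≫ e.homOver) := by
  ext1
  exact e.smul_hom _ _

/-- A pairing of line bundles over a `B`-scheme, on points with values in `B`-schemes. -/
def TensorPairing.pairOver (b : TensorPairing L M N) {T : Over B} (l : T ⟶ L.toOver)
    (m : T ⟶ M.toOver) (h : l ≫ L.π = m ≫ M.π) : T ⟶ N.toOver :=
  Over.homMk (b.pair l.left m.left (proj_of_π h)) (by
    refine (Category.assoc _ _ _).symm.trans ?_
    rw [b.pair_proj, Category.assoc]
    exact Over.w l)

namespace TensorPairing

variable (b : TensorPairing L M N) {T : Over B} (l : T ⟶ L.toOver) (m : T ⟶ M.toOver)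
  (h : l ≫ L.π = m ≫ M.π)

lemma pairOver_left : (b.pairOver l m h).left = b.pair l.left m.left (proj_of_π h) := rfl

lemma pairOver_π : b.pairOver l m h ≫ N.π = l ≫ L.π := by
  ext1
  exact b.pair_proj _ _ _

lemma comp_pairOver {S : Over B} (f : S ⟶ T) : f ≫ b.pairOver l m h =
    b.pairOver (f ≫ l) (f ≫ m) (by rw [Category.assoc, h, Category.assoc]) := by
  ext1
  exact b.comp_pair _ _ _ _

lemma smul_pairOver (a : Γ(T.left, ⊤)) :
    b.pairOver (L.smulOver a l) m (by rw [smulOver_π, h]) = N.smulOver a (b.pairOver l m h) := by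
  ext1
  exact b.smul_pair _ _ _ _

lemma pairOver_smul (a : Γ(T.left, ⊤)) :
    b.pairOver l (M.smulOver a m) (by rw [smulOver_π, h]) = N.smulOver a (b.pairOver l m h) := by
  ext1
  exact b.pair_smul _ _ _ _

variable {l m} in
lemma pairOver_congr {l' : T ⟶ L.toOver} {m' : T ⟶ M.toOver} (hl : l = l') (hm : m = m') :
    b.pairOver l m h = b.pairOver l' m' (by rw [← hl, ← hm, h]) := by
  subst hl hm; rfl

end TensorPairing

lemma hom_ext_over {T : Over B} {p q : T ⟶ (hom L M).toOver}
    (h : p ≫ (hom L M).π = q ≫ (hom L M).π)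
    (hv : ∀ {S : Over B} (f : S ⟶ T) (l : S ⟶ L.toOver)
      (hl : (f ≫ p) ≫ (hom L M).π = l ≫ L.π),
      (evPairing L M).pairOver (f ≫ p) l hl = (evPairing L M).pairOver (f ≫ q) l
        (by rw [← hl, Category.assoc, Category.assoc, h])) : p = q := by
  ext1
  refine LineBundle.hom_ext (proj_of_π h) fun {S} f l hl ↦ ?_
  let f' : Over.mk (f ≫ T.hom) ⟶ T := Over.homMk f rfl
  let l' : Over.mk (f ≫ T.hom) ⟶ L.toOver := Over.homMk l (by
    change l ≫ L.proj ≫ X.hom = f ≫ T.hom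
    rw [← Category.assoc, ← hl, ← Over.w p, Category.assoc, Category.assoc]
    rfl)
  have := hv f' l' (by ext1; exact hl)
  exact congr_arg CommaMorphism.left this

lemma exists_hom_over {T : Over B} (x : T ⟶ X) (v : ∀ {S : Over B} (f : S ⟶ T)
      (l : S ⟶ L.toOver), f ≫ x = l ≫ L.π → (S ⟶ M.toOver))
    (v_π : ∀ {S : Over B} (f : S ⟶ T) (l : S ⟶ L.toOver) (h : f ≫ x = l ≫ L.π),
      v f l h ≫ M.π = f ≫ x)
    (comp_v : ∀ {R S : Over B} (k : R ⟶ S) (f : S ⟶ T) (l : S ⟶ L.toOver)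
      (h : f ≫ x = l ≫ L.π), k ≫ v f l h = v (k ≫ f) (k ≫ l) (by simp [h]))
    (v_smul : ∀ {S : Over B} (f : S ⟶ T) (l : S ⟶ L.toOver) (h : f ≫ x = l ≫ L.π)
      (a : Γ(S.left, ⊤)), v f (L.smulOver a l) (by rw [smulOver_π, h]) = M.smulOver a (v f l h)) :
    ∃ (p : T ⟶ (hom L M).toOver) (_ : p ≫ (hom L M).π = x), ∀ {S : Over B} (f : S ⟶ T)
      (l : S ⟶ L.toOver) (h : (f ≫ p) ≫ (hom L M).π = l ≫ L.π) (h' : f ≫ x = l ≫ L.π),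
      (evPairing L M).pairOver (f ≫ p) l h = v f l h' := by
  let F {S : Scheme.{u}} (f : S ⟶ T.left) : Over.mk (f ≫ T.hom) ⟶ T := Over.homMk f rfl
  have hw {S : Scheme.{u}} (f : S ⟶ T.left) (l : S ⟶ L.total) (h : f ≫ x.left = l ≫ L.proj) :
      l ≫ L.proj ≫ X.hom = f ≫ T.hom := by
    rw [← Category.assoc, ← h, Category.assoc, Over.w]
  let E {S : Scheme.{u}} (f : S ⟶ T.left) (l : S ⟶ L.total) (h : f ≫ x.left = l ≫ L.proj) :
      Over.mk (f ≫ T.hom) ⟶ L.toOver := Over.homMk l (hw f l h)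
  have hFE {S : Scheme.{u}} (f : S ⟶ T.left) (l : S ⟶ L.total) (h : f ≫ x.left = l ≫ L.proj) :
      F f ≫ x = E f l h ≫ L.π := by ext1; exact h
  obtain ⟨p, hp, hv⟩ := exists_hom_pt (L := L) (M := M) x.left
    (fun f l h ↦ (v (F f) (E f l h) (hFE f l h)).left)
    (fun f l h ↦ congr_arg CommaMorphism.left (v_π _ _ (hFE f l h)))
    (fun {R S} k f l h ↦ by
      let k' : Over.mk ((k ≫ f) ≫ T.hom) ⟶ Over.mk (f ≫ T.hom) := Over.homMk k (by simp)
      exact congr_arg CommaMorphism.left (comp_v k' _ _ (hFE f l h)))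
    (fun f l h a ↦ congr_arg CommaMorphism.left (v_smul _ _ (hFE f l h) a))
  refine ⟨Over.homMk p (by
    change p ≫ (hom L M).proj ≫ X.hom = T.hom
    rw [← Category.assoc, hp, Over.w]), by ext1; exact hp, fun {S} f l h h' ↦ ?_⟩
  ext1
  refine (hv f.left l.left (proj_of_π h) (congr_arg CommaMorphism.left h')).trans ?_
  let k : S ⟶ Over.mk (f.left ≫ T.hom) := Over.homMk (𝟙 _) (by simp)
  have := congr_arg CommaMorphism.left
    (comp_v k (F f.left) _ (hFE f.left l.left (congr_arg CommaMorphism.left h')))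
  refine (Category.id_comp _).symm.trans (this.trans ?_)
  congr 2

end LineBundle

/-- A `G`-linearized line bundle on a `G`-scheme `X`: a line bundle together with an action of `G`
on its total space which lifts the action on `X` and commutes with scalar multiplication. -/
structure LinearizedBundle {B : Scheme.{u}} (G X : Over B) [GrpObj G] [ModObj G X] where
  bundle : LineBundle X.left
  action : ModObj G bundle.toOver
  smul_π : ∀ {T : Over B} (g : T ⟶ G) (l : T ⟶ bundle.toOver),
    (g • l) ≫ bundle.π = g • (l ≫ bundle.π)
  smul_smulOver : ∀ {T : Over B} (g : T ⟶ G) (a : Γ(T.left, ⊤)) (l : T ⟶ bundle.toOver),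
    g • bundle.smulOver a l = bundle.smulOver a (g • l)

attribute [instance] LinearizedBundle.action

namespace LinearizedBundle

open LineBundle

variable {B : Scheme.{u}} {G X : Over B} [GrpObj G] [ModObj G X]

/-- An isomorphism of `G`-linearized line bundles: an isomorphism of line bundles which commutes
with the actions of `G`. -/
structure Isom (L M : LinearizedBundle G X) extends LineBundle.Isom L.bundle M.bundle where
  smul_homOver : ∀ {T : Over B} (g : T ⟶ G) (l : T ⟶ L.bundle.toOver),
    (g • l) ≫ toIsom.homOver = g • (l ≫ toIsom.homOver)

/-- A pairing of linearized line bundles is equivariant if `g • (l ⊗ m) = (g • l) ⊗ (g • m)`. -/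
def Equivariant {L M N : LinearizedBundle G X} (b : TensorPairing L.bundle M.bundle N.bundle) :
    Prop :=
  ∀ ⦃T : Over B⦄ (g : T ⟶ G) (l : T ⟶ L.bundle.toOver) (m : T ⟶ M.bundle.toOver)
    (h : l ≫ L.bundle.π = m ≫ M.bundle.π), g • b.pairOver l m h =
      b.pairOver (g • l) (g • m) (by rw [L.smul_π, M.smul_π, h])

section hom

variable (L M : LinearizedBundle G X)

lemma exists_homAct {T : Over B} (g : T ⟶ G) (e : T ⟶ (LineBundle.hom L.bundle M.bundle).toOver) :
    ∃ (p : T ⟶ (LineBundle.hom L.bundle M.bundle).toOver)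
      (_ : p ≫ (LineBundle.hom L.bundle M.bundle).π = g • (e ≫ (LineBundle.hom L.bundle M.bundle).π)),
      ∀ {S : Over B} (f : S ⟶ T) (g' : S ⟶ G) (_ : g' = f ≫ g) (l : S ⟶ L.bundle.toOver)
        (h : (f ≫ e) ≫ (LineBundle.hom L.bundle M.bundle).π = l ≫ L.bundle.π)
        (h' : (f ≫ p) ≫ (LineBundle.hom L.bundle M.bundle).π = (g' • l) ≫ L.bundle.π),
        (evPairing L.bundle M.bundle).pairOver (f ≫ p) (g' • l) h' = g' • (evPairing L.bundle M.bundle).pairOver (f ≫ e) l h := by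
  have hx {S : Over B} (f : S ⟶ T) (l : S ⟶ L.bundle.toOver)
      (h : f ≫ (g • (e ≫ (LineBundle.hom L.bundle M.bundle).π)) = l ≫ L.bundle.π) :
      (f ≫ e) ≫ (LineBundle.hom L.bundle M.bundle).π = ((f ≫ g)⁻¹ • l) ≫ L.bundle.π := by
    rw [L.smul_π, ← h, ModObj.comp_smul, inv_smul_smul, Category.assoc]
  obtain ⟨p, hp, hv⟩ := exists_hom_over (L := L.bundle) (M := M.bundle)
    (g • (e ≫ (LineBundle.hom L.bundle M.bundle).π))
    (fun f l h ↦ (f ≫ g) • (evPairing L.bundle M.bundle).pairOver (f ≫ e) ((f ≫ g)⁻¹ • l) (hx f l h))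
    (fun f l h ↦ by
      rw [M.smul_π, TensorPairing.pairOver_π, hx f l h, L.smul_π, smul_inv_smul, h])
    (fun k f l h ↦ by
      rw [ModObj.comp_smul, TensorPairing.comp_pairOver]
      congr 1
      refine TensorPairing.pairOver_congr _ _ (Category.assoc _ _ _).symm ?_
      rw [ModObj.comp_smul, GrpObj.comp_inv, Category.assoc])
    (fun f l h a ↦ by
      rw [← M.smul_smulOver]
      congr 1
      refine (TensorPairing.pairOver_congr _ _ rfl (L.smul_smulOver _ _ _)).trans ?_
      exact TensorPairing.pairOver_smul _ _ _ (hx f l h) _)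
  refine ⟨p, hp, ?_⟩
  rintro S f _ rfl l h h'
  refine (hv f _ h' (by rw [← h', Category.assoc, hp])).trans ?_
  congr 1
  exact TensorPairing.pairOver_congr _ _ rfl (inv_smul_smul _ _)

/-- The action characterized by `(g • e)(g • l) = g • e(l)`. -/
def homAct {T : Over B} (g : T ⟶ G) (e : T ⟶ (LineBundle.hom L.bundle M.bundle).toOver) :
    T ⟶ (LineBundle.hom L.bundle M.bundle).toOver := (exists_homAct L M g e).choose

lemma homAct_π {T : Over B} (g : T ⟶ G) (e : T ⟶ (LineBundle.hom L.bundle M.bundle).toOver) :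
    homAct L M g e ≫ (LineBundle.hom L.bundle M.bundle).π = g • (e ≫ (LineBundle.hom L.bundle M.bundle).π) :=
  (exists_homAct L M g e).choose_spec.choose

lemma homAct_ev {T : Over B} (g : T ⟶ G) (e : T ⟶ (LineBundle.hom L.bundle M.bundle).toOver)
    {S : Over B} (f : S ⟶ T) (g' : S ⟶ G) (hg : g' = f ≫ g) (l : S ⟶ L.bundle.toOver)
    (h : (f ≫ e) ≫ (LineBundle.hom L.bundle M.bundle).π = l ≫ L.bundle.π)
    (h' : (f ≫ homAct L M g e) ≫ (LineBundle.hom L.bundle M.bundle).π = (g' • l) ≫ L.bundle.π) :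
    (evPairing L.bundle M.bundle).pairOver (f ≫ homAct L M g e) (g' • l) h' = g' • (evPairing L.bundle M.bundle).pairOver (f ≫ e) l h :=
  (exists_homAct L M g e).choose_spec.choose_spec f g' hg l h h'

lemma eq_homAct {T : Over B} (g : T ⟶ G) (e p : T ⟶ (LineBundle.hom L.bundle M.bundle).toOver)
    (hp : p ≫ (LineBundle.hom L.bundle M.bundle).π = g • (e ≫ (LineBundle.hom L.bundle M.bundle).π))
    (hv : ∀ {S : Over B} (f : S ⟶ T) (g' : S ⟶ G) (_ : g' = f ≫ g) (l : S ⟶ L.bundle.toOver)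
      (h : (f ≫ e) ≫ (LineBundle.hom L.bundle M.bundle).π = l ≫ L.bundle.π)
      (h' : (f ≫ p) ≫ (LineBundle.hom L.bundle M.bundle).π = (g' • l) ≫ L.bundle.π),
      (evPairing L.bundle M.bundle).pairOver (f ≫ p) (g' • l) h' = g' • (evPairing L.bundle M.bundle).pairOver (f ≫ e) l h) :
    p = homAct L M g e := by
  refine hom_ext_over (hp.trans (homAct_π L M g e).symm) fun f l' h ↦ ?_
  obtain ⟨l, rfl⟩ : ∃ l, l' = (f ≫ g) • l := ⟨(f ≫ g)⁻¹ • l', (smul_inv_smul _ _).symm⟩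
  have h' : (f ≫ e) ≫ (LineBundle.hom L.bundle M.bundle).π = l ≫ L.bundle.π := by
    rw [Category.assoc, hp, ModObj.comp_smul, L.smul_π, smul_left_cancel_iff] at h
    rw [Category.assoc, h]
  rw [hv f _ rfl l h' h, homAct_ev L M g e f _ rfl l h']

lemma comp_homAct {S T : Over B} (k : S ⟶ T) (g : T ⟶ G)
    (e : T ⟶ (LineBundle.hom L.bundle M.bundle).toOver) :
    k ≫ homAct L M g e = homAct L M (k ≫ g) (k ≫ e) := by
  refine eq_homAct L M _ _ _ ?_ ?_
  · rw [Category.assoc, homAct_π, ModObj.comp_smul, Category.assoc]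
  · rintro R f g' rfl l h h'
    have := homAct_ev L M g e (f ≫ k) _ (Category.assoc _ _ _).symm l
      (by rw [Category.assoc f k]; exact h) (by rw [Category.assoc f k]; exact h')
    simpa only [Category.assoc] using this

lemma one_homAct {T : Over B} (e : T ⟶ (LineBundle.hom L.bundle M.bundle).toOver) :
    homAct L M 1 e = e := by
  refine (eq_homAct L M _ _ _ (by rw [one_smul]) ?_).symm
  intro R f g' hg l h h'
  obtain rfl : g' = 1 := hg.trans (MonObj.comp_one f)
  refine (TensorPairing.pairOver_congr _ _ rfl (one_smul _ _)).trans ?_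
  exact (one_smul _ _).symm

lemma mul_homAct {T : Over B} (g₁ g₂ : T ⟶ G) (e : T ⟶ (LineBundle.hom L.bundle M.bundle).toOver) :
    homAct L M (g₁ * g₂) e = homAct L M g₁ (homAct L M g₂ e) := by
  refine (eq_homAct L M _ _ _ ?_ ?_).symm
  · rw [homAct_π, homAct_π, mul_smul]
  · intro R f g' hg l h h'
    obtain rfl : g' = (f ≫ g₁) * (f ≫ g₂) := hg.trans (MonObj.comp_mul f g₁ g₂)
    have h₂ : (f ≫ homAct L M g₂ e) ≫ (LineBundle.hom L.bundle M.bundle).π = ((f ≫ g₂) • l) ≫ L.bundle.π := by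
      rw [Category.assoc, homAct_π, ModObj.comp_smul, ← Category.assoc, h, L.smul_π]
    rw [TensorPairing.pairOver_congr _ _ rfl (mul_smul _ _ _),
      homAct_ev L M g₁ _ f _ rfl _ h₂, homAct_ev L M g₂ e f _ rfl l h, mul_smul]

lemma homAct_smulOver {T : Over B} (g : T ⟶ G) (a : Γ(T.left, ⊤)) (e : T ⟶ (LineBundle.hom L.bundle M.bundle).toOver) :
    homAct L M g ((LineBundle.hom L.bundle M.bundle).smulOver a e) = (LineBundle.hom L.bundle M.bundle).smulOver a (homAct L M g e) := by
  refine (eq_homAct L M _ _ _ ?_ ?_).symm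
  · rw [smulOver_π, smulOver_π, homAct_π]
  · rintro R f g' rfl l h h'
    have h₁ : (f ≫ e) ≫ (LineBundle.hom L.bundle M.bundle).π = l ≫ L.bundle.π := by
      rw [← h, Category.assoc, Category.assoc, smulOver_π]
    have h₂ : (f ≫ homAct L M g e) ≫ (LineBundle.hom L.bundle M.bundle).π = ((f ≫ g) • l) ≫ L.bundle.π := by
      rw [← h', Category.assoc, Category.assoc, smulOver_π]
    rw [TensorPairing.pairOver_congr _ _ (comp_smulOver _ _ _) rfl,
      TensorPairing.smul_pairOver _ _ _ h₂, homAct_ev L M g e f _ rfl l h₁,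
      TensorPairing.pairOver_congr _ _ (comp_smulOver _ _ _) rfl,
      TensorPairing.smul_pairOver _ _ _ h₁, M.smul_smulOver]

/-- The linearized line bundle of linear morphisms, with `(g • e)(g • l) = g • e(l)`. -/
def hom : LinearizedBundle G X where
  bundle := (LineBundle.hom L.bundle M.bundle)
  action := actionOfPoints (homAct L M) (comp_homAct L M) (one_homAct L M) (mul_homAct L M)
  smul_π g l := by
    rw [actionOfPoints_smul]
    exact homAct_π L M g l
  smul_smulOver g a e := by
    rw [actionOfPoints_smul, actionOfPoints_smul]
    exact homAct_smulOver L M g a e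

lemma equivariant_ev : Equivariant (L := hom L M) (M := L) (N := M)
    (evPairing L.bundle M.bundle) := by
  intro T g e l h
  have hs : g • e = homAct L M g e :=
    actionOfPoints_smul _ (comp_homAct L M) (one_homAct L M) (mul_homAct L M) _ _
  have h' : (𝟙 T ≫ e) ≫ (LineBundle.hom L.bundle M.bundle).π = l ≫ L.bundle.π := by rw [Category.id_comp]; exact h
  have h'' : (𝟙 T ≫ homAct L M g e) ≫ (LineBundle.hom L.bundle M.bundle).π = (g • l) ≫ L.bundle.π := by
    rw [Category.id_comp, L.smul_π, ← h]
    exact homAct_π L M g e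
  refine Eq.trans ?_ ((homAct_ev L M g e (𝟙 T) g (Category.id_comp _).symm l h' h'').symm.trans ?_)
  · congr 1
  · refine TensorPairing.pairOver_congr _ _ ?_ rfl
    rw [Category.id_comp, hs]

end hom

end LinearizedBundle

section trivial

open LineBundle

variable {B : Scheme.{u}} {G X : Over B}

/-- The value of an invertible function on `G × X` at a point `(g, x)`. -/
def valueAt (c : Γ((G ⊗ X).left, ⊤)ˣ) {T : Over B} (g : T ⟶ G) (x : T ⟶ X) : Γ(T.left, ⊤)ˣ :=
  Units.map (pullFun (lift g x).left).toMonoidHom c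

lemma pullFun_valueAt (c : Γ((G ⊗ X).left, ⊤)ˣ) {S T : Over B} (f : S ⟶ T) (g : T ⟶ G)
    (x : T ⟶ X) : Units.map (pullFun f.left).toMonoidHom (valueAt c g x) =
      valueAt c (f ≫ g) (f ≫ x) := by
  ext
  refine (pullFun_comp _ _ _).symm.trans ?_
  change _ = pullFun (lift (f ≫ g) (f ≫ x)).left _
  rw [← comp_lift]
  rfl

@[simp]
lemma valueAt_one {T : Over B} (g : T ⟶ G) (x : T ⟶ X) :
    valueAt (1 : Γ((G ⊗ X).left, ⊤)ˣ) g x = 1 := map_one _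

lemma valueAt_mul (c d : Γ((G ⊗ X).left, ⊤)ˣ) {T : Over B} (g : T ⟶ G) (x : T ⟶ X) :
    valueAt (c * d) g x = valueAt c g x * valueAt d g x := map_mul _ _ _

variable [GrpObj G] [ModObj G X]

/-- An invertible function `c` on `G × X` is a cocycle if `c(gh, x) = c(g, hx) c(h, x)`. -/
def IsCocycle (c : Γ((G ⊗ X).left, ⊤)ˣ) : Prop :=
  ∀ ⦃T : Over B⦄ (g h : T ⟶ G) (x : T ⟶ X),
    valueAt c (g * h) x = valueAt c g (h • x) * valueAt c h x

lemma isCocycle_one : IsCocycle (1 : Γ((G ⊗ X).left, ⊤)ˣ) := fun _ _ _ _ ↦ by simp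

lemma IsCocycle.valueAt_one {c : Γ((G ⊗ X).left, ⊤)ˣ} (hc : IsCocycle c) {T : Over B}
    (x : T ⟶ X) : valueAt c 1 x = 1 := by
  have := hc 1 1 x
  rwa [one_smul, mul_one, left_eq_mul] at this

/-- The point `(x, a)` of `X × 𝔸¹`, over `B`. -/
def lineOver {T : Over B} (x : T ⟶ X) (a : Γ(T.left, ⊤)) : T ⟶ (trivial X.left).toOver :=
  Over.homMk (linePt x.left a) (by
    refine (Category.assoc _ _ _).symm.trans ?_
    rw [linePt_over]
    exact Over.w x)

lemma lineOver_π {T : Over B} (x : T ⟶ X) (a : Γ(T.left, ⊤)) :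
    lineOver x a ≫ (trivial X.left).π = x := by
  ext1
  exact linePt_over _ _

lemma lineOver_ext {T : Over B} {l l' : T ⟶ (trivial X.left).toOver}
    (h : l ≫ (trivial X.left).π = l' ≫ (trivial X.left).π)
    (h' : lineCoord l.left = lineCoord l'.left) : l = l' := by
  ext1
  exact line_ext (congr_arg CommaMorphism.left h) h'

lemma lineCoord_lineOver {T : Over B} (x : T ⟶ X) (a : Γ(T.left, ⊤)) :
    lineCoord (lineOver x a).left = a := lineCoord_linePt _ _

/-- The action `g • (x, t) = (g • x, c(g, x) t)` on points of `X × 𝔸¹`. -/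
def lineAct (c : Γ((G ⊗ X).left, ⊤)ˣ) {T : Over B} (g : T ⟶ G)
    (l : T ⟶ (trivial X.left).toOver) : T ⟶ (trivial X.left).toOver :=
  lineOver (g • (l ≫ (trivial X.left).π))
    (valueAt c g (l ≫ (trivial X.left).π) * lineCoord l.left)

lemma comp_lineAct (c : Γ((G ⊗ X).left, ⊤)ˣ) {S T : Over B} (f : S ⟶ T) (g : T ⟶ G)
    (l : T ⟶ (trivial X.left).toOver) : f ≫ lineAct c g l = lineAct c (f ≫ g) (f ≫ l) := by
  apply lineOver_ext
  · rw [Category.assoc, lineAct, lineOver_π, lineAct, lineOver_π, ModObj.comp_smul,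
      Category.assoc]
  · refine (lineCoord_comp _ _).trans ?_
    rw [lineAct, lineAct, lineCoord_lineOver, lineCoord_lineOver, map_mul, Category.assoc,
      ← pullFun_valueAt]
    congr 1

lemma one_lineAct {c : Γ((G ⊗ X).left, ⊤)ˣ} (hc : IsCocycle c) {T : Over B}
    (l : T ⟶ (trivial X.left).toOver) : lineAct c 1 l = l := by
  apply lineOver_ext
  · rw [lineAct, lineOver_π, one_smul]
  · rw [lineAct, lineCoord_lineOver, hc.valueAt_one, Units.val_one, one_mul]

lemma mul_lineAct {c : Γ((G ⊗ X).left, ⊤)ˣ} (hc : IsCocycle c) {T : Over B} (g h : T ⟶ G)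
    (l : T ⟶ (trivial X.left).toOver) : lineAct c (g * h) l = lineAct c g (lineAct c h l) := by
  apply lineOver_ext
  · simp only [lineAct, lineOver_π, mul_smul]
  · simp only [lineAct, lineCoord_lineOver, lineOver_π]
    rw [hc g h, Units.val_mul, mul_assoc]

/-- The trivial line bundle `X × 𝔸¹` linearized by `g • (x, t) = (g • x, c(g, x) t)`. -/
def LinearizedBundle.ofCocycle (c : Γ((G ⊗ X).left, ⊤)ˣ) (hc : IsCocycle c) :
    LinearizedBundle G X where
  bundle := trivial X.left
  action := actionOfPoints (lineAct c) (comp_lineAct c) (one_lineAct hc) (mul_lineAct hc)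
  smul_π g l := by
    rw [actionOfPoints_smul]
    exact lineOver_π _ _
  smul_smulOver g a l := by
    rw [actionOfPoints_smul, actionOfPoints_smul]
    apply lineOver_ext
    · rw [smulOver_π]
      simp only [lineAct, lineOver_π, smulOver_π]
    · refine (lineCoord_lineOver _ _).trans ?_
      refine Eq.trans ?_ (lineCoord_linePt _ _).symm
      rw [smulOver_π]
      refine (congr_arg _ (lineCoord_linePt _ _)).trans ?_
      refine Eq.trans ?_ (congr_arg _ (lineCoord_lineOver _ _)).symm
      rw [mul_left_comm]

@[simp]
lemma LinearizedBundle.ofCocycle_bundle (c : Γ((G ⊗ X).left, ⊤)ˣ) (hc : IsCocycle c) :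
    (ofCocycle c hc).bundle = trivial X.left := rfl

lemma LinearizedBundle.ofCocycle_smul (c : Γ((G ⊗ X).left, ⊤)ˣ) (hc : IsCocycle c)
    {T : Over B} (g : T ⟶ G) (l : T ⟶ (ofCocycle c hc).bundle.toOver) :
    g • l = lineAct c g l := 
  actionOfPoints_smul _ (comp_lineAct c) (one_lineAct hc) (mul_lineAct hc) g l

end trivial

namespace LinearizedBundle

open LineBundle

variable {B : Scheme.{u}} {G X : Over B} [GrpObj G] [ModObj G X]

variable (G X) in
/-- The trivial line bundle with the linearization `g • (x, t) = (g • x, t)`. -/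
abbrev unit : LinearizedBundle G X := ofCocycle 1 isCocycle_one

lemma lineCoord_lineAct_one {T : Over B} (g : T ⟶ G) (l : T ⟶ (trivial X.left).toOver) :
    lineCoord (lineAct 1 g l).left = lineCoord l.left := by
  rw [lineAct, lineCoord_lineOver, valueAt_one, Units.val_one, one_mul]

lemma equivariant_unit (M : LinearizedBundle G X) :
    Equivariant (L := unit G X) (M := M) (N := M) (unitPairing M.bundle) := by
  intro T g l m h
  refine (M.smul_smulOver g (lineCoord l.left) m).trans ?_
  have h₁ : g • l = lineAct 1 g l := ofCocycle_smul _ _ _ _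
  refine Eq.trans ?_ (TensorPairing.pairOver_congr (unitPairing M.bundle)
    (l := lineAct 1 g l) (l' := g • l) (by
      rw [M.smul_π, ← h, ← h₁]; exact (unit G X).smul_π g l) h₁.symm rfl)
  have h₂ := lineCoord_lineAct_one g l
  ext1
  exact congr_arg (fun a ↦ M.bundle.smul a (g • m).left) h₂.symm

/-- The dual of a linearized line bundle. -/
abbrev dual (L : LinearizedBundle G X) : LinearizedBundle G X := hom L (unit G X)

/-- The tensor product of linearized line bundles. -/
abbrev tensor (L M : LinearizedBundle G X) : LinearizedBundle G X := hom (dual L) M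

lemma tensor_ev_over {L M : LineBundle X.left} {T : Over B} (l : T ⟶ L.toOver) (m : T ⟶ M.toOver)
    (h : l ≫ L.π = m ≫ M.π) {S : Over B} (f : S ⟶ T) (ξ : S ⟶ (LineBundle.dual L).toOver)
    (h₁ : (f ≫ (tensorPairing L M).pairOver l m h) ≫ (LineBundle.tensor L M).π =
      ξ ≫ (LineBundle.dual L).π)
    (h₂ : ξ ≫ (LineBundle.dual L).π = (f ≫ l) ≫ L.π) :
    (evPairing (LineBundle.dual L) M).pairOver (f ≫ (tensorPairing L M).pairOver l m h) ξ h₁ =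
      M.smulOver (lineCoord ((evPairing L (trivial X.left)).pairOver ξ (f ≫ l) h₂).left)
        (f ≫ m) := by
  ext1
  exact tensorPt_ev l.left m.left (proj_of_π h) f.left ξ.left (proj_of_π h₁) (proj_of_π h₂)

lemma lineCoord_dual_smul (L : LinearizedBundle G X) {T : Over B} (g : T ⟶ G)
    (ξ : T ⟶ (dual L).bundle.toOver) (l : T ⟶ L.bundle.toOver)
    (h : ξ ≫ (dual L).bundle.π = l ≫ L.bundle.π)
    (h' : (g • ξ) ≫ (dual L).bundle.π = (g • l) ≫ L.bundle.π) :
    lineCoord ((evPairing L.bundle (trivial X.left)).pairOver (g • ξ) (g • l) h').left =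
      lineCoord ((evPairing L.bundle (trivial X.left)).pairOver ξ l h).left := by
  have h₁ := equivariant_ev L (unit G X) g ξ l h
  have h₂ := ofCocycle_smul (1 : Γ((G ⊗ X).left, ⊤)ˣ) isCocycle_one g
    ((evPairing L.bundle (unit G X).bundle).pairOver ξ l h)
  have h₃ := h₁.symm.trans h₂
  refine Eq.trans ?_ (lineCoord_lineAct_one g _)
  exact congr_arg (fun p : T ⟶ (trivial X.left).toOver ↦ lineCoord p.left) h₃

lemma equivariant_tensor (L M : LinearizedBundle G X) :
    Equivariant (L := L) (M := M) (N := tensor L M) (tensorPairing L.bundle M.bundle) := by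
  intro T g l m h
  have hgl : (g • l) ≫ L.bundle.π = (g • m) ≫ M.bundle.π := by rw [L.smul_π, M.smul_π, h]
  refine (actionOfPoints_smul _ (comp_homAct (dual L) M) (one_homAct (dual L) M)
    (mul_homAct (dual L) M) _ _).trans ?_
  refine (eq_homAct (dual L) M g _ _ ?_ ?_).symm
  · refine (TensorPairing.pairOver_π _ _ _ _).trans ((L.smul_π g l).trans ?_)
    exact congr_arg _ (TensorPairing.pairOver_π _ _ _ _).symm
  · rintro S f g' rfl ξ h₁ h₂
    have e₁ : ξ ≫ (dual L).bundle.π = (f ≫ l) ≫ L.bundle.π := by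
      refine h₁.symm.trans ?_
      refine (Category.assoc _ _ _).trans (Eq.trans ?_ (Category.assoc _ _ _).symm)
      exact congr_arg _ (TensorPairing.pairOver_π _ _ _ _)
    have e₂ : ((f ≫ g) • ξ) ≫ (dual L).bundle.π = ((f ≫ g) • (f ≫ l)) ≫ L.bundle.π := by
      rw [(dual L).smul_π, L.smul_π, e₁]
    have e₃ : ((f ≫ g) • ξ) ≫ (dual L).bundle.π = (f ≫ (g • l)) ≫ L.bundle.π := by
      rw [e₂, ModObj.comp_smul]
    refine (tensor_ev_over (g • l) (g • m) hgl f ((f ≫ g) • ξ) h₂ e₃).trans ?_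
    refine Eq.trans ?_ (congr_arg (fun p : S ⟶ M.bundle.toOver ↦ (f ≫ g) • p)
      (tensor_ev_over l m h f ξ h₁ e₁)).symm
    refine Eq.trans ?_ (M.smul_smulOver _ _ _).symm
    rw [← lineCoord_dual_smul L (f ≫ g) ξ (f ≫ l) e₁ e₂, ModObj.comp_smul f g m]
    congr 2
    exact congr_arg CommaMorphism.left
      (TensorPairing.pairOver_congr _ _ rfl (ModObj.comp_smul f g l))

end LinearizedBundle

namespace LinearizedBundle

open LineBundle

variable {B : Scheme.{u}} {G X : Over B} [GrpObj G] [ModObj G X]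

/-- The translate of a frame is a frame. -/
lemma isFrame_smul_left (L : LinearizedBundle G X) {T : Over B} (g : T ⟶ G)
    (l : T ⟶ L.bundle.toOver) (hl : L.bundle.IsFrame l.left) :
    L.bundle.IsFrame (g • l).left := by
  intro S f m hm
  let f' : Over.mk (f ≫ T.hom) ⟶ T := Over.homMk f rfl
  let m' : Over.mk (f ≫ T.hom) ⟶ L.bundle.toOver := Over.homMk m (by
    change m ≫ L.bundle.proj ≫ X.hom = f ≫ T.hom
    rw [← Category.assoc, hm, ← Over.w (g • l), Category.assoc, Category.assoc]
    rfl)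
  have hm' : m' ≫ L.bundle.π = f' ≫ (g • l) ≫ L.bundle.π := by ext1; exact hm
  have key (a : Γ(S, ⊤)) : L.bundle.smul a (f ≫ (g • l).left) = m ↔
      L.bundle.smul a (f ≫ l.left) = ((f' ≫ g)⁻¹ • m').left := by
    have : L.bundle.smulOver (T := Over.mk (f ≫ T.hom)) a (f' ≫ (g • l)) = m' ↔
        L.bundle.smulOver (T := Over.mk (f ≫ T.hom)) a (f' ≫ l) = (f' ≫ g)⁻¹ • m' := by
      rw [ModObj.comp_smul, ← L.smul_smulOver, eq_inv_smul_iff]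
    constructor
    · intro h
      exact congr_arg CommaMorphism.left (this.1 (by ext1; exact h))
    · intro h
      exact congr_arg CommaMorphism.left (this.2 (by ext1; exact h))
  obtain ⟨a, ha, hu⟩ := hl f ((f' ≫ g)⁻¹ • m').left (by
    have : ((f' ≫ g)⁻¹ • m') ≫ L.bundle.π = f' ≫ l ≫ L.bundle.π := by
      rw [L.smul_π, hm', L.smul_π, ModObj.comp_smul, inv_smul_smul]
    exact congr_arg CommaMorphism.left this)
  exact ⟨a, (key a).2 ha, fun c hc ↦ hu c ((key c).1 hc)⟩

lemma exists_isom {L M : LinearizedBundle G X}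
    {R : ∀ {T : Scheme.{u}}, (T ⟶ L.bundle.total) → (T ⟶ M.bundle.total) → Prop}
    (h : FrameRel L.bundle M.bundle R)
    (hR : ∀ {T : Over B} (g : T ⟶ G) (p : T ⟶ L.bundle.toOver) (q : T ⟶ M.bundle.toOver),
      R p.left q.left → R (g • p).left (g • q).left) : Nonempty (Isom L M) := by
  obtain ⟨e, he⟩ := h.exists_iso
  refine ⟨⟨e, fun {T} g l ↦ ?_⟩⟩
  ext1
  refine Scheme.hom_ext_of_forall _ _ fun t ↦ ?_
  obtain ⟨V, hV, p, p', a, hr, ha⟩ := h.local_rep l.left t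
  refine ⟨V, hV, ?_⟩
  let i : Over.mk (V.ι ≫ T.hom) ⟶ T := Over.homMk V.ι rfl
  have hp : p ≫ L.bundle.proj = V.ι ≫ l.left ≫ L.bundle.proj := by
    rw [← Category.assoc, ha, L.bundle.smul_proj]
  have hp' : p ≫ L.bundle.proj ≫ X.hom = V.ι ≫ T.hom := by
    rw [← Category.assoc, hp, Category.assoc, Category.assoc]
    exact congr_arg _ (Over.w l)
  let P : Over.mk (V.ι ≫ T.hom) ⟶ L.bundle.toOver := Over.homMk p hp'
  let Q : Over.mk (V.ι ≫ T.hom) ⟶ M.bundle.toOver := Over.homMk p' (by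
    change p' ≫ M.bundle.proj ≫ X.hom = _
    rw [← Category.assoc, ← h.base _ _ hr, Category.assoc, hp']
    rfl)
  have h₁ : i ≫ l = L.bundle.smulOver (T := Over.mk (V.ι ≫ T.hom)) a P := by ext1; exact ha
  have h₂ : P ≫ e.homOver = Q := by ext1; exact he _ _ hr
  have h₃ : ((i ≫ g) • P) ≫ e.homOver = (i ≫ g) • Q := by
    ext1; exact he _ _ (hR (i ≫ g) P Q hr)
  have : i ≫ (g • l) ≫ e.homOver = i ≫ (g • (l ≫ e.homOver)) := by
    rw [← Category.assoc, ModObj.comp_smul, ModObj.comp_smul, ← Category.assoc, h₁,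
      L.smul_smulOver, e.smulOver_homOver, h₃, e.smulOver_homOver, h₂, M.smul_smulOver]
  exact congr_arg CommaMorphism.left this

lemma exists_smul_frames (L M N : LinearizedBundle G X) {T : Over B} (g : T ⟶ G)
    (e : Frames L.bundle M.bundle N.bundle T.left) (hx : e.x ≫ X.hom = T.hom) :
    ∃ (l : T ⟶ L.bundle.toOver) (m : T ⟶ M.bundle.toOver) (n : T ⟶ N.bundle.toOver)
      (e' : Frames L.bundle M.bundle N.bundle T.left),
      l.left = e.l ∧ m.left = e.m ∧ n.left = e.n ∧ l ≫ L.bundle.π = m ≫ M.bundle.π ∧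
      m ≫ M.bundle.π = n ≫ N.bundle.π ∧
      e'.l = (g • l).left ∧ e'.m = (g • m).left ∧ e'.n = (g • n).left := by
  let l : T ⟶ L.bundle.toOver := Over.homMk e.l (by
    change e.l ≫ L.bundle.proj ≫ X.hom = _
    rw [← Category.assoc, e.hl, hx])
  let m : T ⟶ M.bundle.toOver := Over.homMk e.m (by
    change e.m ≫ M.bundle.proj ≫ X.hom = _
    rw [← Category.assoc, e.hm, hx])
  let n : T ⟶ N.bundle.toOver := Over.homMk e.n (by
    change e.n ≫ N.bundle.proj ≫ X.hom = _
    rw [← Category.assoc, e.hn, hx])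
  have h₁ : l ≫ L.bundle.π = m ≫ M.bundle.π := by ext1; exact e.hl.trans e.hm.symm
  have h₂ : m ≫ M.bundle.π = n ≫ N.bundle.π := by ext1; exact e.hm.trans e.hn.symm
  have k₁ : (g • l) ≫ L.bundle.π = (g • m) ≫ M.bundle.π := by rw [L.smul_π, M.smul_π, h₁]
  have k₂ : (g • m) ≫ M.bundle.π = (g • n) ≫ N.bundle.π := by rw [M.smul_π, N.smul_π, h₂]
  exact ⟨l, m, n,
    { x := (g • l).left ≫ L.bundle.proj
      l := (g • l).left
      m := (g • m).left
      n := (g • n).left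
      hl := rfl
      hm := (congr_arg CommaMorphism.left k₁).symm
      hn := (congr_arg CommaMorphism.left (k₁.trans k₂)).symm
      fl := L.isFrame_smul_left g l e.fl
      fm := M.isFrame_smul_left g m e.fm
      fn := N.isFrame_smul_left g n e.fn }, rfl, rfl, rfl, h₁, h₂, rfl, rfl, rfl⟩

lemma Equivariant.unique {L M N N' : LinearizedBundle G X}
    {b : TensorPairing L.bundle M.bundle N.bundle}
    {b' : TensorPairing L.bundle M.bundle N'.bundle} (hb : Equivariant b) (hb' : Equivariant b') :
    Nonempty (Isom N N') := by
  refine exists_isom (b.frameRel_unique b') ?_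
  rintro T g p q ⟨e, hp, hq⟩
  have hx : e.x ≫ X.hom = T.hom := by
    rw [← e.hl, ← b.pair_proj _ _ (e.hl.trans e.hm.symm), ← hp, Category.assoc]
    exact Over.w p
  obtain ⟨l, m, n, e', hl, hm, hn, h₁, h₂, k₁, k₂, k₃⟩ := exists_smul_frames L M M g e hx
  have hp' : p = b.pairOver l m h₁ := by
    ext1; exact hp.trans (b.pair_congr hl.symm hm.symm _)
  have hq' : q = b'.pairOver l m h₁ := by
    ext1; exact hq.trans (b'.pair_congr hl.symm hm.symm _)
  refine ⟨e', ?_, ?_⟩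
  · rw [hp', hb g l m h₁]
    exact b.pair_congr k₁.symm k₂.symm _
  · rw [hq', hb' g l m h₁]
    exact b'.pair_congr k₁.symm k₂.symm _

lemma Equivariant.assoc {L M N P Q R Q' : LinearizedBundle G X}
    {b₁ : TensorPairing L.bundle M.bundle P.bundle}
    {b₂ : TensorPairing P.bundle N.bundle Q.bundle}
    {b₃ : TensorPairing M.bundle N.bundle R.bundle}
    {b₄ : TensorPairing L.bundle R.bundle Q'.bundle} (h₁ : Equivariant b₁) (h₂ : Equivariant b₂)
    (h₃ : Equivariant b₃) (h₄ : Equivariant b₄) : Nonempty (Isom Q Q') := by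
  refine exists_isom (b₁.frameRel_assoc b₂ b₃ b₄) ?_
  rintro T g p q ⟨e, hp, hq⟩
  have hx : e.x ≫ X.hom = T.hom := by
    rw [← e.hl, ← b₄.pair_proj e.l (b₃.pair e.m e.n (e.hm.trans e.hn.symm))
      (by rw [b₃.pair_proj, e.hl, e.hm]), ← hq, Category.assoc]
    exact Over.w q
  obtain ⟨l, m, n, e', hl, hm, hn, e₁, e₂, k₁, k₂, k₃⟩ := exists_smul_frames L M N g e hx
  have e₃ : b₁.pairOver l m e₁ ≫ P.bundle.π = n ≫ N.bundle.π := by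
    rw [b₁.pairOver_π, e₁, e₂]
  have e₄ : l ≫ L.bundle.π = b₃.pairOver m n e₂ ≫ R.bundle.π := by
    rw [b₃.pairOver_π, e₁]
  have hp' : p = b₂.pairOver (b₁.pairOver l m e₁) n e₃ := by
    ext1
    exact hp.trans (b₂.pair_congr (b₁.pair_congr hl.symm hm.symm _) hn.symm _)
  have hq' : q = b₄.pairOver l (b₃.pairOver m n e₂) e₄ := by
    ext1
    exact hq.trans (b₄.pair_congr hl.symm (b₃.pair_congr hm.symm hn.symm _) _)
  refine ⟨e', ?_, ?_⟩
  · rw [hp', h₂ g _ _ e₃, b₂.pairOver_congr _ (h₁ g l m e₁) rfl]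
    exact b₂.pair_congr (b₁.pair_congr k₁.symm k₂.symm _) k₃.symm _
  · rw [hq', h₄ g _ _ e₄, b₄.pairOver_congr _ rfl (h₃ g m n e₂)]
    exact b₄.pair_congr k₁.symm (b₃.pair_congr k₂.symm k₃.symm _) _

namespace Isom

/-- The identity isomorphism. -/
def refl (L : LinearizedBundle G X) : Isom L L where
  toIsom := LineBundle.Isom.refl L.bundle
  smul_homOver g l := by
    have : (LineBundle.Isom.refl L.bundle).homOver = 𝟙 _ := rfl
    rw [this, Category.comp_id, Category.comp_id]

lemma homOver_symm {L M : LineBundle X.left} (e : LineBundle.Isom L M) :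
    e.homOver ≫ e.symm.homOver = 𝟙 _ := by
  ext1
  exact e.iso.hom_inv_id

lemma symm_homOver {L M : LineBundle X.left} (e : LineBundle.Isom L M) :
    e.symm.homOver ≫ e.homOver = 𝟙 _ := by
  ext1
  exact e.iso.inv_hom_id

/-- The inverse isomorphism. -/
def symm {L M : LinearizedBundle G X} (e : Isom L M) : Isom M L where
  toIsom := e.toIsom.symm
  smul_homOver g m := by
    have h := e.smul_homOver g (m ≫ e.toIsom.symm.homOver)
    rw [Category.assoc, symm_homOver, Category.comp_id] at h
    rw [← h, Category.assoc, homOver_symm, Category.comp_id]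

/-- Composition of isomorphisms. -/
def trans {L M N : LinearizedBundle G X} (e : Isom L M) (f : Isom M N) : Isom L N where
  toIsom := e.toIsom.trans f.toIsom
  smul_homOver g l := by
    have : (e.toIsom.trans f.toIsom).homOver = e.homOver ≫ f.homOver := rfl
    rw [this, ← Category.assoc, e.smul_homOver, f.smul_homOver, Category.assoc]

end Isom

lemma Equivariant.symm {L M N : LinearizedBundle G X}
    {b : TensorPairing L.bundle M.bundle N.bundle} (hb : Equivariant b) :
    Equivariant (L := M) (M := L) (N := N) b.symm :=
  fun _ g m l h ↦ hb g l m h.symm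

lemma Equivariant.congr {L M N L' M' N' : LinearizedBundle G X}
    {b : TensorPairing L.bundle M.bundle N.bundle} (hb : Equivariant b) (e : Isom L' L)
    (f : Isom M' M) (k : Isom N N') :
    Equivariant (L := L') (M := M') (N := N') (b.congr e.toIsom f.toIsom k.toIsom) := by
  intro T g l m h
  have h' : (l ≫ e.homOver) ≫ L.bundle.π = (m ≫ f.homOver) ≫ M.bundle.π := by
    rw [Category.assoc, e.homOver_π, Category.assoc, f.homOver_π, h]
  have h₁ := hb g (l ≫ e.homOver) (m ≫ f.homOver) h'
  have h₂ := k.smul_homOver g (b.pairOver (l ≫ e.homOver) (m ≫ f.homOver) h')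
  rw [h₁, b.pairOver_congr _ (e.smul_homOver g l).symm (f.smul_homOver g m).symm] at h₂
  exact h₂.symm

/-- Isomorphism of linearized line bundles, as an equivalence relation. -/
instance isomSetoid (G X : Over B) [GrpObj G] [ModObj G X] : Setoid (LinearizedBundle G X) where
  r L M := Nonempty (Isom L M)
  iseqv := ⟨fun L ↦ ⟨Isom.refl L⟩, fun ⟨e⟩ ↦ ⟨e.symm⟩, fun ⟨e⟩ ⟨f⟩ ↦ ⟨e.trans f⟩⟩

end LinearizedBundle

/-- The equivariant Picard group: isomorphism classes of `G`-linearized line bundles. -/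
def EquivPic {B : Scheme.{u}} (G X : Over B) [GrpObj G] [ModObj G X] : Type (u + 1) :=
  Quotient (LinearizedBundle.isomSetoid G X)

namespace EquivPic

open LinearizedBundle LineBundle

variable {B : Scheme.{u}} {G X : Over B} [GrpObj G] [ModObj G X]

/-- The class of a linearized line bundle. -/
def mk (L : LinearizedBundle G X) : EquivPic G X := Quotient.mk _ L

lemma mk_surjective : Function.Surjective (mk : LinearizedBundle G X → EquivPic G X) :=
  Quotient.mk_surjective

lemma mk_eq_iff {L M : LinearizedBundle G X} :
    mk L = mk M ↔ Nonempty (LinearizedBundle.Isom L M) := Quotient.eq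

instance : One (EquivPic G X) := ⟨mk (unit G X)⟩

instance : Mul (EquivPic G X) := ⟨Quotient.map₂ LinearizedBundle.tensor fun L L' ⟨e⟩ M M' ⟨f⟩ ↦
  ((equivariant_tensor L M).congr e.symm f.symm (LinearizedBundle.Isom.refl _)).unique
    (equivariant_tensor L' M')⟩

lemma mk_mul {L M N : LinearizedBundle G X} {b : TensorPairing L.bundle M.bundle N.bundle}
    (hb : Equivariant b) : mk L * mk M = mk N :=
  mk_eq_iff.2 ((equivariant_tensor L M).unique hb)

/-- The monoid structure given by tensor product of linearized line bundles. -/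
instance : CommMonoid (EquivPic G X) where
  mul_assoc := by
    intro a b c
    obtain ⟨L, rfl⟩ := mk_surjective a
    obtain ⟨M, rfl⟩ := mk_surjective b
    obtain ⟨N, rfl⟩ := mk_surjective c
    rw [mk_mul (equivariant_tensor L M), mk_mul (equivariant_tensor _ N),
      mk_mul (equivariant_tensor M N), mk_mul (equivariant_tensor L _), mk_eq_iff]
    exact (equivariant_tensor L M).assoc (equivariant_tensor _ N) (equivariant_tensor M N)
      (equivariant_tensor L _)
  mul_comm := by
    intro a b
    obtain ⟨L, rfl⟩ := mk_surjective a
    obtain ⟨M, rfl⟩ := mk_surjective b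
    rw [mk_mul (equivariant_tensor L M), mk_mul (equivariant_tensor L M).symm]
  one_mul := by
    intro a
    obtain ⟨L, rfl⟩ := mk_surjective a
    exact mk_mul (equivariant_unit L)
  mul_one := by
    intro a
    obtain ⟨L, rfl⟩ := mk_surjective a
    exact mk_mul (equivariant_unit L).symm

lemma mk_dual_mul (L : LinearizedBundle G X) : mk (LinearizedBundle.dual L) * mk L = 1 :=
  mk_mul (equivariant_ev L (unit G X))

instance : Inv (EquivPic G X) := ⟨Quotient.map LinearizedBundle.dual fun L L' h ↦ by
  have h' : mk L = mk L' := Quotient.sound h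
  refine mk_eq_iff.1 (left_inv_eq_right_inv (mk_dual_mul L) ?_)
  rw [h', mul_comm, mk_dual_mul]⟩

/-- The group structure on the equivariant Picard group; inverses are given by duals. -/
instance : CommGroup (EquivPic G X) where
  inv_mul_cancel := by
    intro a
    obtain ⟨L, rfl⟩ := mk_surjective a
    exact mk_dual_mul L

variable (G X) in
/-- The homomorphism `Pic^G(X) ⟶ Pic(X)` which forgets the linearization. -/
def forget : EquivPic G X →* Pic X.left :=
  MonoidHom.mk' (Quotient.map LinearizedBundle.bundle fun _ _ ⟨e⟩ ↦ ⟨e.toIsom⟩) fun a b ↦ by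
    obtain ⟨L, rfl⟩ := mk_surjective a
    obtain ⟨M, rfl⟩ := mk_surjective b
    exact (Pic.mk_mul (tensorPairing L.bundle M.bundle)).symm

end EquivPic

section sequence

variable {B : Scheme.{u}} (G X : Over B)

variable {X} in
/-- Pull-back of invertible functions. -/
def unitPull {Y : Over B} (f : Y ⟶ X) : Γ(X.left, ⊤)ˣ →* Γ(Y.left, ⊤)ˣ :=
  Units.map (pullFun f.left).toMonoidHom

variable [GrpObj G]

/-- The group `Ĝ(X)` of homomorphisms of group schemes over `X` from `G × X` to `𝔾ₘ × X`:
the invertible functions `c` on `G × X` such that `c(gh, x) = c(g, x) c(h, x)`. -/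
def characters : Subgroup Γ((G ⊗ X).left, ⊤)ˣ where
  carrier := {c | ∀ (T : Over B) (g h : T ⟶ G) (x : T ⟶ X),
    valueAt c (g * h) x = valueAt c g x * valueAt c h x}
  one_mem' := by simp
  mul_mem' {c d} hc hd T g h x := by
    rw [valueAt_mul, valueAt_mul, valueAt_mul, hc, hd, mul_mul_mul_comm]
  inv_mem' {c} hc T g h x := by
    have (g : T ⟶ G) : valueAt c⁻¹ g x = (valueAt c g x)⁻¹ := map_inv _ _
    rw [this, this, this, hc, mul_inv]

variable [ModObj G X]

/-- The group of `G`-invariant invertible functions on `X`. -/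
def invariantUnits : Subgroup Γ(X.left, ⊤)ˣ :=
  (unitPull (γ[G, X] : G ⊗ X ⟶ X)).eqLocus (unitPull (snd G X))

/-- The homomorphism `Pic(X) ⟶ Pic(G × X) / p₂^* Pic(X)` which sends the class of `L` to the class
of `α^* L`, where `α` is the action. -/
def obstruction : Pic X.left →*
    Pic (G ⊗ X).left ⧸ (Pic.map (snd G X).left : Pic X.left →* Pic (G ⊗ X).left).range :=
  (QuotientGroup.mk' _).comp (Pic.map (γ[G, X] : G ⊗ X ⟶ X).left)

end sequence

end EquivariantPicard

end

/-! The whole sequence follows from one rigidity statement, `units_eq_one`: an invertible function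
on G × G × X which is 1 on 1 × G × X and on G × 1 × X is 1.

Consequences for functions. If c is a unit on G × X with c(1, x) = 1, then c(gh, x) / (c(g, x) c(h,
x)) is 1 as soon as g or h is 1, so c is a character. This applies to f(gx) / f(x). If c is a
character, then c(g, hx) / c(g, x) is likewise 1, so c is also a cocycle; conversely a cocycle is 1
at g = 1, hence a character. Thus Ĝ(X) is exactly the set of linearizations of the trivial bundle.
An isomorphism between two of these is multiplication by a unit f, which changes the cocycle by
f(gx) / f(x). This gives exactness up to and including Pic^G(X).

Exactness at Pic(X). A linearization l ↦ g • l is an isomorphism from p₂^*L to α^*L. Conversely, an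
isomorphism from p₂^*M to α^*L is a family of linear maps from M_x to L_{gx}. Composing with the
inverse of its member at g = 1 gives maps from L_x to L_{gx} that are the identity at g = 1. The two
lifts of translation by gh obtained from these maps differ by a unit on G × G × X
(`exists_units_isRatio`), which is 1 when g or h is 1. By rigidity it is 1, and the maps form an
action (`mul_act_of_normalized`).

Rigidity. G is geometrically integral: a connected group has a rational point, so it stays connected
over an algebraic closure, where translations make it irreducible; smoothness gives geometric
reducedness. Hence G × G × X is reduced and equality may be tested at geometric points, where X
becomes a point over an algebraically closed field Ω. Then G_Ω × G_Ω is integral, and equality may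
be tested at its generic point, both of whose coordinates lie in a given affine neighbourhood of the
neutral element.

What is left is algebra (`unit_tensorProduct_eq_one`): for domains A and B over an algebraically
closed field K, each with a K-point, a unit x of A ⊗ B which is 1 on both axes is 1. Let F be the
fraction field of A, and expand x in F ⊗ B along a K-basis of B. For every valuation ring V of F
containing K, Gauss's lemma, in which the residue field of V tensored with B is a domain, shows that
x is primitive over V up to a scalar, and the normalization puts the coordinates into V. Elements
lying in all such V are integral over K, so they lie in K: x depends on the second variable only,
and its value on the other axis is 1. The rings V play the part of the points of a compactification,
so neither properness nor normality is needed. -/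

namespace EquivariantPicard

open TensorProduct

/-! ### Coordinates along a basis of the second tensor factor -/

section coordinates

variable {K A A' B σ : Type*} [CommRing K] [CommRing A] [CommRing A'] [CommRing B]
  [Algebra K A] [Algebra K A'] [Algebra K B]

lemma basis_repr_map (b : Module.Basis σ K B) (f : A →ₐ[K] A') (z : A ⊗[K] B) (i : σ) :
    (Algebra.TensorProduct.basis A' b).repr (Algebra.TensorProduct.map f (AlgHom.id K B) z) i =
      f ((Algebra.TensorProduct.basis A b).repr z i) := by
  induction z with
  | zero => simp
  | add x y hx hy => simp [hx, hy]
  | tmul x y => simp [Algebra.TensorProduct.basis_repr_tmul, map_mul]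

/-- Descent of elements is decided coordinate by coordinate. It is applied to descend to a finitely
generated subalgebra, to a valuation ring and to the base field. -/
lemma exists_map_eq (b : Module.Basis σ K B) (f : A →ₐ[K] A') (z : A' ⊗[K] B)
    (h : ∀ i, ∃ a, f a = (Algebra.TensorProduct.basis A' b).repr z i) :
    ∃ w : A ⊗[K] B, Algebra.TensorProduct.map f (AlgHom.id K B) w = z := by
  choose c hc using h
  refine ⟨∑ i ∈ ((Algebra.TensorProduct.basis A' b).repr z).support, c i ⊗ₜ b i, ?_⟩
  rw [map_sum]
  conv_rhs => rw [← (Algebra.TensorProduct.basis A' b).linearCombination_repr z,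
    Finsupp.linearCombination_apply]
  refine Finset.sum_congr rfl fun i _ ↦ ?_
  simp [hc, Algebra.TensorProduct.basis_apply, TensorProduct.smul_tmul']

lemma basis_repr_ne_zero (b : Module.Basis σ K B) {z : A ⊗[K] B} (hz : z ≠ 0) :
    ∃ i, (Algebra.TensorProduct.basis A b).repr z i ≠ 0 := by
  by_contra! h
  exact hz ((map_eq_zero_iff _ (Algebra.TensorProduct.basis A b).repr.injective).1
    (Finsupp.ext h))

lemma map_id_injective [Module.Flat K B] {f : A →ₐ[K] A'} (hf : Function.Injective f) :
    Function.Injective (Algebra.TensorProduct.map f (AlgHom.id K B)) :=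
  Module.Flat.rTensor_preserves_injective_linearMap (M := B) f.toLinearMap hf

end coordinates

/-! ### Tensor products of domains, and reducedness of smooth algebras -/

/-- This is the Nullstellensatz. In a reduced Jacobson ring some maximal ideal avoids `a`, and its
residue field, being finite over the algebraically closed field `K`, equals `K`. -/
lemma exists_algHom_ne_zero {K A : Type*} [Field K] [IsAlgClosed K] [CommRing A] [IsReduced A]
    [Algebra K A] [Algebra.FiniteType K A] {a : A} (ha : a ≠ 0) : ∃ f : A →ₐ[K] K, f a ≠ 0 := by
  have : IsJacobsonRing A := isJacobsonRing_of_finiteType (A := K)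
  have h : a ∉ (⊥ : Ideal A).jacobson := by
    rw [IsJacobsonRing.out ‹_› ((Ideal.isRadical_iff_quotient_reduced _).2
      (isReduced_of_injective _ (RingEquiv.quotientBot A).injective))]
    simpa using ha
  rw [Ideal.jacobson, Ideal.mem_sInf] at h
  push Not at h
  obtain ⟨m, ⟨-, hm⟩, ham⟩ := h
  have : Algebra.FiniteType K (A ⧸ m) := inferInstance
  let := Ideal.Quotient.field m
  have := finite_of_finite_type_of_isJacobsonRing K (A ⧸ m)
  have hb := IsAlgClosed.algebraMap_bijective_of_isIntegral (k := K) (K := A ⧸ m)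
  let e : K ≃ₐ[K] A ⧸ m := AlgEquiv.ofBijective (Algebra.ofId K _) hb
  refine ⟨e.symm.toAlgHom.comp (Ideal.Quotient.mkₐ K m), fun h ↦ ham ?_⟩
  have h' : e.symm (Ideal.Quotient.mk m a) = 0 := h
  rw [map_eq_zero_iff _ e.symm.injective] at h'
  exact Ideal.Quotient.eq_zero_iff_mem.1 h'

/-- Over an algebraically closed field, the tensor product of two domains is a domain. -/
theorem isDomain_tensorProduct (K A B : Type*) [Field K] [IsAlgClosed K] [CommRing A] [IsDomain A]
    [CommRing B] [IsDomain B] [Algebra K A] [Algebra K B] : IsDomain (A ⊗[K] B) := by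
  have : Nontrivial (A ⊗[K] B) := inferInstance
  have : NoZeroDivisors (A ⊗[K] B) := by
    refine ⟨fun {x y} hxy ↦ ?_⟩
    by_contra! hne
    let b := Module.Free.chooseBasis K B
    let bA := Algebra.TensorProduct.basis A b
    obtain ⟨i, hi⟩ := basis_repr_ne_zero b hne.1
    obtain ⟨j, hj⟩ := basis_repr_ne_zero b hne.2
    -- Finitely many coordinates are involved, so the relation descends to a finitely generated
    -- subalgebra of `A`, where the Nullstellensatz is available.
    let s : Set A := Set.range (bA.repr x) ∪ Set.range (bA.repr y)
    have hs : s.Finite := (Finsupp.finite_range _).union (Finsupp.finite_range _)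
    let A₀ := Algebra.adjoin K s
    have : Algebra.FiniteType K A₀ := (Subalgebra.fg_iff_finiteType _).1 ⟨hs.toFinset, by simp [A₀]⟩
    let b₀ := Algebra.TensorProduct.basis A₀ b
    obtain ⟨x₀, hx₀⟩ := exists_map_eq b A₀.val x
      fun i ↦ ⟨⟨bA.repr x i, Algebra.subset_adjoin (.inl ⟨i, rfl⟩)⟩, rfl⟩
    obtain ⟨y₀, hy₀⟩ := exists_map_eq b A₀.val y
      fun i ↦ ⟨⟨bA.repr y i, Algebra.subset_adjoin (.inr ⟨i, rfl⟩)⟩, rfl⟩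
    have h₀ : x₀ * y₀ = 0 := map_id_injective (B := B) (f := A₀.val) Subtype.val_injective (by
      rw [map_mul, hx₀, hy₀, hxy, map_zero])
    rw [← hx₀, basis_repr_map] at hi
    rw [← hy₀, basis_repr_map] at hj
    -- A `K`-point that does not kill this product of coordinates keeps the images of `x₀` and `y₀`
    -- in K ⊗ B ≅ B nonzero, although their product is zero.
    have hij : b₀.repr x₀ i * b₀.repr y₀ j ≠ 0 := by
      intro h
      have := congr_arg A₀.val h
      rw [map_mul, map_zero] at this
      exact (mul_ne_zero hi hj) this
    obtain ⟨f, hf⟩ := exists_algHom_ne_zero (K := K) hij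
    rw [map_mul] at hf
    let F : A₀ ⊗[K] B →ₐ[K] K ⊗[K] B := Algebra.TensorProduct.map f (AlgHom.id K B)
    have hF : F x₀ * F y₀ = 0 := by rw [← map_mul, h₀, map_zero]
    have : IsDomain (K ⊗[K] B) := (Algebra.TensorProduct.lid K B).toMulEquiv.isDomain B
    rcases mul_eq_zero.1 hF with h | h
    · refine hf ?_
      rw [← basis_repr_map b f x₀ i]
      simp only [F] at h
      rw [h]; simp
    · refine hf ?_
      rw [← basis_repr_map b f y₀ j]
      simp only [F] at h
      rw [h]; simp
  exact NoZeroDivisors.to_isDomain _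

/-- A smooth algebra over a field is reduced. -/
theorem isReduced_of_smooth (k S : Type u) [Field k] [CommRing S] [Algebra k S]
    [Algebra.Smooth k S] : IsReduced S := by
  refine ⟨fun n hn ↦ ?_⟩
  -- A nilpotent `n` makes n ⊗ X nilpotent, hence integral over `S`. Integral closure commutes with
  -- smooth base change, so n ⊗ X comes from `S` tensored with the integral closure of `k` in k[X].
  have hint : IsIntegral S (n ⊗ₜ[k] (Polynomial.X : Polynomial k)) := by
    obtain ⟨m, hm⟩ := hn
    refine ⟨Polynomial.X ^ (m + 1), Polynomial.monic_X_pow _, ?_⟩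
    simp [Algebra.TensorProduct.tmul_pow, pow_succ, hm]
  obtain ⟨z, hz⟩ := (TensorProduct.toIntegralClosure_bijective_of_smooth (R := k) (S := S)
    (B := Polynomial k)).2 ⟨_, hint⟩
  have hz' : Algebra.TensorProduct.map (AlgHom.id S S) (integralClosure k (Polynomial k)).val z =
    n ⊗ₜ[k] (Polynomial.X : Polynomial k) := congr_arg Subtype.val hz
  have h₁ := congr_arg (TensorProduct.map (LinearMap.id : S →ₗ[k] S) (Polynomial.lcoeff k 1)) hz'
  -- A polynomial integral over `k` is constant. So taking the coefficient of X kills everything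
  -- coming from the integral closure, whereas it sends n ⊗ X to `n`.
  have h₂ (z : S ⊗[k] integralClosure k (Polynomial k)) :
      TensorProduct.map (LinearMap.id : S →ₗ[k] S) (Polynomial.lcoeff k 1)
        (Algebra.TensorProduct.map (AlgHom.id S S) (integralClosure k (Polynomial k)).val z) =
          0 := by
    induction z with
    | zero => simp
    | add x y hx hy => rw [map_add, map_add, hx, hy, add_zero]
    | tmul x y =>
      have : (y : Polynomial k).coeff 1 = 0 := by
        obtain ⟨p, hp, hpy⟩ := y.2
        rw [← Polynomial.aeval_def, ← Polynomial.comp_eq_aeval, Polynomial.comp_eq_zero_iff] at hpy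
        rcases hpy with h | ⟨-, h⟩
        · exact absurd h hp.ne_zero
        · rw [h, Polynomial.coeff_C_succ]
      simp [this]
  rw [h₂] at h₁
  have h₃ := congr_arg (TensorProduct.rid k S) h₁
  simpa using h₃.symm


/-! ### Units of a tensor product of domains -/

section units

variable {K B F : Type*} [Field K] [CommRing B] [Algebra K B] [Field F] [Algebra K F]

/-- A nonzero element of `F ⊗ B` is a multiple of a primitive element of `V ⊗ B`, where `V` is a
valuation ring of `F`. -/
lemma exists_primitive {σ : Type*} (b : Module.Basis σ K B) (V : ValuationSubring F) [Algebra K V]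
    (f : V →ₐ[K] F) (hf : ∀ a, f a = a) {z : F ⊗[K] B} (hz : z ≠ 0) :
    ∃ (a : F) (w : V ⊗[K] B) (i : σ), a ≠ 0 ∧
      z = a • Algebra.TensorProduct.map f (AlgHom.id K B) w ∧
      (Algebra.TensorProduct.basis V b).repr w i = 1 := by
  let bF := Algebra.TensorProduct.basis F b
  obtain ⟨j, hj⟩ := basis_repr_ne_zero b hz
  -- Dividing by a coordinate of largest valuation brings all coordinates into `V` and makes this
  -- one equal to 1.
  obtain ⟨i, -, hi⟩ := (bF.repr z).support.exists_max_image (fun i ↦ V.valuation (bF.repr z i))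
    ⟨j, Finsupp.mem_support_iff.2 hj⟩
  have hle (l) : V.valuation (bF.repr z l) ≤ V.valuation (bF.repr z i) := by
    by_cases hl : bF.repr z l = 0
    · simp [hl]
    · exact hi l (Finsupp.mem_support_iff.2 hl)
  have hi0 : bF.repr z i ≠ 0 := by
    intro h
    have := hle j
    rw [h, map_zero, le_zero_iff, map_eq_zero] at this
    exact hj this
  obtain ⟨w, hw⟩ := exists_map_eq b f ((bF.repr z i)⁻¹ • z) fun l ↦ by
    refine ⟨⟨(bF.repr z i)⁻¹ * bF.repr z l, ?_⟩, ?_⟩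
    · rw [← V.valuation_le_one_iff, map_mul, map_inv₀, mul_comm, ← div_eq_mul_inv]
      exact div_le_one_of_le₀ (hle l) zero_le
    · rw [hf]
      simp [bF]
  refine ⟨bF.repr z i, w, i, hi0, ?_, ?_⟩
  · rw [hw, smul_inv_smul₀ hi0]
  · have := basis_repr_map b f w i
    rw [hw, hf] at this
    ext
    rw [← this]
    simp [bF, hi0]

/-- Evaluation of the second factor of a tensor product at a point. -/
def evalRight (A : Type*) [CommRing A] [Algebra K A] (e : B →ₐ[K] K) : A ⊗[K] B →ₐ[A] A :=
  Algebra.TensorProduct.lift (AlgHom.id A A) ((Algebra.ofId K A).comp e) fun _ _ ↦ .all _ _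

lemma evalRight_tmul (A : Type*) [CommRing A] [Algebra K A] (e : B →ₐ[K] K) (a : A) (c : B) :
    evalRight A e (a ⊗ₜ c) = a * algebraMap K A (e c) := by
  simp [evalRight, Algebra.ofId_apply]

lemma evalRight_map {A A' : Type*} [CommRing A] [Algebra K A] [CommRing A'] [Algebra K A']
    (e : B →ₐ[K] K) (f : A →ₐ[K] A') (z : A ⊗[K] B) :
    evalRight A' e (Algebra.TensorProduct.map f (AlgHom.id K B) z) = f (evalRight A e z) := by
  induction z with
  | zero => simp
  | add x y hx hy => simp only [map_add, hx, hy]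
  | tmul x y => simp [evalRight_tmul]

/-- The coordinates of a unit which specializes to `1` lie in every valuation ring. -/
lemma basis_repr_mem_valuationSubring [IsAlgClosed K] [IsDomain B] {σ : Type*}
    (b : Module.Basis σ K B) (e : B →ₐ[K] K) (V : ValuationSubring F)
    (hV : ∀ c : K, algebraMap K F c ∈ V) {x y : F ⊗[K] B} (hxy : x * y = 1)
    (hx : evalRight F e x = 1) (i : σ) : (Algebra.TensorProduct.basis F b).repr x i ∈ V := by
  let : Algebra K V := ((algebraMap K F).codRestrict V.toSubring hV).toAlgebra
  let f : V →ₐ[K] F := { V.subtype with commutes' := fun _ ↦ rfl }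
  have hf (a : V) : f a = a := rfl
  have hfi : Function.Injective f := Subtype.val_injective
  have hy : evalRight F e y = 1 := by
    have := congr_arg (evalRight F e) hxy
    rwa [map_mul, hx, one_mul, map_one] at this
  obtain ⟨a, w, i₁, ha, hw, hi₁⟩ := exists_primitive b V f hf (left_ne_zero_of_mul_eq_one hxy)
  obtain ⟨a', w', i₂, ha', hw', hi₂⟩ := exists_primitive b V f hf (right_ne_zero_of_mul_eq_one hxy)
  let m := Algebra.TensorProduct.map f (AlgHom.id K B)
  have hmm : (a * a') • m (w * w') = 1 := by
    rw [← hxy, hw, hw', map_mul, smul_mul_smul_comm]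
  have hmm' : m (w * w') = (a * a')⁻¹ • 1 := by
    rw [← hmm, inv_smul_smul₀ (mul_ne_zero ha ha')]
  -- The primitive parts multiply to the constant (a a')⁻¹. Comparing one coordinate at which 1 ∈ B
  -- is nonzero shows that this constant lies in `V`.
  obtain ⟨q, hq⟩ : ∃ q : V, f q = (a * a')⁻¹ := by
    obtain ⟨l, hl⟩ : ∃ l, b.repr 1 l ≠ 0 := by
      by_contra! h
      exact one_ne_zero ((map_eq_zero_iff _ b.repr.injective).1 (Finsupp.ext h))
    have h₁ := basis_repr_map b f (w * w') l
    have h₂ : (Algebra.TensorProduct.basis F b).repr (m (w * w')) l =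
        (a * a')⁻¹ * algebraMap K F (b.repr 1 l) := by
      rw [hmm', Algebra.TensorProduct.one_def, map_smul, Finsupp.smul_apply,
        Algebra.TensorProduct.basis_repr_tmul]
      simp
    refine ⟨(Algebra.TensorProduct.basis V b).repr (w * w') l *
      algebraMap K V (b.repr 1 l)⁻¹, ?_⟩
    rw [map_mul, ← h₁]
    refine (congr_arg (· * _) h₂).trans ?_
    rw [AlgHom.commutes, mul_assoc, ← map_mul, mul_inv_cancel₀ hl, map_one, mul_one]
  have hww : w * w' = q ⊗ₜ 1 := by
    apply map_id_injective (B := B) hfi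
    refine hmm'.trans ?_
    rw [Algebra.TensorProduct.map_tmul, hq, Algebra.TensorProduct.one_def, TensorProduct.smul_tmul']
    simp
  let r : V →ₐ[K] IsLocalRing.ResidueField V := IsScalarTower.toAlgHom K V _
  let W := Algebra.TensorProduct.map r (AlgHom.id K B)
  have hW (w : V ⊗[K] B) (i) (hi : (Algebra.TensorProduct.basis V b).repr w i = 1) : W w ≠ 0 := by
    intro h
    have := basis_repr_map b r w i
    rw [hi, map_one] at this
    change (Algebra.TensorProduct.basis _ b).repr (W w) i = 1 at this
    rw [h] at this
    simp at this
  have := isDomain_tensorProduct K (IsLocalRing.ResidueField V) B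
  -- Gauss's lemma: a primitive element has a nonzero image over the residue field of `V`, and the
  -- residue field tensored with `B` is a domain. So q ⊗ 1 has nonzero image and `q` is a unit of
  -- `V`.
  have hq0 : IsLocalRing.residue V q ≠ 0 := by
    intro h
    have h' : W (w * w') = 0 := by
      rw [hww, Algebra.TensorProduct.map_tmul]
      change IsLocalRing.residue V q ⊗ₜ _ = _
      rw [h, TensorProduct.zero_tmul]
    rw [map_mul] at h'
    exact mul_ne_zero (hW w i₁ hi₁) (hW w' i₂ hi₂) h'
  obtain ⟨q', hq'⟩ : ∃ q', q * q' = 1 := by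
    have hu : IsUnit q := by rwa [IsLocalRing.residue_ne_zero_iff_isUnit] at hq0
    exact hu.exists_right_inv
  have ha1 : a' * f (evalRight V e w') = 1 := by
    rw [← hy, hw', map_smul, evalRight_map, smul_eq_mul]
  -- Since q⁻¹ = a a' and a' times the value of `w'` at `e` is 1, the scalar `a` is q⁻¹ times that
  -- value, an element of `V`. Without the normalization at `e` only the product a a' would be
  -- controlled.
  have haV : a = f (q' * evalRight V e w') := by
    have h₁ : (a * a')⁻¹ * f q' = 1 := by rw [← hq, ← map_mul, hq', map_one]
    have h₂ : f q' = a * a' := by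
      rwa [inv_mul_eq_one₀ (mul_ne_zero ha ha'), eq_comm] at h₁
    rw [map_mul, h₂, mul_assoc, ha1, mul_one]
  rw [hw, map_smul, Finsupp.smul_apply, basis_repr_map, haV, smul_eq_mul, ← map_mul, hf]
  exact SetLike.coe_mem _

lemma mem_range_of_isIntegral [IsAlgClosed K] {x : F} (hx : IsIntegral K x) :
    x ∈ (algebraMap K F).range :=
  minpoly.mem_range_of_degree_eq_one K x
    (IsAlgClosed.degree_eq_one_of_irreducible K (minpoly.irreducible hx))

/-- An element of an extension of an algebraically closed field `K` which lies in every valuation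
ring containing `K` lies in `K`. -/
lemma mem_range_of_forall_valuationSubring [IsAlgClosed K] {x : F}
    (hx : ∀ V : ValuationSubring F, (∀ c : K, algebraMap K F c ∈ V) → x ∈ V) :
    x ∈ (algebraMap K F).range := by
  let R : Subring F := (⊥ : Subalgebra K F).toSubring
  -- The image of `K` in `F` is integrally closed because `K` is algebraically closed, and any
  -- element outside an integrally closed subring is missed by some valuation ring containing the
  -- subring.
  have : IsIntegrallyClosedIn R F := by
    rw [Subring.isIntegrallyClosedIn_iff]
    intro y hy
    have hy' : IsIntegral (⊥ : Subalgebra K F) y := hy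
    exact Algebra.mem_bot.2 (mem_range_of_isIntegral (isIntegral_trans (R := K) y hy'))
  suffices h : x ∈ R from Algebra.mem_bot.1 h
  by_contra h
  obtain ⟨V, hV, hxV⟩ := Subring.exists_le_valuationSubring_of_isIntegrallyClosedIn h
  exact hxV (hx V fun c ↦ hV (Algebra.mem_bot.2 ⟨c, rfl⟩))

/-- A unit on the product of two integral schemes over an algebraically closed field which is `1`
on both axes is `1`. -/
theorem unit_tensorProduct_eq_one {A : Type*} [CommRing A] [IsDomain A] [Algebra K A]
    [IsAlgClosed K] [IsDomain B] (d : A →ₐ[K] K) (e : B →ₐ[K] K) (x : (A ⊗[K] B)ˣ)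
    (h₁ : evalRight A e x = 1)
    (h₂ : Algebra.TensorProduct.map d (AlgHom.id K B) (x : A ⊗[K] B) = 1) : x = 1 := by
  let F := FractionRing A
  let f : A →ₐ[K] F := IsScalarTower.toAlgHom K A F
  have hf : Function.Injective f := IsFractionRing.injective A F
  let m := Algebra.TensorProduct.map f (AlgHom.id K B)
  let b := Module.Free.chooseBasis K B
  -- Over the fraction field, `x` is still 1 at `e`, so its coordinates lie in every valuation ring
  -- over `K`, hence in `K`. Therefore `x` has the form 1 ⊗ y, and `d` then reads off y = 1.
  have hmem (i) : ∃ c : K, Algebra.ofId K F c =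
      (Algebra.TensorProduct.basis F b).repr (m x) i :=
    mem_range_of_forall_valuationSubring fun V hV ↦
      basis_repr_mem_valuationSubring b e V hV (y := m ↑x⁻¹)
        (by rw [← map_mul, Units.mul_inv, map_one])
        (by rw [evalRight_map, h₁, map_one]) i
  obtain ⟨w, hw⟩ := exists_map_eq b (Algebra.ofId K F) (m x) hmem
  obtain ⟨y, rfl⟩ := (Algebra.TensorProduct.lid K B).symm.surjective w
  rw [Algebra.TensorProduct.lid_symm_apply, Algebra.TensorProduct.map_tmul, map_one] at hw
  have hx : (x : A ⊗[K] B) = 1 ⊗ₜ y := by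
    apply map_id_injective (B := B) hf
    rw [Algebra.TensorProduct.map_tmul, map_one]
    exact hw.symm
  rw [hx, Algebra.TensorProduct.map_tmul, map_one] at h₂
  have h₃ : (1 : K) ⊗ₜ[K] y = 1 ⊗ₜ 1 := h₂
  have h₄ : y = 1 := by simpa using congr_arg (Algebra.TensorProduct.lid K B) h₃
  ext
  rw [hx, h₄]
  rfl

end units

end EquivariantPicard

namespace EquivariantPicard

/-! ### Connected and irreducible spaces -/

section topology

variable {Y Z : Type*} [TopologicalSpace Y] [TopologicalSpace Z]

/-- The image of a nonempty clopen set is clopen and nonempty, hence everything, so every nonempty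
clopen set meets the fibre over `z`. A nontrivial clopen set and its complement would disconnect
that fibre. -/
lemma connectedSpace_of_isOpenMap_of_isClosedMap [ConnectedSpace Z] {p : Y → Z}
    (ho : IsOpenMap p) (hc : IsClosedMap p) {z : Z} (hz : IsConnected (p ⁻¹' {z})) :
    ConnectedSpace Y := by
  have key {U : Set Y} (hU : IsClopen U) (hne : U.Nonempty) : (p ⁻¹' {z} ∩ U).Nonempty := by
    have h : p '' U = Set.univ :=
      IsClopen.eq_univ ⟨hc _ hU.1, ho _ hU.2⟩ (hne.image p)
    obtain ⟨y, hy, hyz⟩ : z ∈ p '' U := h ▸ Set.mem_univ z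
    exact ⟨y, hyz, hy⟩
  have : PreconnectedSpace Y := by
    rw [preconnectedSpace_iff_clopen]
    intro U hU
    by_contra! hne
    obtain ⟨h₁, h₂⟩ := hne
    obtain ⟨y, hy, hyU⟩ := key hU.compl (Set.nonempty_compl.2 h₂)
    exact hyU (hz.isPreconnected.subset_isClopen hU (key hU h₁) hy)
  exact { toNonempty := hz.nonempty.to_subtype.map Subtype.val }

/-- A connected space which is covered by irreducible open subsets is irreducible. -/
lemma irreducibleSpace_of_forall_exists_isOpen [ConnectedSpace Y]
    (h : ∀ y : Y, ∃ U : Set Y, IsOpen U ∧ IsIrreducible U ∧ y ∈ U) : IrreducibleSpace Y := by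
  obtain ⟨x⟩ := (inferInstance : Nonempty Y)
  have hopen : IsOpen (irreducibleComponent x) := by
    rw [isOpen_iff_forall_mem_open]
    intro y hy
    obtain ⟨U, hU, hUi, hyU⟩ := h y
    refine ⟨U, ?_, hU, hyU⟩
    -- The part of the component inside `U` is dense in it, so the closure of `U` is an irreducible
    -- set containing the component and equals it by maximality. Thus `U` lies in the component,
    -- which is therefore clopen.
    have h₁ : irreducibleComponent x ⊆ closure U :=
      (subset_closure_inter_of_isPreirreducible_of_isOpen
        isIrreducible_irreducibleComponent.isPreirreducible hU ⟨y, hy, hyU⟩).trans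
        (closure_mono Set.inter_subset_right)
    have h₂ := eq_irreducibleComponent (hUi.closure.isPreirreducible) h₁
    exact subset_closure.trans h₂.subset
  have hu : irreducibleComponent x = Set.univ :=
    IsClopen.eq_univ ⟨isClosed_irreducibleComponent, hopen⟩ ⟨x, mem_irreducibleComponent⟩
  rw [irreducibleSpace_def, Set.top_eq_univ, ← hu]
  exact isIrreducible_irreducibleComponent

/-- A connected noetherian Jacobson space whose closed points are permuted transitively by
homeomorphisms is irreducible. -/
lemma irreducibleSpace_of_transitive [ConnectedSpace Y] [TopologicalSpace.NoetherianSpace Y]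
    [JacobsonSpace Y] (h : ∀ x ∈ closedPoints Y, ∀ y ∈ closedPoints Y, ∃ e : Y ≃ₜ Y, e x = y) :
    IrreducibleSpace Y := by
  -- This open locus is preserved by homeomorphisms. It contains a closed point, hence all of them,
  -- and a nonempty closed complement would contain a closed point of the Jacobson space.
  let W : Set Y := {y | ∃ U : Set Y, IsOpen U ∧ IsIrreducible U ∧ y ∈ U}
  have hW : IsOpen W := by
    rw [isOpen_iff_forall_mem_open]
    rintro y ⟨U, hU, hUi, hyU⟩
    exact ⟨U, fun z hz ↦ ⟨U, hU, hUi, hz⟩, hU, hyU⟩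
  suffices H : W = Set.univ from
    irreducibleSpace_of_forall_exists_isOpen fun y ↦ by
      have : y ∈ W := H ▸ Set.mem_univ y
      exact this
  by_contra hne
  obtain ⟨x₀⟩ := (inferInstance : Nonempty Y)
  -- In a noetherian space an irreducible component contains a nonempty open subset of the whole
  -- space.
  have hWne : W.Nonempty := by
    obtain ⟨U, hU, hne, hle⟩ :=
      TopologicalSpace.NoetherianSpace.exists_isOpen_nonempty_subset_irreducibleComponent
        (irreducibleComponent x₀) (irreducibleComponent_mem_irreducibleComponents x₀)
    obtain ⟨z, hz⟩ := hne
    exact ⟨z, U, hU, ⟨⟨z, hz⟩,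
      isIrreducible_irreducibleComponent.isPreirreducible.open_subset hU hle⟩, hz⟩
  obtain ⟨x, hx, hxc⟩ := nonempty_inter_closedPoints (Set.nonempty_compl.2 hne)
    hW.isClosed_compl.isLocallyClosed
  obtain ⟨y, ⟨U, hU, hUi, hyU⟩, hyc⟩ := nonempty_inter_closedPoints hWne hW.isLocallyClosed
  obtain ⟨e, rfl⟩ := h x hxc y hyc
  refine hx ⟨e ⁻¹' U, hU.preimage e.continuous, ?_, hyU⟩
  rw [← e.image_symm]
  exact hUi.image _ e.symm.continuous.continuousOn

lemma irreducibleSpace_of_surjective [IrreducibleSpace Y] {p : Y → Z} (hp : Continuous p)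
    (h : Function.Surjective p) : IrreducibleSpace Z := by
  rw [irreducibleSpace_def, Set.top_eq_univ, ← h.range_eq, ← Set.image_univ]
  exact (IrreducibleSpace.isIrreducible_univ Y).image p hp.continuousOn

end topology

/-! ### Geometric integrality of connected smooth groups -/

section geometry

lemma isReduced_of_smooth_specField {k : Type u} [Field k] {Y : Scheme.{u}}
    (f : Y ⟶ Spec (.of k)) [Smooth f] : AlgebraicGeometry.IsReduced Y := by
  have : ∀ i, AlgebraicGeometry.IsReduced (Y.affineOpenCover.openCover.X i) := fun i ↦ by
    obtain ⟨φ, hφ⟩ := Spec.map_surjective (Y.affineOpenCover.f i ≫ f)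
    have : IsOpenImmersion (Y.affineOpenCover.f i) := Y.affineOpenCover.map_prop i
    have h : Smooth (Spec.map φ) := hφ ▸ smooth_comp _ _
    have h' : φ.hom.Smooth := HasRingHomProperty.Spec_iff.mp h
    let : Algebra k (Y.affineOpenCover.X i) := φ.hom.toAlgebra
    have : Algebra.Smooth k (Y.affineOpenCover.X i) := h'
    have : _root_.IsReduced (Y.affineOpenCover.X i) := isReduced_of_smooth k (Y.affineOpenCover.X i)
    exact inferInstanceAs (AlgebraicGeometry.IsReduced (Spec (Y.affineOpenCover.X i)))
  exact IsReduced.of_openCover _ Y.affineOpenCover.openCover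

/-- Smoothness survives base change to any field, so it is enough that smooth schemes over fields
are reduced. -/
lemma geometricallyReduced_of_smooth {k : Type u} [Field k] {Y : Scheme.{u}}
    (f : Y ⟶ Spec (.of k)) [Smooth f] : GeometricallyReduced f := by
  refine ⟨geometrically_iff_of_isClosedUnderIsomorphisms.2 fun K _ y ↦ ?_⟩
  exact isReduced_of_smooth_specField (pullback.snd f y)

/-- Over an algebraically closed field the tensor product of two field extensions is a domain. -/
lemma geometricallyIrreducible_specField {K L : Type u} [Field K] [IsAlgClosed K] [Field L]
    (f : Spec (.of L) ⟶ Spec (.of K)) : GeometricallyIrreducible f := by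
  obtain ⟨φ, rfl⟩ := Spec.map_surjective f
  refine ⟨geometrically_iff_of_isClosedUnderIsomorphisms.2 fun F _ y ↦ ?_⟩
  obtain ⟨ψ, rfl⟩ := Spec.map_surjective y
  let : Algebra K L := φ.hom.toAlgebra
  let : Algebra K F := ψ.hom.toAlgebra
  have := isDomain_tensorProduct K L F
  have : IrreducibleSpace (Spec (.of (TensorProduct K L F))) :=
    inferInstanceAs (IrreducibleSpace (PrimeSpectrum (TensorProduct K L F)))
  exact irreducibleSpace_of_surjective (pullbackSpecIso K L F).inv.continuous
    (pullbackSpecIso K L F).inv.homeomorph.surjective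

/-- The part of the base change lying over the section `s` is a copy of `T`. With `T` the spectrum
of a field, this computes the fibre over a rational point. -/
lemma isPullback_section {Y S T : Scheme.{u}} (f : Y ⟶ S) (s : S ⟶ Y) (hs : s ≫ f = 𝟙 S)
    (g : T ⟶ S) : IsPullback (pullback.lift (g ≫ s) (𝟙 T) (by simp [hs])) g (pullback.fst f g) s := by
  refine IsPullback.of_right (h₁₂ := pullback.snd f g) (h₂₂ := f) (v₁₃ := g) ?_
    (pullback.lift_fst _ _ _) (IsPullback.of_hasPullback f g).flip
  rw [pullback.lift_snd, hs]
  exact IsPullback.of_horiz_isIso ⟨by simp⟩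

lemma range_of_isPullback {P Y Z S : Scheme.{u}} {p : P ⟶ Y} {q : P ⟶ Z} {f : Y ⟶ S} {g : Z ⟶ S}
    (h : IsPullback p q f g) : Set.range p = f ⁻¹' Set.range g := by
  have hs : Function.Surjective h.isoPullback.hom := h.isoPullback.hom.homeomorph.surjective
  rw [← Scheme.Pullback.range_fst, ← h.isoPullback_hom_fst, Scheme.Hom.comp_base, TopCat.coe_comp,
    Set.range_comp, hs.range_eq, Set.image_univ]

/-- The projection to `Y` is open, and it is closed because the extension is algebraic. The fibre
over the rational point is the image of Spec L, a single point, hence connected. -/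
lemma connectedSpace_pullback_of_section {k L : Type u} [Field k] [Field L] [Algebra k L]
    [Algebra.IsAlgebraic k L] {Y : Scheme.{u}} [ConnectedSpace Y] (f : Y ⟶ Spec (.of k))
    (s : Spec (.of k) ⟶ Y) (hs : s ≫ f = 𝟙 _) :
    ConnectedSpace ↥(pullback f (Spec.map (CommRingCat.ofHom (algebraMap k L)))) := by
  set g := Spec.map (CommRingCat.ofHom (algebraMap k L))
  have : IsIntegralHom g := by
    rw [IsIntegralHom.SpecMap_iff]
    exact algebraMap_isIntegral_iff.2 inferInstance
  have hr := range_of_isPullback (isPullback_section f s hs g)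
  have hs : Set.range s = {s (IsLocalRing.closedPoint k)} := by
    ext y
    simp only [Set.mem_range, Set.mem_singleton_iff]
    exact ⟨fun ⟨z, hz⟩ ↦ hz ▸ congr_arg s (Subsingleton.elim _ _), fun h ↦ ⟨_, h.symm⟩⟩
  rw [hs] at hr
  refine connectedSpace_of_isOpenMap_of_isClosedMap (pullback.fst f g).isOpenMap
    (pullback.fst f g).isClosedMap (z := s (IsLocalRing.closedPoint k)) ?_
  rw [← hr]
  exact isConnected_range (Scheme.Hom.continuous _)

/-- Over an algebraically closed field closed points are rational points, and a group acts
transitively on its rational points by translations. -/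
lemma exists_homeomorph_apply_eq {K : Type u} [Field K] [IsAlgClosed K] {Y : Scheme.{u}}
    (f : Y ⟶ Spec (.of K)) [LocallyOfFiniteType f] [GrpObj (Over.mk f)] {x y : Y}
    (hx : x ∈ closedPoints Y) (hy : y ∈ closedPoints Y) : ∃ e : Y ≃ₜ Y, e x = y := by
  let x' : 𝟙_ _ ⟶ Over.mk f := Over.homMk _ ((pointEquivClosedPoint f).symm ⟨x, hx⟩).2
  let y' : 𝟙_ _ ⟶ Over.mk f := Over.homMk _ ((pointEquivClosedPoint f).symm ⟨y, hy⟩).2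
  let α := (GrpObj.mulRight (A := Over.mk f) x').symm ≪≫
    (GrpObj.mulRight (A := Over.mk f) y')
  have hα : x' ≫ α.hom = y' := by
    dsimp only [Iso.trans_hom, Iso.symm_hom, α]
    rw [← Category.assoc, ← Iso.eq_comp_inv]
    simp [comp_lift_assoc]
  refine ⟨((Over.forget _).mapIso α).hom.homeomorph, ?_⟩
  let z : Spec (.of K) := IsLocalRing.closedPoint K
  have hx' : x'.left z = x := pointOfClosedPoint_apply f x hx z
  have hy' : y'.left z = y := pointOfClosedPoint_apply f y hy z
  have h : α.hom.left (x'.left z) = y'.left z := by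
    rw [← hα, Over.comp_left]
    rfl
  rw [hx', hy'] at h
  exact h

lemma irreducibleSpace_of_grpObj {K : Type u} [Field K] [IsAlgClosed K] {Y : Scheme.{u}}
    (f : Y ⟶ Spec (.of K)) [LocallyOfFiniteType f] [QuasiCompact f] [GrpObj (Over.mk f)]
    [ConnectedSpace Y] : IrreducibleSpace Y := by
  have := LocallyOfFiniteType.jacobsonSpace f
  have := LocallyOfFiniteType.isLocallyNoetherian f
  have : CompactSpace Y := QuasiCompact.compactSpace_of_compactSpace f
  have : IsNoetherian Y := {}
  exact irreducibleSpace_of_transitive fun x hx y hy ↦ exists_homeomorph_apply_eq f hx hy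

/-- The extension is split as k ⊂ k̄ ⊂ L. The algebraic step preserves connectedness because of the
neutral section; over k̄ translations turn this into irreducibility; and extensions of the
algebraically closed field k̄ preserve irreducibility. -/
lemma irreducibleSpace_pullback_algClosed {k L : Type u} [Field k] [Field L] [IsAlgClosed L]
    {Y : Scheme.{u}} [ConnectedSpace Y] (f : Y ⟶ Spec (.of k)) [LocallyOfFiniteType f]
    [QuasiCompact f] [GrpObj (Over.mk f)] (g : Spec (.of L) ⟶ Spec (.of k)) :
    IrreducibleSpace ↥(pullback f g) := by
  obtain ⟨φ, rfl⟩ := Spec.map_surjective g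
  let : Algebra k L := φ.hom.toAlgebra
  let i : AlgebraicClosure k →ₐ[k] L := IsAlgClosed.lift
  let g₀ := Spec.map (CommRingCat.ofHom (algebraMap k (AlgebraicClosure k)))
  let g₁ := Spec.map (CommRingCat.ofHom i.toRingHom)
  have hg : g₁ ≫ g₀ = Spec.map φ := by
    rw [← Spec.map_comp, ← CommRingCat.ofHom_comp]
    congr 1
    ext1
    exact i.comp_algebraMap
  let : GrpObj (Over.mk (pullback.snd f g₀)) := Over.grpObjMkPullbackSnd
  have : ConnectedSpace ↥(pullback f g₀) :=
    connectedSpace_pullback_of_section f η[Over.mk f].left (Over.w η[Over.mk f])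
  have := irreducibleSpace_of_grpObj (pullback.snd f g₀)
  have := geometricallyIrreducible_specField g₁
  have : IrreducibleSpace ↥(pullback (pullback.snd f g₀) g₁) := inferInstance
  rw [← hg]
  exact irreducibleSpace_of_surjective (pullbackLeftPullbackSndIso f g₀ g₁).hom.continuous
    (pullbackLeftPullbackSndIso f g₀ g₁).hom.homeomorph.surjective

/-- For an arbitrary extension F, the base change to the algebraic closure of F is irreducible and
surjects onto the base change to F. -/
lemma geometricallyIrreducible_of_grpObj {k : Type u} [Field k]
    {Y : Scheme.{u}} [ConnectedSpace Y] (f : Y ⟶ Spec (.of k)) [LocallyOfFiniteType f]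
    [QuasiCompact f] [GrpObj (Over.mk f)] : GeometricallyIrreducible f := by
  refine ⟨geometrically_iff_of_isClosedUnderIsomorphisms.2 fun F _ y ↦ ?_⟩
  let q := Spec.map (CommRingCat.ofHom (algebraMap F (AlgebraicClosure F)))
  have := irreducibleSpace_pullback_algClosed f (q ≫ y)
  have : IrreducibleSpace ↥(pullback (pullback.snd f y) q) :=
    irreducibleSpace_of_surjective (pullbackLeftPullbackSndIso f y q).inv.continuous
      (pullbackLeftPullbackSndIso f y q).inv.homeomorph.surjective
  exact irreducibleSpace_of_surjective (pullback.fst (pullback.snd f y) q).continuous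
    (pullback.fst (pullback.snd f y) q).surjective

/-- A connected smooth algebraic group is geometrically integral. -/
lemma geometricallyIntegral_of_grpObj {k : Type u} [Field k] (G : Over (Spec (.of k)))
    [GrpObj G] [Smooth G.hom] [QuasiCompact G.hom] [ConnectedSpace G.left] :
    GeometricallyIntegral G.hom := by
  have : GrpObj (Over.mk G.hom) := inferInstanceAs (GrpObj G)
  have := geometricallyReduced_of_smooth G.hom
  have := geometricallyIrreducible_of_grpObj G.hom
  exact .of_geometricallyReduced_of_geometricallyIrreducible _

end geometry

end EquivariantPicard

namespace EquivariantPicard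

/-! ### Functions determined by their values at points -/

section functions

lemma ΓSpecIso_pullFun {R S : CommRingCat.{u}} (f : R ⟶ S) (a : Γ(Spec R, ⊤)) :
    (Scheme.ΓSpecIso S).hom.hom (pullFun (Spec.map f) a) =
      f.hom ((Scheme.ΓSpecIso R).hom.hom a) :=
  congr_arg (fun g ↦ g.hom a) (Scheme.ΓSpecIso_naturality f)

lemma pullFun_specMap_injective {R S : CommRingCat.{u}} (f : R ⟶ S)
    (hf : Function.Injective f.hom) : Function.Injective (pullFun (Spec.map f)) := by
  intro a b h
  have h' := congr_arg (Scheme.ΓSpecIso S).hom.hom h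
  rw [ΓSpecIso_pullFun, ΓSpecIso_pullFun] at h'
  exact (ConcreteCategory.bijective_of_isIso (Scheme.ΓSpecIso R).hom).1 (hf h')

lemma pullFun_fromSpecStalk {Z : Scheme.{u}} (z : Z) (a : Γ(Z, ⊤)) :
    (Scheme.ΓSpecIso _).hom.hom (pullFun (Z.fromSpecStalk z) a) =
      (Z.presheaf.germ ⊤ z trivial).hom a := by
  rw [pullFun, Scheme.fromSpecStalk_appTop]
  change ((Z.presheaf.germ ⊤ z trivial) ≫ (Scheme.ΓSpecIso _).inv ≫ (Scheme.ΓSpecIso _).hom).hom a = _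
  rw [Iso.inv_hom_id, Category.comp_id]

lemma pullFun_fromSpecStalk_genericPoint_injective (Z : Scheme.{u}) [IsIntegral Z] :
    Function.Injective (pullFun (Z.fromSpecStalk (genericPoint Z))) := by
  intro a b h
  have h' := congr_arg (Scheme.ΓSpecIso _).hom.hom h
  rw [pullFun_fromSpecStalk, pullFun_fromSpecStalk] at h'
  exact germ_injective_of_isIntegral Z _ _ h'

/-- A function on a reduced scheme is determined by its values at geometric points. -/
lemma eq_of_forall_geometric_point {Z : Scheme.{u}} [AlgebraicGeometry.IsReduced Z] {a b : Γ(Z, ⊤)}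
    (h : ∀ (Ω : Type u) [Field Ω] [IsAlgClosed Ω] (p : Spec (.of Ω) ⟶ Z),
      pullFun p a = pullFun p b) : a = b := by
  -- On a reduced scheme a function is zero once the open set where it does not vanish is empty.
  -- Non-vanishing at a point is detected in an algebraic closure of the residue field.
  rw [← sub_eq_zero, ← basicOpen_eq_bot_iff, ← le_bot_iff]
  intro z hz
  let i := CommRingCat.ofHom (algebraMap (Z.residueField z) (AlgebraicClosure (Z.residueField z)))
  have h₁ : pullFun (Z.fromSpecResidueField z) (a - b) = 0 := by
    refine pullFun_specMap_injective i (algebraMap (Z.residueField z) _).injective ?_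
    rw [map_zero, ← pullFun_comp, map_sub, sub_eq_zero]
    exact h _ _
  have hz : IsUnit ((Z.presheaf.germ ⊤ z trivial).hom (a - b)) :=
    (Scheme.mem_basicOpen_top _ _ _).1 hz
  have h₂ : (Z.residue z).hom ((Z.presheaf.germ ⊤ z trivial).hom (a - b)) = 0 := by
    rw [← pullFun_fromSpecStalk, ← ΓSpecIso_pullFun, ← pullFun_comp]
    rw [← Scheme.fromSpecResidueField, h₁, map_zero]
  exact ((hz.map (Z.residue z).hom).ne_zero h₂).elim

end functions

/-! ### Rigidity near the neutral element -/

section affine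

variable {k : Type u} [Field k]

/-- The spectrum of a `k`-algebra, as a scheme over `k`. -/
noncomputable abbrev specOver (k R : Type u) [Field k] [CommRing R] [Algebra k R] : Over (Spec (.of k)) :=
  Over.mk (Spec.map (CommRingCat.ofHom (algebraMap k R)))

/-- The morphism of spectra given by a homomorphism of `k`-algebras. -/
noncomputable abbrev specOverMap {R S : Type u} [CommRing R] [CommRing S] [Algebra k R] [Algebra k S]
    (f : R →ₐ[k] S) : specOver k S ⟶ specOver k R :=
  Over.homMk (Spec.map (CommRingCat.ofHom f.toRingHom)) (by
    change _ ≫ Spec.map _ = Spec.map _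
    rw [← Spec.map_comp, ← CommRingCat.ofHom_comp]
    congr 2
    exact f.comp_algebraMap)

lemma specOverMap_comp {R S T : Type u} [CommRing R] [CommRing S] [CommRing T] [Algebra k R]
    [Algebra k S] [Algebra k T] (f : R →ₐ[k] S) (g : S →ₐ[k] T) :
    specOverMap g ≫ specOverMap f = specOverMap (g.comp f) := by
  ext1
  change Spec.map _ ≫ Spec.map _ = Spec.map _
  rw [← Spec.map_comp]
  rfl

lemma exists_specOverMap {R S : Type u} [CommRing R] [CommRing S] [Algebra k R]
    [Algebra k S] (p : specOver k S ⟶ specOver k R) : ∃ f : R →ₐ[k] S, specOverMap f = p := by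
  obtain ⟨f, hf⟩ := Spec.map_surjective p.left
  have hw := Over.w p
  change p.left ≫ Spec.map _ = Spec.map _ at hw
  rw [← hf, ← Spec.map_comp] at hw
  have hw' := Spec.map_injective hw
  refine ⟨⟨f.hom, fun r ↦ ?_⟩, ?_⟩
  · exact congr_arg (fun q ↦ q.hom r) hw'
  · ext1
    exact hf

variable {G X : Over (Spec (.of k))} [GrpObj G]

variable (φ : ∀ {T : Over (Spec (.of k))}, (T ⟶ G) → (T ⟶ G) → (T ⟶ X) → Γ(T.left, ⊤)ˣ)

/-- Here `φ` stands for an invertible function on G × G × X given on points, and `j` for a chart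
Spec C of G around the neutral element, which is the image of `e`. At a fixed geometric point `x`,
`φ` becomes a unit of C ⊗ C equal to 1 on both axes, so it is 1; every pair of points of the chart
is a specialization of the universal pair. -/
lemma units_specOver_eq_one {Ω C : Type u} [Field Ω] [IsAlgClosed Ω] [Algebra k Ω]
    [CommRing C] [IsDomain C] [Algebra k C] [Algebra Ω C] [IsScalarTower k Ω C]
    (e : C →ₐ[Ω] Ω) (j : specOver k C ⟶ G) (he : specOverMap (e.restrictScalars k) ≫ j = 1)
    (x : specOver k Ω ⟶ X)
    (nat : ∀ {S T : Over (Spec (.of k))} (f : S ⟶ T) (g h : T ⟶ G) (x : T ⟶ X),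
      unitPull f (φ g h x) = φ (f ≫ g) (f ≫ h) (f ≫ x))
    (h₁ : ∀ {T : Over (Spec (.of k))} (h : T ⟶ G) (x : T ⟶ X), φ 1 h x = 1)
    (h₂ : ∀ {T : Over (Spec (.of k))} (g : T ⟶ G) (x : T ⟶ X), φ g 1 x = 1)
    {F : Type u} [CommRing F] [Algebra k F] [Algebra Ω F] [IsScalarTower k Ω F]
    (a b : C →ₐ[Ω] F) :
    φ (specOverMap (a.restrictScalars k) ≫ j) (specOverMap (b.restrictScalars k) ≫ j)
      (specOverMap (IsScalarTower.toAlgHom k Ω F) ≫ x) = 1 := by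
  let D := TensorProduct Ω C C
  let l : C →ₐ[Ω] D := Algebra.TensorProduct.includeLeft
  let r : C →ₐ[Ω] D := Algebra.TensorProduct.includeRight
  -- The value of `φ` at the universal pair of points of the chart.
  let w := φ (specOverMap (l.restrictScalars k) ≫ j) (specOverMap (r.restrictScalars k) ≫ j)
    (specOverMap (IsScalarTower.toAlgHom k Ω D) ≫ x)
  have hpull {E : Type u} [CommRing E] [Algebra k E] [Algebra Ω E] [IsScalarTower k Ω E]
      (q : D →ₐ[Ω] E) : unitPull (specOverMap (q.restrictScalars k)) w =
        φ (specOverMap ((q.comp l).restrictScalars k) ≫ j)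
          (specOverMap ((q.comp r).restrictScalars k) ≫ j)
          (specOverMap (IsScalarTower.toAlgHom k Ω E) ≫ x) := by
    rw [nat, ← Category.assoc, ← Category.assoc, ← Category.assoc, specOverMap_comp,
      specOverMap_comp, specOverMap_comp]
    congr 3
    ext a
    exact q.commutes a
  have hone {E : Type u} [CommRing E] [Algebra k E] [Algebra Ω E] [IsScalarTower k Ω E]
      (q : Ω →ₐ[Ω] E) : specOverMap ((q.comp e).restrictScalars k) ≫ j = 1 := by
    have : (q.comp e).restrictScalars k =
      (q.restrictScalars k).comp (e.restrictScalars k) := rfl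
    rw [this, ← specOverMap_comp, Category.assoc, he, MonObj.comp_one]
  let w' : Dˣ := Units.map (Scheme.ΓSpecIso (.of D)).hom.hom.toMonoidHom w
  have hval {E : Type u} [CommRing E] [Algebra k E] [Algebra Ω E] [IsScalarTower k Ω E]
      (q : D →ₐ[Ω] E) (h : unitPull (specOverMap (q.restrictScalars k)) w = 1) :
      q w' = 1 := by
    refine (ΓSpecIso_pullFun (CommRingCat.ofHom q.toRingHom) w.val).symm.trans ?_
    refine (congr_arg (fun v : Γ(Spec (.of E), ⊤)ˣ ↦
      (Scheme.ΓSpecIso (.of E)).hom.hom (v : Γ(Spec (.of E), ⊤))) h).trans ?_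
    rw [Units.val_one, map_one]
  have hw' : w' = 1 := by
    -- Evaluating the second factor at `e` puts the second group element at 1, where `h₂` applies;
    -- evaluating the first factor leads to `h₁`.
    refine unit_tensorProduct_eq_one e e w' ?_ ?_
    · refine hval ((evalRight C e).restrictScalars Ω) ?_
      rw [hpull]
      have : ((evalRight C e).restrictScalars Ω).comp r = (Algebra.ofId Ω C).comp e := by
        ext c
        simp [r, evalRight_tmul, Algebra.ofId_apply, Algebra.algebraMap_eq_smul_one]
      rw [this, hone, h₂]
    · refine hval (Algebra.TensorProduct.map e (AlgHom.id Ω C)) ?_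
      rw [hpull]
      have : (Algebra.TensorProduct.map e (AlgHom.id Ω C)).comp l =
          (Algebra.TensorProduct.includeLeft : Ω →ₐ[Ω] TensorProduct Ω Ω C).comp e := by
        ext c
        simp [l]
      rw [this, hone, h₁]
  have hw : w = 1 := by
    ext
    refine (ConcreteCategory.bijective_of_isIso (Scheme.ΓSpecIso (.of D)).hom).1 ?_
    refine (congr_arg Units.val hw').trans ?_
    exact (map_one (Scheme.ΓSpecIso (.of D)).hom.hom).symm
  -- The pair (a, b) is the pull-back of the universal pair along the homomorphism C ⊗ C → F defined
  -- by `a` and `b`.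
  have := hpull (Algebra.TensorProduct.lift a b fun _ _ ↦ Commute.all _ _)
  rw [hw, map_one] at this
  convert this.symm using 4
  · exact (congr_arg _ (Algebra.TensorProduct.lift_comp_includeLeft a b _)).symm
  · exact (congr_arg _ (Algebra.TensorProduct.lift_comp_includeRight' a b _)).symm

/-- An affine open neighbourhood of the neutral element. -/
lemma exists_affine_nhds_one (G : Over (Spec (.of k))) [GrpObj G] :
    ∃ (A : Type u) (_ : CommRing A) (_ : Algebra k A) (j : specOver k A ⟶ G) (ε : A →ₐ[k] k),
      IsOpenImmersion j.left ∧ specOverMap ε ≫ j = 1 := by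
  let p : specOver k k ⟶ G := 1
  let z : Spec (.of k) := IsLocalRing.closedPoint k
  obtain ⟨U, hU, hz, -⟩ := exists_isAffineOpen_mem_and_subset (U := ⊤) (x := p.left z) trivial
  obtain ⟨i, hi⟩ := Spec.map_surjective (hU.fromSpec ≫ G.hom)
  let : Algebra k Γ(G.left, U) := i.hom.toAlgebra
  let j : specOver k Γ(G.left, U) ⟶ G := Over.homMk hU.fromSpec hi.symm
  have hj : IsOpenImmersion j.left := inferInstanceAs (IsOpenImmersion hU.fromSpec)
  -- Spec k has a single point, so the neutral section factors through any open subscheme containing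
  -- its image.
  have hr : Set.range p.left ⊆ Set.range j.left := by
    rintro _ ⟨y, rfl⟩
    have hy : y = z := Subsingleton.elim (α := PrimeSpectrum k) y z
    have : Set.range j.left = U := hU.range_fromSpec
    rw [hy, this]
    exact hz
  let p' : specOver k k ⟶ specOver k Γ(G.left, U) :=
    Over.homMk (IsOpenImmersion.lift j.left p.left hr) (by
      rw [← Over.w p, ← Over.w j, ← Category.assoc, IsOpenImmersion.lift_fac])
  obtain ⟨ε, hε⟩ := exists_specOverMap p'
  refine ⟨Γ(G.left, U), inferInstance, inferInstance, j, ε, hj, ?_⟩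
  rw [hε]
  ext1
  exact IsOpenImmersion.lift_fac _ _ _

/-- Spec (Ω ⊗ A) is a nonempty open subscheme of the base change of `G` to `Ω`, which is integral by
geometric integrality. -/
lemma isDomain_tensorProduct_of_isOpenImmersion (G : Over (Spec (.of k))) [GeometricallyIntegral G.hom]
    {A Ω : Type u} [CommRing A] [Algebra k A] [Field Ω] [Algebra k Ω] [Nontrivial A]
    (j : specOver k A ⟶ G) [IsOpenImmersion j.left] : IsDomain (TensorProduct k Ω A) := by
  have : Nontrivial (TensorProduct k Ω A) := inferInstance
  let s := Spec.map (CommRingCat.ofHom (algebraMap k Ω))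
  have h₁ : IsIntegral (pullback s G.hom) := inferInstance
  let m : pullback s (specOver k A).hom ⟶ pullback s G.hom :=
    pullback.map _ _ _ _ (𝟙 _) j.left (𝟙 _) (by simp) (by simp)
  have : IsOpenImmersion m := inferInstance
  let m' := (pullbackSpecIso k Ω A).inv ≫ m
  have : Nonempty (Spec (.of (TensorProduct k Ω A))) :=
    inferInstanceAs (Nonempty (PrimeSpectrum (TensorProduct k Ω A)))
  have := isIntegral_of_isOpenImmersion m'
  exact (affine_isIntegral_iff _).1 this

/-- A morphism from the generic point factors through an open subscheme if some point does. -/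
lemma exists_factor_genericPoint {P G U : Over (Spec (.of k))} [IsIntegral P.left] (j : U ⟶ G)
    [IsOpenImmersion j.left] (p : P ⟶ G) {T : Over (Spec (.of k))} [Nonempty T.left] (q : T ⟶ P)
    (r : T ⟶ U) (h : q ≫ p = r ≫ j) {F : Over (Spec (.of k))} (f : F ⟶ P)
    (hf : Set.range f.left ⊆ {y | y ⤳ genericPoint P.left}) : ∃ f' : F ⟶ U, f' ≫ j = f ≫ p := by
  have hopen : IsOpen (p.left ⁻¹' Set.range j.left) :=
    j.left.isOpenEmbedding.isOpen_range.preimage p.left.continuous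
  -- The preimage of the open subscheme is nonempty because it contains the image of `q`, so it
  -- contains the generic point, and then every point specializing to the generic point.
  have hmem : genericPoint P.left ∈ p.left ⁻¹' Set.range j.left := by
    refine ((genericPoint_spec P.left).mem_open_set_iff hopen).2 ?_
    obtain ⟨t⟩ := (inferInstance : Nonempty T.left)
    refine ⟨q.left t, trivial, r.left t, ?_⟩
    have := congr_arg (fun f ↦ f.left t) h
    simpa using this.symm
  have hr : Set.range (f ≫ p).left ⊆ Set.range j.left := by
    rintro _ ⟨y, rfl⟩
    have hy : f.left y ∈ p.left ⁻¹' Set.range j.left :=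
      (hf ⟨y, rfl⟩ : f.left y ⤳ genericPoint P.left).mem_open hopen hmem
    rw [Over.comp_left, Scheme.Hom.comp_apply]
    exact hy
  refine ⟨Over.homMk (IsOpenImmersion.lift j.left (f ≫ p).left hr) ?_, ?_⟩
  · rw [← Over.w (f ≫ p), ← Over.w j, ← Category.assoc, IsOpenImmersion.lift_fac]
  · ext1
    exact IsOpenImmersion.lift_fac _ _ _

end affine

end EquivariantPicard

namespace EquivariantPicard

/-! ### Rigidity of units on G × G × X -/

section rigidity

variable {k : Type u} [Field k]

lemma isReduced_tensorObj (G X : Over (Spec (.of k))) [Smooth G.hom]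
    [AlgebraicGeometry.IsReduced X.left] [IsLocallyNoetherian X.left] : AlgebraicGeometry.IsReduced (X ⊗ G).left := by
  have := geometricallyReduced_of_smooth G.hom
  exact inferInstanceAs (AlgebraicGeometry.IsReduced (pullback X.hom G.hom))

lemma isIntegral_tensorObj (G X : Over (Spec (.of k))) [GeometricallyIntegral G.hom]
    [IsIntegral X.left] [IsLocallyNoetherian X.left] : IsIntegral (X ⊗ G).left :=
  inferInstanceAs (IsIntegral (pullback X.hom G.hom))

lemma isLocallyNoetherian_tensorObj (G X : Over (Spec (.of k))) [LocallyOfFiniteType G.hom]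
    [IsLocallyNoetherian X.left] : IsLocallyNoetherian (X ⊗ G).left :=
  LocallyOfFiniteType.isLocallyNoetherian (pullback.fst X.hom G.hom)

variable {G X : Over (Spec (.of k))} [GrpObj G] [Smooth G.hom] [QuasiCompact G.hom]
  [ConnectedSpace G.left]
  (φ : ∀ {T : Over (Spec (.of k))}, (T ⟶ G) → (T ⟶ G) → (T ⟶ X) → Γ(T.left, ⊤)ˣ)

/-- With `x` fixed, `φ` is a unit on G_Ω × G_Ω, which is integral, so its value at the generic point
decides. That point lies in the product of two copies of an affine neighbourhood of the neutral
element, where the result for tensor products of domains applies. -/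
lemma units_eq_one_of_algClosed
    (nat : ∀ {S T : Over (Spec (.of k))} (f : S ⟶ T) (g h : T ⟶ G) (x : T ⟶ X),
      unitPull f (φ g h x) = φ (f ≫ g) (f ≫ h) (f ≫ x))
    (h₁ : ∀ {T : Over (Spec (.of k))} (h : T ⟶ G) (x : T ⟶ X), φ 1 h x = 1)
    (h₂ : ∀ {T : Over (Spec (.of k))} (g : T ⟶ G) (x : T ⟶ X), φ g 1 x = 1)
    {Ω : Type u} [Field Ω] [IsAlgClosed Ω] [Algebra k Ω]
    (x : specOver k Ω ⟶ X) (g h : specOver k Ω ⟶ G) : φ g h x = 1 := by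
  have := geometricallyIntegral_of_grpObj G
  obtain ⟨A, _, _, j, ε, hj, hε⟩ := exists_affine_nhds_one G
  have : Nontrivial A := ε.toRingHom.domain_nontrivial
  have : IsDomain (TensorProduct k Ω A) := isDomain_tensorProduct_of_isOpenImmersion G j
  let S := specOver k Ω
  have : IsIntegral S.left := inferInstanceAs (IsIntegral (Spec (.of Ω)))
  have : IsLocallyNoetherian S.left := inferInstanceAs (IsLocallyNoetherian (Spec (.of Ω)))
  have := isIntegral_tensorObj G S
  have := isLocallyNoetherian_tensorObj G S
  let P := (S ⊗ G) ⊗ G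
  have : IsIntegral P.left := isIntegral_tensorObj G (S ⊗ G)
  have : Nonempty S.left := inferInstanceAs (Nonempty (PrimeSpectrum Ω))
  let w := φ (fst _ _ ≫ snd S G : P ⟶ G) (snd _ _ : P ⟶ G) ((fst _ _ ≫ fst S G : P ⟶ S) ≫ x)
  suffices hw : w = 1 by
    have := congr_arg (unitPull (lift (lift (𝟙 S) g) h)) hw
    simpa [w, nat] using this
  let F : Type u := P.left.presheaf.stalk (genericPoint P.left)
  let q : Spec (.of F) ⟶ P.left := P.left.fromSpecStalk (genericPoint P.left)
  obtain ⟨i, hi⟩ := Spec.map_surjective (q ≫ P.hom)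
  let : Algebra k F := i.hom.toAlgebra
  let Q : specOver k F ⟶ P := Over.homMk q hi.symm
  have hQ : Set.range Q.left ⊆ {y | y ⤳ genericPoint P.left} :=
    (Scheme.range_fromSpecStalk (X := P.left) (x := genericPoint P.left)).le
  let e₀ : A →ₐ[k] Ω := (Algebra.ofId k Ω).comp ε
  have he₀ : specOverMap e₀ ≫ j = 1 := by
    rw [← specOverMap_comp, Category.assoc, hε, MonObj.comp_one]
  -- The point (1, 1) maps into the affine neighbourhood under both projections, so both projections
  -- of the generic point land in it as well.
  obtain ⟨a', ha'⟩ := exists_factor_genericPoint j (fst _ _ ≫ snd S G : P ⟶ G)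
    (lift (lift (𝟙 S) 1) 1) (specOverMap e₀) (by rw [he₀]; simp) Q hQ
  obtain ⟨b', hb'⟩ := exists_factor_genericPoint j (snd _ _ : P ⟶ G)
    (lift (lift (𝟙 S) 1) 1) (specOverMap e₀) (by rw [he₀]; simp) Q hQ
  obtain ⟨a, rfl⟩ := exists_specOverMap a'
  obtain ⟨b, rfl⟩ := exists_specOverMap b'
  -- The generic stalk becomes an `Ω`-algebra through the projection of `P` to Spec Ω. This makes
  -- the two coordinates of the generic point points of the chart over `Ω`.
  obtain ⟨c, hc⟩ := exists_specOverMap (Q ≫ (fst _ _ ≫ fst S G : P ⟶ S))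
  let : Algebra Ω F := c.toRingHom.toAlgebra
  have : IsScalarTower k Ω F := .of_algHom c
  let C := TensorProduct k Ω A
  let r : A →ₐ[k] C := Algebra.TensorProduct.includeRight
  let e : C →ₐ[Ω] Ω := Algebra.TensorProduct.lift (AlgHom.id Ω Ω) e₀ fun _ _ ↦ .all _ _
  let a₁ : C →ₐ[Ω] F := Algebra.TensorProduct.lift (Algebra.ofId Ω F) a fun _ _ ↦ .all _ _
  let b₁ : C →ₐ[Ω] F := Algebra.TensorProduct.lift (Algebra.ofId Ω F) b fun _ _ ↦ .all _ _
  have he : (e.restrictScalars k).comp r = e₀ := Algebra.TensorProduct.lift_comp_includeRight _ _ _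
  have ha : (a₁.restrictScalars k).comp r = a := Algebra.TensorProduct.lift_comp_includeRight _ _ _
  have hb : (b₁.restrictScalars k).comp r = b := Algebra.TensorProduct.lift_comp_includeRight _ _ _
  have key := units_specOver_eq_one φ e (specOverMap r ≫ j)
    (by rw [← Category.assoc, specOverMap_comp, he, he₀]) x nat h₁ h₂ a₁ b₁
  have hc' : IsScalarTower.toAlgHom k Ω F = c := rfl
  simp only [← Category.assoc] at key
  rw [specOverMap_comp, specOverMap_comp, ha, hb, hc', hc, ha', hb', Category.assoc, ← nat] at key
  ext
  -- `key` says that `w` is 1 at the generic point of the integral scheme `P`.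
  exact pullFun_fromSpecStalk_genericPoint_injective P.left
    ((congr_arg Units.val key).trans (map_one _).symm)

variable [AlgebraicGeometry.IsReduced X.left] [IsLocallyNoetherian X.left]

/-- An invertible function on `G × G × X` which is trivial on `1 × G × X` and on `G × 1 × X` is
trivial. -/
theorem units_eq_one
    (nat : ∀ {S T : Over (Spec (.of k))} (f : S ⟶ T) (g h : T ⟶ G) (x : T ⟶ X),
      unitPull f (φ g h x) = φ (f ≫ g) (f ≫ h) (f ≫ x))
    (h₁ : ∀ {T : Over (Spec (.of k))} (h : T ⟶ G) (x : T ⟶ X), φ 1 h x = 1)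
    (h₂ : ∀ {T : Over (Spec (.of k))} (g : T ⟶ G) (x : T ⟶ X), φ g 1 x = 1)
    {T : Over (Spec (.of k))} (g h : T ⟶ G) (x : T ⟶ X) : φ g h x = 1 := by
  have := isReduced_tensorObj G X
  have := isLocallyNoetherian_tensorObj G X
  let P := (X ⊗ G) ⊗ G
  have : AlgebraicGeometry.IsReduced P.left := isReduced_tensorObj G (X ⊗ G)
  -- By naturality it suffices to treat the universal point of X × G × G.
  let w := φ (fst _ _ ≫ snd X G : P ⟶ G) (snd _ _ : P ⟶ G) (fst _ _ ≫ fst X G : P ⟶ X)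
  suffices hw : w = 1 by
    have := congr_arg (unitPull (lift (lift x g) h)) hw
    simpa [w, nat] using this
  ext
  -- The product is reduced, so geometric points suffice; at such a point the component in `X` is a
  -- point over an algebraically closed field.
  refine eq_of_forall_geometric_point fun Ω _ _ p ↦ ?_
  obtain ⟨i, hi⟩ := Spec.map_surjective (p ≫ P.hom)
  let : Algebra k Ω := i.hom.toAlgebra
  let Q : specOver k Ω ⟶ P := Over.homMk p hi.symm
  have : unitPull Q w = 1 := by
    rw [nat]
    exact units_eq_one_of_algClosed φ nat h₁ h₂ _ _ _
  exact (congr_arg Units.val this).trans (map_one _).symm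

end rigidity

end EquivariantPicard

namespace EquivariantPicard

open LineBundle LinearizedBundle

/-! ### Coboundaries and products of cocycles -/

section functions

variable {B : Scheme.{u}} {G X : Over B}

lemma unitPull_comp {S T : Over B} (f : S ⟶ T) (g : T ⟶ X) (a : Γ(X.left, ⊤)ˣ) :
    unitPull (f ≫ g) a = unitPull f (unitPull g a) := by
  ext
  exact pullFun_comp _ _ _

lemma unitPull_valueAt (c : Γ((G ⊗ X).left, ⊤)ˣ) {S T : Over B} (f : S ⟶ T) (g : T ⟶ G)
    (x : T ⟶ X) : unitPull f (valueAt c g x) = valueAt c (f ≫ g) (f ≫ x) :=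
  pullFun_valueAt c f g x

lemma valueAt_fst_snd (c : Γ((G ⊗ X).left, ⊤)ˣ) : valueAt c (fst G X) (snd G X) = c := by
  ext
  change pullFun (lift (fst G X) (snd G X)).left _ = _
  rw [lift_fst_snd]
  exact pullFun_id _ _

/-- Taking the universal point (the two projections) recovers the function, so identities between
functions on G × X can be checked on points. -/
lemma units_ext {c d : Γ((G ⊗ X).left, ⊤)ˣ}
    (h : ∀ {T : Over B} (g : T ⟶ G) (x : T ⟶ X), valueAt c g x = valueAt d g x) : c = d := by
  rw [← valueAt_fst_snd c, h, valueAt_fst_snd]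

variable [GrpObj G]

lemma valueAt_one_of_mem_characters {c : Γ((G ⊗ X).left, ⊤)ˣ} (hc : c ∈ characters G X)
    {T : Over B} (x : T ⟶ X) : valueAt c 1 x = 1 := by
  have := hc T 1 1 x
  rwa [mul_one, left_eq_mul] at this

variable [ModObj G X]

variable (G) in
/-- The function `f(g • x) / f(x)` on `G × X`. -/
noncomputable def coboundary : Γ(X.left, ⊤)ˣ →* Γ((G ⊗ X).left, ⊤)ˣ :=
  unitPull γ[G, X] / unitPull (snd G X)

lemma valueAt_coboundary (f : Γ(X.left, ⊤)ˣ) {T : Over B} (g : T ⟶ G) (x : T ⟶ X) :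
    valueAt (coboundary G f) g x = unitPull (g • x) f / unitPull x f := by
  refine (map_div (unitPull (lift g x)) _ _).trans ?_
  rw [← unitPull_comp, ← unitPull_comp, lift_snd]
  rfl

lemma unitPull_action_eq (f : Γ(X.left, ⊤)ˣ) :
    unitPull γ[G, X] f = coboundary G f * unitPull (snd G X) f := by
  rw [coboundary, MonoidHom.div_apply, div_mul_cancel]

lemma lineAct_pairOver (c d : Γ((G ⊗ X).left, ⊤)ˣ) {T : Over B} (g : T ⟶ G)
    (l m : T ⟶ (trivial X.left).toOver)
    (h : l ≫ (trivial X.left).π = m ≫ (trivial X.left).π)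
    (h' : lineAct c g l ≫ (trivial X.left).π = lineAct d g m ≫ (trivial X.left).π) :
    lineAct (c * d) g ((unitPairing (trivial X.left)).pairOver l m h) =
      (unitPairing (trivial X.left)).pairOver (lineAct c g l) (lineAct d g m) h' := by
  apply lineOver_ext
  · rw [lineAct, lineOver_π, TensorPairing.pairOver_π, TensorPairing.pairOver_π, lineAct,
      lineOver_π]
  · refine Eq.trans ?_ (lineCoord_linePt _ _).symm
    simp only [lineAct, lineCoord_lineOver]
    rw [TensorPairing.pairOver_π, ← h, valueAt_mul, Units.val_mul]
    refine (congr_arg _ (lineCoord_linePt _ _)).trans ?_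
    exact mul_mul_mul_comm _ _ _ _

/-- Because (c s)(d t) = (c d)(s t), multiplication of fibre coordinates is equivariant. This is
what makes `linearize` a homomorphism. -/
lemma equivariant_ofCocycle {c d : Γ((G ⊗ X).left, ⊤)ˣ} (hc : IsCocycle c) (hd : IsCocycle d)
    (hcd : IsCocycle (c * d)) : Equivariant (L := ofCocycle c hc) (M := ofCocycle d hd)
      (N := ofCocycle (c * d) hcd) (unitPairing (trivial X.left)) := by
  intro T g l m h
  have hc' : g • l = lineAct c g l := ofCocycle_smul _ _ _ _
  have hd' : g • m = lineAct d g m := ofCocycle_smul _ _ _ _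
  have h' : lineAct c g l ≫ (trivial X.left).π = lineAct d g m ≫ (trivial X.left).π :=
    (lineOver_π _ _).trans ((congr_arg (g • ·) h).trans (lineOver_π _ _).symm)
  refine (ofCocycle_smul _ _ _ _).trans ((lineAct_pairOver c d g l m h h').trans ?_)
  exact TensorPairing.pairOver_congr _ _ hc'.symm hd'.symm

end functions

/-! ### Characters as cocycles -/

section group

variable {k : Type u} [Field k] {G X : Over (Spec (.of k))} [GrpObj G] [Smooth G.hom]
  [QuasiCompact G.hom] [ConnectedSpace G.left] [AlgebraicGeometry.IsReduced X.left]
  [IsLocallyNoetherian X.left]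

/-- An invertible function on `G × X` which is trivial on `1 × X` is a character. -/
lemma mem_characters_of_normalized {c : Γ((G ⊗ X).left, ⊤)ˣ}
    (hc : ∀ {T : Over (Spec (.of k))} (x : T ⟶ X), valueAt c 1 x = 1) : c ∈ characters G X := by
  intro T g h x
  -- The defect of multiplicativity is 1 whenever one of the two group elements is 1, so rigidity
  -- removes it.
  have := units_eq_one (fun g h x ↦ valueAt c (g * h) x / (valueAt c g x * valueAt c h x))
    (fun f g h x ↦ by simp only [map_div, map_mul, unitPull_valueAt, MonObj.comp_mul])
    (fun h x ↦ by rw [one_mul, hc, one_mul, div_self'])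
    (fun h x ↦ by rw [mul_one, hc, mul_one, div_self']) g h x
  exact div_eq_one.1 this

variable [ModObj G X]

/-- The quotient c(g, hx) / c(g, x) is 1 for g = 1 and for h = 1, so by rigidity a character is
unchanged by translating x. For such functions the character identity and the cocycle identity
coincide. -/
lemma isCocycle_of_mem_characters {c : Γ((G ⊗ X).left, ⊤)ˣ} (hc : c ∈ characters G X) :
    IsCocycle c := by
  intro T g h x
  have := units_eq_one (fun g h x ↦ valueAt c g (h • x) / valueAt c g x)
    (fun f g h x ↦ by simp only [map_div, unitPull_valueAt, ModObj.comp_smul])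
    (fun h x ↦ by rw [valueAt_one_of_mem_characters hc, valueAt_one_of_mem_characters hc, div_self'])
    (fun h x ↦ by rw [one_smul, div_self']) g h x
  rw [hc T g h x, div_eq_one.1 this]

/-- At g = 1 the quotient f(gx) / f(x) is 1, and normalized units are characters. -/
lemma coboundary_mem_characters (f : Γ(X.left, ⊤)ˣ) : coboundary G f ∈ characters G X :=
  mem_characters_of_normalized fun x ↦ by rw [valueAt_coboundary, one_smul, div_self']

variable (G X) in
/-- The homomorphism which sends a function `f` to the character `f(g • x) / f(x)`. -/
noncomputable def toCharacters : Γ(X.left, ⊤)ˣ →* characters G X :=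
  (coboundary G).codRestrict _ coboundary_mem_characters

variable (G X) in
/-- The homomorphism which sends a character `c` to the trivial line bundle linearized by
`g • (x, t) = (g • x, c(g, x) t)`. -/
noncomputable def linearize : characters G X →* EquivPic G X :=
  MonoidHom.mk' (fun c ↦ EquivPic.mk (ofCocycle c (isCocycle_of_mem_characters c.2))) fun _ _ ↦
    (EquivPic.mk_mul (equivariant_ofCocycle _ _ _)).symm

end group

end EquivariantPicard

namespace EquivariantPicard

open LineBundle LinearizedBundle

/-! ### Points of line bundles over the base scheme -/

section points

variable {B : Scheme.{u}} {X : Over B} {L M : LineBundle X.left}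

lemma one_smulOver {T : Over B} (l : T ⟶ L.toOver) : L.smulOver 1 l = l := by
  ext1
  exact L.one_smul _

lemma mul_smulOver {T : Over B} (a b : Γ(T.left, ⊤)) (l : T ⟶ L.toOver) :
    L.smulOver (a * b) l = L.smulOver a (L.smulOver b l) := by
  ext1
  exact L.mul_smul _ _ _

lemma frame_exists_over {T : Over B} {s : T ⟶ L.toOver} (hs : L.IsFrame s.left)
    (l : T ⟶ L.toOver) (h : l ≫ L.π = s ≫ L.π) : ∃ a : Γ(T.left, ⊤), L.smulOver a s = l := by
  obtain ⟨a, ha⟩ := frame_exists hs l.left (proj_of_π h)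
  exact ⟨a, by ext1; exact ha⟩

lemma frame_ext_over {T : Over B} {s : T ⟶ L.toOver} (hs : L.IsFrame s.left) {a b : Γ(T.left, ⊤)}
    (h : L.smulOver a s = L.smulOver b s) : a = b :=
  frame_ext hs (congr_arg CommaMorphism.left h)

lemma frame_ratio_over {T : Over B} {s t : T ⟶ L.toOver} (hs : L.IsFrame s.left)
    (ht : L.IsFrame t.left) (h : t ≫ L.π = s ≫ L.π) :
    ∃ a : Γ(T.left, ⊤)ˣ, L.smulOver a s = t := by
  obtain ⟨a, b, hab, ha, -⟩ := frame_ratio hs ht (proj_of_π h)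
  exact ⟨⟨a, b, by rw [mul_comm, hab], hab⟩, by ext1; exact ha⟩

lemma lineOver_eq_smulOver {T : Over B} (x : T ⟶ X) (a : Γ(T.left, ⊤)) :
    lineOver x a = (trivial X.left).smulOver a (lineOver x 1) := by
  apply lineOver_ext
  · rw [smulOver_π, lineOver_π, lineOver_π]
  · rw [lineCoord_lineOver]
    refine Eq.trans ?_ (lineCoord_linePt _ _).symm
    exact ((congr_arg _ (lineCoord_lineOver _ _)).trans (mul_one _)).symm

lemma eq_lineOver {T : Over B} (l : T ⟶ (trivial X.left).toOver) :
    l = lineOver (l ≫ (trivial X.left).π) (lineCoord l.left) := by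
  apply lineOver_ext
  · rw [lineOver_π]
  · rw [lineCoord_lineOver]

lemma comp_lineOver {S T : Over B} (f : S ⟶ T) (x : T ⟶ X) (a : Γ(T.left, ⊤)) :
    f ≫ lineOver x a = lineOver (f ≫ x) (pullFun f.left a) := by
  ext1
  exact comp_linePt _ _ _

/-- Multiplication by an invertible function, as an automorphism of a line bundle. -/
noncomputable def scaleIsom {Y : Scheme.{u}} (L : LineBundle Y) (f : Γ(Y, ⊤)ˣ) : LineBundle.Isom L L where
  iso :=
    { hom := L.smul (pullFun L.proj f) (𝟙 _)
      inv := L.smul (pullFun L.proj ↑f⁻¹) (𝟙 _)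
      hom_inv_id := by
        rw [L.comp_smul, ← pullFun_comp, L.smul_proj, Category.comp_id, Category.id_comp,
          ← L.mul_smul, ← map_mul, Units.inv_mul, map_one, L.one_smul]
      inv_hom_id := by
        rw [L.comp_smul, ← pullFun_comp, L.smul_proj, Category.comp_id, Category.id_comp,
          ← L.mul_smul, ← map_mul, Units.mul_inv, map_one, L.one_smul] }
  hom_proj := by rw [L.smul_proj, Category.id_comp]
  smul_hom a l := by
    simp only [L.comp_smul, ← pullFun_comp, L.smul_proj, Category.comp_id, ← L.mul_smul, mul_comm]

lemma comp_scaleIsom_homOver (f : Γ(X.left, ⊤)ˣ) {T : Over B} (l : T ⟶ L.toOver) :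
    l ≫ (scaleIsom L f).homOver = L.smulOver (unitPull (l ≫ L.π) f) l := by
  ext1
  refine (L.comp_smul _ _ _).trans ?_
  rw [← pullFun_comp]
  exact congr_arg (L.smul _) (Category.comp_id l.left)

end points

/-! ### Linearizations of the trivial line bundle -/

section exactness

variable {B : Scheme.{u}} {G X : Over B} [GrpObj G] [ModObj G X]

/-- Rescaling fibres by f turns c(g, x) t into f(gx) c(g, x) t, which is c(g, x) (f(gx) / f(x))
applied to the rescaled coordinate f(x) t. -/
lemma lineAct_scaleIsom (c : Γ((G ⊗ X).left, ⊤)ˣ) (f : Γ(X.left, ⊤)ˣ) {T : Over B} (g : T ⟶ G)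
    (l : T ⟶ (trivial X.left).toOver) :
    lineAct c g l ≫ (scaleIsom (trivial X.left) f).homOver =
      lineAct (c * coboundary G f) g (l ≫ (scaleIsom (trivial X.left) f).homOver) := by
  rw [comp_scaleIsom_homOver, comp_scaleIsom_homOver]
  apply lineOver_ext
  · simp only [smulOver_π, lineAct, lineOver_π]
  · refine (lineCoord_linePt _ _).trans ?_
    simp only [lineAct, lineOver_π, lineCoord_lineOver, smulOver_π]
    refine Eq.trans ?_ (congr_arg _ (lineCoord_linePt _ _)).symm
    rw [← mul_assoc, ← mul_assoc, ← Units.val_mul, ← Units.val_mul, valueAt_mul,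
      valueAt_coboundary, mul_assoc (valueAt c _ _), div_mul_cancel,
      mul_comm (valueAt c _ _)]

lemma nonempty_isom_of_coboundary {c d : Γ((G ⊗ X).left, ⊤)ˣ} (hc : IsCocycle c)
    (hd : IsCocycle d) (f : Γ(X.left, ⊤)ˣ) (h : c * coboundary G f = d) :
    Nonempty (LinearizedBundle.Isom (ofCocycle c hc) (ofCocycle d hd)) := by
  subst h
  refine ⟨⟨(scaleIsom (trivial X.left) f), fun {T} g l ↦ ?_⟩⟩
  refine (congr_arg (· ≫ (scaleIsom (trivial X.left) f).homOver)
    (ofCocycle_smul c hc g l)).trans ?_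
  exact (lineAct_scaleIsom c f g l).trans (ofCocycle_smul _ hd g _).symm

/-- An automorphism of the trivial line bundle is multiplication by a unit, namely the image of the
constant section 1. Equivariance then compares the two cocycles. -/
lemma coboundary_of_isom {c d : Γ((G ⊗ X).left, ⊤)ˣ} (hc : IsCocycle c) (hd : IsCocycle d)
    (e : LinearizedBundle.Isom (ofCocycle c hc) (ofCocycle d hd)) :
    ∃ f : Γ(X.left, ⊤)ˣ, c * coboundary G f = d := by
  let s : X ⟶ (trivial X.left).toOver := lineOver (𝟙 X) 1
  let eo : (trivial X.left).toOver ⟶ (trivial X.left).toOver := e.toIsom.homOver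
  have heo {T : Over B} (a : Γ(T.left, ⊤)) (l : T ⟶ (trivial X.left).toOver) :
    (trivial X.left).smulOver a l ≫ eo = (trivial X.left).smulOver a (l ≫ eo) :=
      e.toIsom.smulOver_homOver a l
  have hπ : eo ≫ (trivial X.left).π = (trivial X.left).π := e.toIsom.homOver_π
  -- The constant section 1 and its image are both frames, so their ratio is invertible.
  obtain ⟨f, hf⟩ := frame_ratio_over (L := trivial X.left) (s := s) (t := s ≫ eo)
    (isFrame_linePt _) (e.toIsom.isFrame (isFrame_linePt _)) (by rw [Category.assoc, hπ])
  have hs {T : Over B} (x : T ⟶ X) (a : Γ(T.left, ⊤)) :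
      lineOver x a ≫ eo = lineOver x (a * unitPull x f) := by
    have h₁ : lineOver x 1 = x ≫ s := by rw [comp_lineOver, map_one, Category.comp_id]
    rw [lineOver_eq_smulOver x a, heo, lineOver_eq_smulOver x (a * _), mul_smulOver, h₁,
      Category.assoc, ← hf, comp_smulOver]
    rfl
  refine ⟨f, units_ext fun g x ↦ ?_⟩
  have h : lineAct c g (lineOver x 1) ≫ eo = lineAct d g (lineOver x 1 ≫ eo) := by
    refine (congr_arg (· ≫ eo) (ofCocycle_smul c hc g (lineOver x 1))).symm.trans ?_
    exact (e.smul_homOver g _).trans (ofCocycle_smul d hd g (lineOver x 1 ≫ eo))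
  have h' := congr_arg (fun l ↦ lineCoord l.left) h
  simp only [lineAct, hs, lineOver_π, lineCoord_lineOver, mul_one, one_mul] at h'
  rw [valueAt_mul, valueAt_coboundary, mul_div_assoc', div_eq_iff_eq_mul]
  exact Units.ext h'

/-- A linearization of a trivial line bundle is given by a cocycle. -/
lemma exists_isom_ofCocycle (L : LinearizedBundle G X)
    (e : LineBundle.Isom (trivial X.left) L.bundle) :
    ∃ (c : Γ((G ⊗ X).left, ⊤)ˣ) (hc : IsCocycle c),
      Nonempty (LinearizedBundle.Isom (ofCocycle c hc) L) := by
  -- The nowhere vanishing section of the bundle corresponding to the constant section 1.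
  let s : X ⟶ L.bundle.toOver := lineOver (𝟙 X) 1 ≫ e.homOver
  have hs : L.bundle.IsFrame s.left := e.isFrame (isFrame_linePt _)
  have hs' {T : Over B} (x : T ⟶ X) : L.bundle.IsFrame (x ≫ s).left := isFrame_comp hs _
  have hsπ {T : Over B} (x : T ⟶ X) : (x ≫ s) ≫ L.bundle.π = x := by
    rw [Category.assoc, Category.assoc, e.homOver_π, lineOver_π, Category.comp_id]
  -- Over the universal point (g, x) of G × X, both g • s(x) and s(gx) are frames over gx; `c` is
  -- their ratio.
  obtain ⟨c, hc⟩ := frame_ratio_over (hs' γ[G, X])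
    (L.isFrame_smul_left (fst G X) (snd G X ≫ s) (hs' _)) (by
      rw [L.smul_π, hsπ, hsπ]
      exact (congr_arg (· ≫ γ[G, X]) lift_fst_snd).trans (Category.id_comp _))
  have key {T : Over B} (g : T ⟶ G) (x : T ⟶ X) :
      g • (x ≫ s) = L.bundle.smulOver (valueAt c g x) ((g • x) ≫ s) := by
    have := congr_arg (lift g x ≫ ·) hc
    simp only [comp_smulOver, ModObj.comp_smul, lift_fst, ← Category.assoc, lift_snd] at this
    exact this.symm
  -- Expanding (gh) • s(x) in two ways gives two multiples of the frame s(ghx), and comparing the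
  -- coefficients gives the cocycle identity.
  have hcc : IsCocycle c := by
    intro T g h x
    ext
    refine frame_ext_over (hs' ((g * h) • x)) ?_
    rw [← key, mul_smul, key h, L.smul_smulOver, key g, mul_smul, ← mul_smulOver, Units.val_mul,
      mul_comm]
  refine ⟨c, hcc, ⟨⟨e, fun {T} g l ↦ ?_⟩⟩⟩
  have he {T : Over B} (l : T ⟶ (trivial X.left).toOver) : l ≫ e.homOver =
      L.bundle.smulOver (lineCoord l.left) ((l ≫ (trivial X.left).π) ≫ s) := by
    rw [← Category.assoc, comp_lineOver, map_one, Category.comp_id, ← e.smulOver_homOver,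
      ← lineOver_eq_smulOver, ← eq_lineOver]
  have hact {T : Over B} (g : T ⟶ G) (l : T ⟶ (trivial X.left).toOver) :
      lineAct c g l ≫ e.homOver = g • (l ≫ e.homOver) := by
    rw [he, he, L.smul_smulOver, key, ← mul_smulOver, lineAct, lineOver_π, lineCoord_lineOver,
      mul_comm]
  exact (congr_arg (· ≫ e.homOver) (ofCocycle_smul c hcc g l)).trans (hact g l)

end exactness

end EquivariantPicard

namespace EquivariantPicard

open LineBundle LinearizedBundle

/-! ### Ratios of linear maps between fibres -/

section ratio

variable {B : Scheme.{u}} {X : Over B} {L : LineBundle X.left}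

/-- The function `a` on `T` is the ratio of two families of morphisms on the pull-back of `L` along
`x : T ⟶ X`. -/
def IsRatio {T : Over B} (x : T ⟶ X)
    (F₁ F₂ : ∀ ⦃S : Over B⦄, (S ⟶ T) → (S ⟶ L.toOver) → (S ⟶ L.toOver)) (a : Γ(T.left, ⊤)) : Prop :=
  ∀ ⦃S : Over B⦄ (f : S ⟶ T) (l : S ⟶ L.toOver), l ≫ L.π = f ≫ x →
    F₁ f l = L.smulOver (pullFun f.left a) (F₂ f l)

/-- A natural family of linear morphisms on the pull-backs of `L` to `T`. -/
structure IsLinearFamily {T : Over B}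
    (F : ∀ ⦃S : Over B⦄, (S ⟶ T) → (S ⟶ L.toOver) → (S ⟶ L.toOver)) : Prop where
  comp : ∀ {R S : Over B} (k : R ⟶ S) (f : S ⟶ T) (l : S ⟶ L.toOver),
    k ≫ F f l = F (k ≫ f) (k ≫ l)
  smul : ∀ {S : Over B} (f : S ⟶ T) (a : Γ(S.left, ⊤)) (l : S ⟶ L.toOver),
    F f (L.smulOver a l) = L.smulOver a (F f l)
  isFrame : ∀ {S : Over B} (f : S ⟶ T) (l : S ⟶ L.toOver), L.IsFrame l.left →
    L.IsFrame (F f l).left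

/-- Local frames, over `B`. -/
lemma exists_local_frame_over (L : LineBundle X.left) {T : Over B} (x : T ⟶ X) (t : T.left) :
    ∃ (V : T.left.Opens) (_ : t ∈ V) (l : Over.mk (V.ι ≫ T.hom) ⟶ L.toOver),
      l ≫ L.π = (Over.homMk V.ι : Over.mk (V.ι ≫ T.hom) ⟶ T) ≫ x ∧ L.IsFrame l.left := by
  obtain ⟨V, hV, s, hs, hf⟩ := L.exists_local_frame x.left t
  refine ⟨V, hV, Over.homMk s ?_, ?_, @hf⟩
  · refine (Category.assoc _ _ _).symm.trans ?_
    rw [hs, Category.assoc, Over.w]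
    rfl
  · ext1
    exact hs

variable {T : Over B} {x : T ⟶ X}
  {F₁ F₂ : ∀ ⦃S : Over B⦄, (S ⟶ T) → (S ⟶ L.toOver) → (S ⟶ L.toOver)}

/-- Functions are read as sections of the affine line over `Y`, since equality of morphisms of
schemes is local. -/
lemma eq_of_forall_exists_opens {Y : Scheme.{u}} {a b : Γ(Y, ⊤)}
    (h : ∀ y : Y, ∃ (V : Y.Opens) (_ : y ∈ V), pullFun V.ι a = pullFun V.ι b) : a = b := by
  suffices H : linePt (𝟙 Y) a = linePt (𝟙 Y) b by
    rw [← lineCoord_linePt (𝟙 Y) a, H, lineCoord_linePt]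
  refine Scheme.hom_ext_of_forall _ _ fun y ↦ ?_
  obtain ⟨V, hV, h⟩ := h y
  exact ⟨V, hV, by rw [comp_linePt, comp_linePt, h]⟩

/-- Locally there is a frame, which `F₂` carries to a frame, and multiples of a frame determine the
scalar. -/
lemma IsRatio.unique (h₂ : IsLinearFamily F₂) {a b : Γ(T.left, ⊤)} (ha : IsRatio x F₁ F₂ a)
    (hb : IsRatio x F₁ F₂ b) : a = b := by
  refine eq_of_forall_exists_opens fun t ↦ ?_
  obtain ⟨V, hV, l, hl, hf⟩ := exists_local_frame_over L x t
  exact ⟨V, hV, frame_ext_over (h₂.isFrame _ _ hf) ((ha _ l hl).symm.trans (hb _ l hl))⟩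

lemma IsRatio.res {a : Γ(T.left, ⊤)} (ha : IsRatio x F₁ F₂ a) {S : Over B} (k : S ⟶ T) :
    IsRatio (k ≫ x) (fun _ f ↦ F₁ (f ≫ k)) (fun _ f ↦ F₂ (f ≫ k)) (pullFun k.left a) := by
  intro R f l hl
  refine (ha (f ≫ k) l (by rw [hl, Category.assoc])).trans ?_
  rw [← pullFun_comp]
  rfl

lemma IsLinearFamily.res {F : ∀ ⦃S : Over B⦄, (S ⟶ T) → (S ⟶ L.toOver) → (S ⟶ L.toOver)}
    (h : IsLinearFamily F) {S : Over B} (k : S ⟶ T) : IsLinearFamily (fun _ f ↦ F (f ≫ k)) where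
  comp q f l := by rw [h.comp, Category.assoc]
  smul f a l := h.smul _ _ _
  isFrame f l := h.isFrame _ _

/-- Ratios exist over open subschemes over which there is a frame. -/
lemma exists_isRatio_of_frame (h₁ : IsLinearFamily F₁) (h₂ : IsLinearFamily F₂)
    (hπ : ∀ {S : Over B} (f : S ⟶ T) (l : S ⟶ L.toOver), l ≫ L.π = f ≫ x →
      F₁ f l ≫ L.π = F₂ f l ≫ L.π) {l : T ⟶ L.toOver} (hl : l ≫ L.π = x)
    (hf : L.IsFrame l.left) : ∃ a, IsRatio x F₁ F₂ a := by
  -- The ratio is read off on the frame. Every other point is a scalar multiple of a pull-back of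
  -- that frame, so linearity carries the relation over.
  obtain ⟨a, ha⟩ := frame_exists_over (h₂.isFrame (𝟙 T) l hf) (F₁ (𝟙 T) l)
    (hπ _ _ (by rw [hl, Category.id_comp]))
  refine ⟨a, fun S f m hm ↦ ?_⟩
  obtain ⟨b, rfl⟩ := frame_exists_over (s := f ≫ l) (isFrame_comp hf f.left) m
    (by rw [hm, Category.assoc, hl])
  have h := congr_arg (f ≫ ·) ha
  simp only [comp_smulOver, h₁.comp, h₂.comp, Category.comp_id] at h
  rw [h₁.smul, h₂.smul, ← h, ← mul_smulOver, ← mul_smulOver, mul_comm]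

/-- Ratios exist wherever there is a frame and are unique, so the local ratios glue. -/
lemma exists_isRatio (h₁ : IsLinearFamily F₁) (h₂ : IsLinearFamily F₂)
    (hπ : ∀ {S : Over B} (f : S ⟶ T) (l : S ⟶ L.toOver), l ≫ L.π = f ≫ x →
      F₁ f l ≫ L.π = F₂ f l ≫ L.π) : ∃ a, IsRatio x F₁ F₂ a := by
  -- A function on `S` is encoded as a morphism to the affine line over `T`, so that gluing of
  -- morphisms applies. The scheme `S` carries no structure over `B`, which is why the ratio
  -- property is tested after pull-back to `B`-schemes `R`.
  let P : ∀ {S : Scheme.{u}}, (S ⟶ T.left) → (S ⟶ 𝔸(PUnit.{u + 1}; T.left)) → Prop := fun {S} f p ↦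
    p ≫ 𝔸(PUnit.{u + 1}; T.left) ↘ T.left = f ∧
      ∀ ⦃R : Over B⦄ (h : R.left ⟶ S) (q : R ⟶ T), q.left = h ≫ f →
        IsRatio (q ≫ x) (fun _ j ↦ F₁ (j ≫ q)) (fun _ j ↦ F₂ (j ≫ q)) (pullFun h (lineCoord p))
  have hP {S : Over B} (k : S ⟶ T) {a : Γ(S.left, ⊤)}
      (ha : IsRatio (k ≫ x) (fun _ j ↦ F₁ (j ≫ k)) (fun _ j ↦ F₂ (j ≫ k)) a) :
      P k.left (linePt k.left a) := by
    refine ⟨linePt_over _ _, fun R h q hq ↦ ?_⟩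
    let h' : R ⟶ S := Over.homMk h (by
      rw [← Over.w q, hq, Category.assoc, Over.w])
    have hqk : q = h' ≫ k := by ext1; exact hq
    have := ha.res h'
    rw [hqk]
    simp only [Category.assoc, lineCoord_linePt] at this ⊢
    exact this
  have hloc {S : Over B} (k : S ⟶ T) (s : S.left) : ∃ (V : S.left.Opens) (_ : s ∈ V)
      (a : Γ(V, ⊤)), IsRatio (((Over.homMk V.ι : Over.mk (V.ι ≫ S.hom) ⟶ S) ≫ k) ≫ x)
        (fun _ j ↦ F₁ (j ≫ (Over.homMk V.ι : Over.mk (V.ι ≫ S.hom) ⟶ S) ≫ k))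
        (fun _ j ↦ F₂ (j ≫ (Over.homMk V.ι : Over.mk (V.ι ≫ S.hom) ⟶ S) ≫ k)) a := by
    obtain ⟨V, hV, l, hl, hf⟩ := exists_local_frame_over L (k ≫ x) s
    obtain ⟨a, ha⟩ := exists_isRatio_of_frame
      (h₁.res ((Over.homMk V.ι : Over.mk (V.ι ≫ S.hom) ⟶ S) ≫ k))
      (h₂.res ((Over.homMk V.ι : Over.mk (V.ι ≫ S.hom) ⟶ S) ≫ k))
      (fun f m hm ↦ hπ _ _ (by simpa only [Category.assoc] using hm))
      (hl.trans (Category.assoc _ _ _).symm) hf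
    exact ⟨V, hV, a, ha⟩
  obtain ⟨p, hp⟩ := exists_glue P (fun {R S} k f p ⟨hp, hr⟩ ↦
      ⟨by rw [Category.assoc, hp], fun Q h q hq ↦ by
        have := hr (h ≫ k) q (by rw [hq, Category.assoc])
        rwa [lineCoord_comp, ← pullFun_comp]⟩)
    (fun f p q ⟨hp, hr⟩ ⟨hq, hr'⟩ ↦ line_ext (hp.trans hq.symm) (by
      let j : Over.mk (f ≫ T.hom) ⟶ T := Over.homMk f
      have := (hr (R := Over.mk (f ≫ T.hom)) (𝟙 _) j (Category.id_comp f).symm).unique (h₂.res _)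
        (hr' (R := Over.mk (f ≫ T.hom)) (𝟙 _) j (Category.id_comp f).symm)
      exact (pullFun_id _ _).symm.trans (this.trans (pullFun_id _ _))))
    (fun t ↦ by
      obtain ⟨V, hV, a, ha⟩ := hloc (𝟙 T) t
      have := hP _ ha
      rw [Category.comp_id] at this
      exact ⟨V, hV, _, this⟩)
  refine ⟨lineCoord p, fun S f l hl ↦ ?_⟩
  ext1
  refine Scheme.hom_ext_of_forall _ _ fun s ↦ ?_
  obtain ⟨V, hV, a, ha⟩ := hloc f s
  refine ⟨V, hV, ?_⟩
  let i : Over.mk (V.ι ≫ S.hom) ⟶ S := Over.homMk V.ι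
  -- The glued function restricts to the local ratio, since the latter satisfies `P`; this reduces
  -- the ratio property to small open sets of the test scheme.
  have hpa : pullFun (i ≫ f).left (lineCoord p) = a := by
    rw [← lineCoord_comp, hp _ _ (hP _ ha), lineCoord_linePt]
  have := ha (𝟙 _) (i ≫ l) (by rw [Category.id_comp, Category.assoc, hl, Category.assoc])
  have h : i ≫ F₁ f l = i ≫ L.smulOver (pullFun f.left (lineCoord p)) (F₂ f l) := by
    rw [comp_smulOver, h₁.comp, h₂.comp, ← pullFun_comp]
    simp only [Category.id_comp] at this
    refine this.trans ?_
    rw [← hpa]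
    congr 1
  exact congr_arg CommaMorphism.left h

lemma IsRatio.mul {F₃ : ∀ ⦃S : Over B⦄, (S ⟶ T) → (S ⟶ L.toOver) → (S ⟶ L.toOver)}
    {a b : Γ(T.left, ⊤)} (ha : IsRatio x F₁ F₂ a) (hb : IsRatio x F₂ F₃ b) :
    IsRatio x F₁ F₃ (a * b) := by
  intro S f l hl
  rw [ha f l hl, hb f l hl, map_mul, mul_smulOver]

lemma isRatio_one : IsRatio x F₁ F₁ 1 := by
  intro S f l hl
  rw [map_one, one_smulOver]

/-- The ratio taken in the opposite order is the inverse, by uniqueness. -/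
lemma exists_units_isRatio (h₁ : IsLinearFamily F₁) (h₂ : IsLinearFamily F₂)
    (hπ : ∀ {S : Over B} (f : S ⟶ T) (l : S ⟶ L.toOver), l ≫ L.π = f ≫ x →
      F₁ f l ≫ L.π = F₂ f l ≫ L.π) : ∃ u : Γ(T.left, ⊤)ˣ, IsRatio x F₁ F₂ u := by
  obtain ⟨a, ha⟩ := exists_isRatio h₁ h₂ hπ
  obtain ⟨b, hb⟩ := exists_isRatio h₂ h₁ fun f l hl ↦ (hπ f l hl).symm
  exact ⟨⟨a, b, (ha.mul hb).unique h₁ isRatio_one, (hb.mul ha).unique h₂ isRatio_one⟩, ha⟩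

end ratio

/-! ### Associativity of normalized lifts of the translations -/

section action

variable {k : Type u} [Field k] {G X : Over (Spec (.of k))} [GrpObj G] [ModObj G X] [Smooth G.hom]
  [QuasiCompact G.hom] [ConnectedSpace G.left] [AlgebraicGeometry.IsReduced X.left]
  [IsLocallyNoetherian X.left]

/-- A normalized family of linear lifts of the translations by points of `G` is multiplicative. -/
lemma mul_act_of_normalized {L : LineBundle X.left}
    (act : ∀ ⦃T : Over (Spec (.of k))⦄, (T ⟶ G) → (T ⟶ L.toOver) → (T ⟶ L.toOver))
    (hact : IsLinearFamily act)
    (act_π : ∀ ⦃T : Over (Spec (.of k))⦄ (g : T ⟶ G) (l : T ⟶ L.toOver),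
      act g l ≫ L.π = g • (l ≫ L.π))
    (one_act : ∀ ⦃T : Over (Spec (.of k))⦄ (l : T ⟶ L.toOver), act 1 l = l)
    {T : Over (Spec (.of k))} (g h : T ⟶ G) (l : T ⟶ L.toOver) :
    act (g * h) l = act g (act h l) := by
  -- `F₁` and `F₂` are the two candidate lifts of translation by g h: the lift of the product, and
  -- the composite of the lifts.
  let F₁ {T : Over (Spec (.of k))} (g h : T ⟶ G) ⦃S : Over (Spec (.of k))⦄ (f : S ⟶ T)
    (l : S ⟶ L.toOver) : S ⟶ L.toOver := act ((f ≫ g) * (f ≫ h)) l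
  let F₂ {T : Over (Spec (.of k))} (g h : T ⟶ G) ⦃S : Over (Spec (.of k))⦄ (f : S ⟶ T)
    (l : S ⟶ L.toOver) : S ⟶ L.toOver := act (f ≫ g) (act (f ≫ h) l)
  have h₁ {T : Over (Spec (.of k))} (g h : T ⟶ G) : IsLinearFamily (F₁ g h) :=
    { comp q f l := by simp only [F₁, hact.comp, MonObj.comp_mul, Category.assoc]
      smul f a l := hact.smul _ _ _
      isFrame f l hl := hact.isFrame _ _ hl }
  have h₂ {T : Over (Spec (.of k))} (g h : T ⟶ G) : IsLinearFamily (F₂ g h) :=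
    { comp q f l := by simp only [F₂, hact.comp, Category.assoc]
      smul f a l := by simp only [F₂, hact.smul]
      isFrame f l hl := hact.isFrame _ _ (hact.isFrame _ _ hl) }
  have hex {T : Over (Spec (.of k))} (g h : T ⟶ G) (x : T ⟶ X) :=
    exists_units_isRatio (x := x) (h₁ g h) (h₂ g h)
      (fun f l _ ↦ by simp only [F₁, F₂, act_π, mul_smul])
  let φ {T : Over (Spec (.of k))} (g h : T ⟶ G) (x : T ⟶ X) := (hex g h x).choose
  have hφ {T : Over (Spec (.of k))} (g h : T ⟶ G) (x : T ⟶ X) :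
      IsRatio x (F₁ g h) (F₂ g h) (φ g h x) := (hex g h x).choose_spec
  -- By uniqueness the ratio is natural in (g, h, x), and it is 1 when g or h is 1 because `act` is
  -- the identity at the neutral element. Rigidity then makes the two lifts agree.
  have key := units_eq_one φ
    (fun {S T} f g h x ↦ by
      ext
      refine IsRatio.unique (h₂ (f ≫ g) (f ≫ h)) (x := f ≫ x) (F₁ := F₁ (f ≫ g) (f ≫ h)) ?_
        (hφ _ _ _)
      have := (hφ g h x).res f
      simp only [F₁, F₂, Category.assoc] at this ⊢
      exact this)
    (fun h x ↦ by
      ext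
      refine IsRatio.unique (h₂ 1 h) (hφ _ _ _) fun S f l _ ↦ ?_
      simp only [F₁, F₂, MonObj.comp_one, one_mul, one_act, Units.val_one, map_one, one_smulOver])
    (fun g x ↦ by
      ext
      refine IsRatio.unique (h₂ g 1) (hφ _ _ _) fun S f l _ ↦ ?_
      simp only [F₁, F₂, MonObj.comp_one, mul_one, one_act, Units.val_one, map_one, one_smulOver])
    g h (l ≫ L.π)
  have := hφ g h (l ≫ L.π) (𝟙 T) l (Category.id_comp _).symm
  rw [key, Units.val_one, map_one, one_smulOver] at this
  simpa only [F₁, F₂, Category.id_comp] using this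

end action

end EquivariantPicard

namespace EquivariantPicard

open LineBundle LinearizedBundle

/-! ### Pull-backs of line bundles in terms of points -/

section pull

variable {B : Scheme.{u}} {X Y : Over B}

/-- An isomorphism of line bundles given on points. -/
lemma exists_isom_of_points {L M : LineBundle X.left}
    (F : ∀ ⦃T : Over B⦄, (T ⟶ L.toOver) → (T ⟶ M.toOver))
    (F' : ∀ ⦃T : Over B⦄, (T ⟶ M.toOver) → (T ⟶ L.toOver))
    (hF : ∀ ⦃S T : Over B⦄ (f : S ⟶ T) (l : T ⟶ L.toOver), f ≫ F l = F (f ≫ l))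
    (hF' : ∀ ⦃S T : Over B⦄ (f : S ⟶ T) (m : T ⟶ M.toOver), f ≫ F' m = F' (f ≫ m))
    (h : ∀ ⦃T : Over B⦄ (l : T ⟶ L.toOver), F' (F l) = l)
    (h' : ∀ ⦃T : Over B⦄ (m : T ⟶ M.toOver), F (F' m) = m)
    (hπ : ∀ ⦃T : Over B⦄ (l : T ⟶ L.toOver), F l ≫ M.π = l ≫ L.π)
    (hsmul : ∀ ⦃T : Over B⦄ (a : Γ(T.left, ⊤)) (l : T ⟶ L.toOver),
      F (L.smulOver a l) = M.smulOver a (F l)) : Nonempty (LineBundle.Isom L M) := by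
  -- By the Yoneda argument, naturality reduces `F` and `F'` to composition with their values at the
  -- universal points.
  have hc ⦃T : Over B⦄ (l : T ⟶ L.toOver) : l ≫ F (𝟙 _) = F l := by rw [hF, Category.comp_id]
  have hc' ⦃T : Over B⦄ (m : T ⟶ M.toOver) : m ≫ F' (𝟙 _) = F' m := by rw [hF', Category.comp_id]
  let e : L.toOver ≅ M.toOver := ⟨F (𝟙 _), F' (𝟙 _), by rw [hc', h], by rw [hc, h']⟩
  refine ⟨⟨(Over.forget _).mapIso e, ?_, fun {T} a l ↦ ?_⟩⟩
  · exact congr_arg CommaMorphism.left ((hπ (𝟙 L.toOver)).trans (Category.id_comp _))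
  · let l' : Over.mk (l ≫ L.proj ≫ X.hom) ⟶ L.toOver := Over.homMk l
    have := hsmul a l'
    rw [← hc, ← hc l'] at this
    exact congr_arg CommaMorphism.left this

variable (f : Y ⟶ X) (L : LineBundle X.left)

/-- The morphism from the total space of a pull-back to the total space. -/
noncomputable def pullSnd : (L.pull f.left).toOver ⟶ L.toOver :=
  Over.homMk (pullback.snd f.left L.proj) (by
    change _ ≫ L.proj ≫ X.hom = pullback.fst f.left L.proj ≫ Y.hom
    rw [← Category.assoc, ← pullback.condition, Category.assoc, Over.w])

lemma pullSnd_π : pullSnd f L ≫ L.π = (L.pull f.left).π ≫ f := by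
  ext1
  exact pullback.condition.symm

variable {f L}

/-- Points of the total space of a pull-back. -/
noncomputable def pullLift {T : Over B} (y : T ⟶ Y) (l : T ⟶ L.toOver) (h : l ≫ L.π = y ≫ f) :
    T ⟶ (L.pull f.left).toOver :=
  Over.homMk (pullback.lift y.left l.left (congr_arg CommaMorphism.left h).symm) (by
    refine (Category.assoc _ _ _).symm.trans ?_
    exact (congr_arg (· ≫ Y.hom) (pullback.lift_fst _ _ _)).trans (Over.w y))

lemma pullLift_π {T : Over B} (y : T ⟶ Y) (l : T ⟶ L.toOver) (h : l ≫ L.π = y ≫ f) :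
    pullLift y l h ≫ (L.pull f.left).π = y := by
  ext1
  exact pullback.lift_fst _ _ _

lemma pullLift_snd {T : Over B} (y : T ⟶ Y) (l : T ⟶ L.toOver) (h : l ≫ L.π = y ≫ f) :
    pullLift y l h ≫ pullSnd f L = l := by
  ext1
  exact pullback.lift_snd _ _ _

lemma pull_ext {T : Over B} {p q : T ⟶ (L.pull f.left).toOver}
    (h : p ≫ (L.pull f.left).π = q ≫ (L.pull f.left).π)
    (h' : p ≫ pullSnd f L = q ≫ pullSnd f L) : p = q := by
  ext1
  exact pullback.hom_ext (congr_arg CommaMorphism.left h) (congr_arg CommaMorphism.left h')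

lemma smulOver_pullSnd {T : Over B} (a : Γ(T.left, ⊤)) (p : T ⟶ (L.pull f.left).toOver) :
    (L.pull f.left).smulOver a p ≫ pullSnd f L = L.smulOver a (p ≫ pullSnd f L) := by
  ext1
  exact pullScalar_smul_snd _ _ _ _

lemma comp_pullLift {S T : Over B} (k : S ⟶ T) (y : T ⟶ Y) (l : T ⟶ L.toOver)
    (h : l ≫ L.π = y ≫ f) :
    k ≫ pullLift y l h = pullLift (k ≫ y) (k ≫ l) (by rw [Category.assoc, h, Category.assoc]) := by
  apply pull_ext
  · simp only [Category.assoc, pullLift_π]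
  · simp only [Category.assoc, pullLift_snd]

lemma pullLift_smul {T : Over B} (a : Γ(T.left, ⊤)) (y : T ⟶ Y) (l : T ⟶ L.toOver)
    (h : l ≫ L.π = y ≫ f) : pullLift y (L.smulOver a l) (by rw [smulOver_π, h]) =
      (L.pull f.left).smulOver a (pullLift y l h) := by
  apply pull_ext
  · exact (pullLift_π _ _ _).trans ((smulOver_π _ _).trans (pullLift_π _ _ _)).symm
  · rw [smulOver_pullSnd, pullLift_snd, pullLift_snd]

lemma pullLift_congr {T : Over B} {y y' : T ⟶ Y} {l l' : T ⟶ L.toOver} (h : l ≫ L.π = y ≫ f)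
    (hy : y = y') (hl : l = l') : pullLift y l h = pullLift y' l' (by rw [← hy, ← hl, h]) := by
  subst hy hl; rfl

lemma isFrame_pullLift {T : Over B} (y : T ⟶ Y) (l : T ⟶ L.toOver) (h : l ≫ L.π = y ≫ f)
    (hl : L.IsFrame l.left) : (L.pull f.left).IsFrame (pullLift y l h).left := by
  refine isFrame_pullScalar _ _ _ ?_
  have : (pullLift y l h).left ≫ pullback.snd f.left L.proj = l.left := pullback.lift_snd _ _ _
  rw [this]
  exact @hl

lemma isFrame_pullSnd {T : Over B} (p : T ⟶ (L.pull f.left).toOver)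
    (hp : (L.pull f.left).IsFrame p.left) : L.IsFrame (p ≫ pullSnd f L).left :=
  isFrame_of_pullScalar f.left L.toScalarScheme p.left hp

variable {M : LineBundle X.left} {f' : Y ⟶ X}
  (e : LineBundle.Isom (M.pull f.left) (L.pull f'.left))

/-- The morphism from the fibre of `M` at `f(y)` to the fibre of `L` at `f'(y)` which is given by an
isomorphism of the pull-backs of `M` and `L` along `f` and `f'`. -/
noncomputable def pullTransport {T : Over B} (y : T ⟶ Y) (m : T ⟶ M.toOver)
    (h : m ≫ M.π = y ≫ f) : T ⟶ L.toOver :=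
  (pullLift y m h ≫ e.homOver) ≫ pullSnd f' L

lemma pullTransport_π {T : Over B} (y : T ⟶ Y) (m : T ⟶ M.toOver) (h : m ≫ M.π = y ≫ f) :
    pullTransport e y m h ≫ L.π = y ≫ f' := by
  rw [pullTransport, Category.assoc, pullSnd_π, ← Category.assoc, Category.assoc _ e.homOver,
    e.homOver_π, pullLift_π]

lemma comp_pullTransport {S T : Over B} (k : S ⟶ T) (y : T ⟶ Y) (m : T ⟶ M.toOver)
    (h : m ≫ M.π = y ≫ f) : k ≫ pullTransport e y m h =
      pullTransport e (k ≫ y) (k ≫ m) (by rw [Category.assoc, h, Category.assoc]) := by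
  rw [pullTransport, ← Category.assoc, ← Category.assoc, comp_pullLift]
  rfl

lemma pullTransport_congr {T : Over B} {y y' : T ⟶ Y} {m m' : T ⟶ M.toOver}
    (h : m ≫ M.π = y ≫ f) (hy : y = y') (hm : m = m') :
    pullTransport e y m h = pullTransport e y' m' (by rw [← hy, ← hm, h]) := by
  subst hy hm; rfl

lemma pullTransport_smul {T : Over B} (a : Γ(T.left, ⊤)) (y : T ⟶ Y) (m : T ⟶ M.toOver)
    (h : m ≫ M.π = y ≫ f) : pullTransport e y (M.smulOver a m) (by rw [smulOver_π, h]) =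
      L.smulOver a (pullTransport e y m h) := by
  rw [pullTransport, pullLift_smul _ _ _ h, e.smulOver_homOver, smulOver_pullSnd]
  rfl

lemma isFrame_pullTransport {T : Over B} (y : T ⟶ Y) (m : T ⟶ M.toOver) (h : m ≫ M.π = y ≫ f)
    (hm : M.IsFrame m.left) : L.IsFrame (pullTransport e y m h).left :=
  isFrame_pullSnd (pullLift y m h ≫ e.homOver) (e.isFrame (isFrame_pullLift _ _ _ hm))

lemma pullTransport_symm {T : Over B} (y : T ⟶ Y) (l : T ⟶ L.toOver) (h : l ≫ L.π = y ≫ f') :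
    pullTransport e y (pullTransport e.symm y l h) (pullTransport_π _ _ _ _) = l := by
  have : pullLift y (pullTransport e.symm y l h) (pullTransport_π _ _ _ _) =
      pullLift y l h ≫ e.symm.homOver := by
    apply pull_ext
    · rw [pullLift_π, Category.assoc, e.symm.homOver_π, pullLift_π]
    · rw [pullLift_snd, pullTransport]
  rw [pullTransport, this, Category.assoc (pullLift y l h), LinearizedBundle.Isom.symm_homOver,
    Category.comp_id, pullLift_snd]

end pull

/-! ### From a linearization to an isomorphism of pull-backs -/

section equivariant

variable {B : Scheme.{u}} {G X : Over B} [GrpObj G] [ModObj G X]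

lemma comp_action {T : Over B} (p : T ⟶ G ⊗ X) : p ≫ γ[G, X] = (p ≫ fst G X) • (p ≫ snd G X) := by
  refine Eq.trans ?_ (congr_arg (· ≫ γ[G, X]) (comp_lift p (fst G X) (snd G X)))
  rw [lift_fst_snd, Category.comp_id]

/-- A linearization of `L` gives an isomorphism of the pull-backs of `L` along the projection and
the action. -/
lemma nonempty_isom_pull (L : LinearizedBundle G X) :
    Nonempty (LineBundle.Isom (L.bundle.pull (snd G X).left)
      (L.bundle.pull (γ[G, X] : G ⊗ X ⟶ X).left)) := by
  let p (T : Over B) (l : T ⟶ (L.bundle.pull (snd G X).left).toOver) : T ⟶ G ⊗ X :=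
    l ≫ (L.bundle.pull (snd G X).left).π
  let q (T : Over B) (l : T ⟶ (L.bundle.pull (γ[G, X] : G ⊗ X ⟶ X).left).toOver) : T ⟶ G ⊗ X :=
    l ≫ (L.bundle.pull (γ[G, X] : G ⊗ X ⟶ X).left).π
  refine exists_isom_of_points
    -- On points the isomorphism is (g, x, l) ↦ (g, x, g • l), and its inverse applies g⁻¹ to the
    -- point of the bundle.
    (fun T l ↦ pullLift (p T l) ((p T l ≫ fst G X) • (l ≫ pullSnd (snd G X) L.bundle)) ?_)
    (fun T l ↦ pullLift (q T l) ((q T l ≫ fst G X)⁻¹ • (l ≫ pullSnd γ[G, X] L.bundle)) ?_)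
    ?_ ?_ ?_ ?_ ?_ ?_
  · rw [L.smul_π, Category.assoc l (pullSnd _ _), pullSnd_π, comp_action, ← Category.assoc l]
  · rw [L.smul_π, Category.assoc l (pullSnd _ _), pullSnd_π, ← Category.assoc l, comp_action,
      inv_smul_smul]
  · intro S T f l
    rw [comp_pullLift]
    apply pullLift_congr
    · simp only [p, Category.assoc]
    · simp only [p, Category.assoc, ModObj.comp_smul]
  · intro S T f l
    rw [comp_pullLift]
    apply pullLift_congr
    · simp only [q, Category.assoc]
    · simp only [q, Category.assoc, ModObj.comp_smul, GrpObj.comp_inv]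
  · intro T l
    apply pull_ext
    · simp only [p, q, pullLift_π]
    · simp only [p, q, pullLift_π, pullLift_snd, inv_smul_smul]
  · intro T l
    apply pull_ext
    · simp only [p, q, pullLift_π]
    · simp only [p, q, pullLift_π, pullLift_snd, smul_inv_smul]
  · intro T l
    rw [pullLift_π]
  · intro T a l
    apply pull_ext
    · simp only [p, smulOver_π, pullLift_π]
    · simp only [p, smulOver_π, pullLift_snd, smulOver_pullSnd, L.smul_smulOver]

end equivariant

/-! ### From an isomorphism of pull-backs to a linearization -/

section linearization

variable {k : Type u} [Field k] {G X : Over (Spec (.of k))} [GrpObj G] [ModObj G X] [Smooth G.hom]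
  [QuasiCompact G.hom] [ConnectedSpace G.left] [AlgebraicGeometry.IsReduced X.left]
  [IsLocallyNoetherian X.left]

/-- A line bundle is linearizable if its pull-back along the action is the pull-back of a line
bundle along the projection. -/
lemma exists_linearization {L M : LineBundle X.left}
    (e : LineBundle.Isom (M.pull (snd G X).left) (L.pull (γ[G, X] : G ⊗ X ⟶ X).left)) :
    ∃ Λ : LinearizedBundle G X, Λ.bundle = L := by
  have h₁ {T : Over (Spec (.of k))} (g : T ⟶ G) (m : T ⟶ M.toOver) :
      m ≫ M.π = lift g (m ≫ M.π) ≫ snd G X := (lift_snd _ _).symm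
  have h₂ {T : Over (Spec (.of k))} (l : T ⟶ L.toOver) :
      l ≫ L.π = lift 1 (l ≫ L.π) ≫ γ[G, X] := by
    rw [comp_action, lift_fst, lift_snd, one_smul]
  -- The isomorphism `e` at (g, x) is a linear map from the fibre of `M` at x to the fibre of `L` at
  -- gx.
  let ev {T : Over (Spec (.of k))} (g : T ⟶ G) (m : T ⟶ M.toOver) : T ⟶ L.toOver :=
    pullTransport e (lift g (m ≫ M.π)) m (h₁ g m)
  -- At g = 1 the isomorphism identifies `M` with `L`; this is the inverse identification.
  let inv {T : Over (Spec (.of k))} (l : T ⟶ L.toOver) : T ⟶ M.toOver :=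
    pullTransport e.symm (lift 1 (l ≫ L.π)) l (h₂ l)
  have ev_π {T : Over (Spec (.of k))} (g : T ⟶ G) (m : T ⟶ M.toOver) :
      ev g m ≫ L.π = g • (m ≫ M.π) := by
    rw [pullTransport_π, comp_action, lift_fst, lift_snd]
  have inv_π {T : Over (Spec (.of k))} (l : T ⟶ L.toOver) : inv l ≫ M.π = l ≫ L.π := by
    rw [pullTransport_π, lift_snd]
  have comp_ev {S T : Over (Spec (.of k))} (f : S ⟶ T) (g : T ⟶ G) (m : T ⟶ M.toOver) :
      f ≫ ev g m = ev (f ≫ g) (f ≫ m) :=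
    (comp_pullTransport _ _ _ _ _).trans
      (pullTransport_congr _ _ (by rw [comp_lift, Category.assoc]) rfl)
  have comp_inv {S T : Over (Spec (.of k))} (f : S ⟶ T) (l : T ⟶ L.toOver) :
      f ≫ inv l = inv (f ≫ l) :=
    (comp_pullTransport _ _ _ _ _).trans
      (pullTransport_congr _ _ (by rw [comp_lift, Category.assoc, MonObj.comp_one]) rfl)
  have ev_smul {T : Over (Spec (.of k))} (g : T ⟶ G) (a : Γ(T.left, ⊤)) (m : T ⟶ M.toOver) :
      ev g (M.smulOver a m) = L.smulOver a (ev g m) :=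
    (pullTransport_congr _ _ (congr_arg (lift g) (smulOver_π a m)) rfl).trans
      (pullTransport_smul _ _ _ _ _)
  have inv_smul {T : Over (Spec (.of k))} (a : Γ(T.left, ⊤)) (l : T ⟶ L.toOver) :
      inv (L.smulOver a l) = M.smulOver a (inv l) :=
    (pullTransport_congr _ _ (congr_arg (lift 1) (smulOver_π a l)) rfl).trans
      (pullTransport_smul _ _ _ _ _)
  have ev_inv {T : Over (Spec (.of k))} (l : T ⟶ L.toOver) : ev 1 (inv l) = l :=
    (pullTransport_congr _ _ (congr_arg (lift 1) (inv_π l)) rfl).trans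
      (pullTransport_symm e _ l (h₂ l))
  -- From L_x back to M_x by the identification at g = 1, then on to L_{gx}. By construction this is
  -- the identity at g = 1; compatibility with products comes from rigidity.
  let act ⦃T : Over (Spec (.of k))⦄ (g : T ⟶ G) (l : T ⟶ L.toOver) : T ⟶ L.toOver := ev g (inv l)
  have hact : IsLinearFamily act :=
    { comp q f l := by simp only [act, comp_ev, comp_inv]
      smul f a l := by simp only [act, inv_smul, ev_smul]
      isFrame f l hl :=
        isFrame_pullTransport _ _ _ _ (isFrame_pullTransport _ _ _ _ hl) }
  have act_π ⦃T : Over (Spec (.of k))⦄ (g : T ⟶ G) (l : T ⟶ L.toOver) :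
      act g l ≫ L.π = g • (l ≫ L.π) := by simp only [act, ev_π, inv_π]
  refine ⟨{
    bundle := L
    action := actionOfPoints (fun {T} g l ↦ @act T g l) hact.comp (fun l ↦ ev_inv l)
      (mul_act_of_normalized act hact act_π fun _ l ↦ ev_inv l)
    smul_π g l := ?_
    smul_smulOver g a l := ?_ }, rfl⟩
  · rw [actionOfPoints_smul]
    exact act_π g l
  · rw [actionOfPoints_smul, actionOfPoints_smul]
    exact hact.smul g a l

end linearization

end EquivariantPicard

/-! ### The exact sequence -/

open EquivariantPicard in
/-- For a connected smooth algebraic group `G` over a field `k` and a reduced `G`-scheme `X`,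
the sequence
`0 → 𝒪(X)^{*G} → 𝒪(X)^* → Ĝ(X) → Pic^G(X) → Pic(X) → Pic(G × X) / p₂^* Pic(X)` is exact. Here
`χ(f)` is the character with `f(g • x) = χ(f)(g, x) f(x)`, and `κ` sends a character `c` to the
class of `X × 𝔸¹` linearized by `g • (x, t) = (g • x, c(g, x) t)`. -/
theorem proposition2p8 {k : Type u} [Field k] (G X : Over (Spec (CommRingCat.of k)))
    [GrpObj G] [Smooth G.hom] [LocallyOfFiniteType G.hom] [QuasiCompact G.hom]
    [ConnectedSpace G.left] [ModObj G X] [IsSeparated X.hom] [IsLocallyNoetherian X.left]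
    [IsReduced X.left] :
    ∃ (χ : Γ(X.left, ⊤)ˣ →* characters G X) (κ : characters G X →* EquivPic G X),
      (∀ f : Γ(X.left, ⊤)ˣ,
        unitPull γ[G, X] f = (χ f : Γ((G ⊗ X).left, ⊤)ˣ) * unitPull (snd G X) f) ∧
      (∀ c : characters G X, ∃ hc : IsCocycle (c : Γ((G ⊗ X).left, ⊤)ˣ),
        κ c = EquivPic.mk (LinearizedBundle.ofCocycle c hc)) ∧
      Function.Injective (invariantUnits G X).subtype ∧
      Function.MulExact (invariantUnits G X).subtype χ ∧
      Function.MulExact χ κ ∧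
      Function.MulExact κ (EquivPic.forget G X) ∧
      Function.MulExact (EquivPic.forget G X) (obstruction G X) := by
  refine ⟨toCharacters G X, linearize G X, unitPull_action_eq, fun c ↦
    ⟨isCocycle_of_mem_characters c.2, rfl⟩, Subtype.val_injective, fun f ↦ ?_, fun c ↦ ?_,
    fun a ↦ ?_, fun a ↦ ?_⟩
  -- The character of f is the quotient of its pull-backs along the action and the projection, so it
  -- is 1 exactly when these pull-backs agree.
  · rw [Subgroup.coe_subtype, Subtype.range_coe_subtype]
    refine Subtype.ext_iff.trans ?_
    exact div_eq_one
  · constructor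
    · intro h
      obtain ⟨e⟩ := EquivPic.mk_eq_iff.1 h
      -- The neutral class is the linearization with cocycle 1, so an isomorphism from it to the
      -- linearization with cocycle `c` exhibits `c` as a coboundary.
      obtain ⟨f, hf⟩ := coboundary_of_isom isCocycle_one
        (isCocycle_of_mem_characters c.2) e.symm
      exact ⟨f, Subtype.ext ((one_mul _).symm.trans hf)⟩
    · rintro ⟨f, rfl⟩
      refine EquivPic.mk_eq_iff.2 ?_
      obtain ⟨e⟩ := nonempty_isom_of_coboundary (G := G) isCocycle_one
        (isCocycle_of_mem_characters (coboundary_mem_characters f)) f (one_mul _)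
      exact ⟨e.symm⟩
  · obtain ⟨L, rfl⟩ := EquivPic.mk_surjective a
    constructor
    · intro h
      obtain ⟨e⟩ := Pic.mk_eq_iff.1 h
      obtain ⟨c, hc, he⟩ := exists_isom_ofCocycle L e.symm
      -- The linearization only provides a cocycle; being 1 at g = 1, it is a character by rigidity.
      exact ⟨⟨c, mem_characters_of_normalized fun x ↦ hc.valueAt_one x⟩, EquivPic.mk_eq_iff.2 he⟩
    · rintro ⟨c, hc⟩
      rw [← hc]
      rfl
  · obtain ⟨L, rfl⟩ := Pic.mk_surjective a
    constructor
    · intro h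
      -- Vanishing in the quotient means that the pull-back of `L` along the action is the pull-back
      -- along the projection of some `M`, not assumed to be `L`.
      obtain ⟨b, hb⟩ := (QuotientGroup.eq_one_iff _).1 h
      obtain ⟨M, rfl⟩ := Pic.mk_surjective b
      obtain ⟨e⟩ := Pic.mk_eq_iff.1 hb
      obtain ⟨Λ, rfl⟩ := exists_linearization e
      exact ⟨EquivPic.mk Λ, rfl⟩
    · rintro ⟨b, hb⟩
      obtain ⟨Λ, rfl⟩ := EquivPic.mk_surjective b
      rw [← hb]
      -- For a linearized bundle the witness is the bundle itself.
      refine (QuotientGroup.eq_one_iff _).2 ⟨Pic.mk Λ.bundle, ?_⟩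
      exact Pic.mk_eq_iff.2 (nonempty_isom_pull Λ)
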